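/- **Languages.** Fix a countably infinite set of names. Terms are $s,t::=a\mid s\bullet t$; patterns are $p,q::=x\mid\ulcorner a\urcorner\mid p\bullet q$ (binding name, name-match, compound). Processes are $$P,Q::=\mathbf 0\mid \mathit{OutProc}\mid \mathit{InProc}\mid(\nu a)P\mid P\,|\,Q\mid \mathbf{if}\ s=t\ \mathbf{then}\ P\ \mathbf{else}\ Q\mid {*P}\mid\surd .$$ The language $\mathcal L_{\alpha,\beta,\gamma,\delta,\epsilon}$ is given by five features. $\alpha$: outputs are $\mathit{OUT}$ (asynchronous, $A$) or $\mathit{OUT}.P$ (synchronous, $S$). $\epsilon$: inputs are $\mathit{IN}.P$ (binary, $B$) or $(\mathit{IN}_1|\dots|\mathit{IN}_k)\triangleright P$ with $k\ge1$ (joining, $J$). Here $\mathit{OUT}=\overline{s}\langle t_1,\dots,t_n\rangle$ and $\mathit{IN}=s(p_1,\dots,p_n)$, where $n=1$ if $\beta=M$ (monadic) and $n$ is arbitrary if $\beta=P$ (polyadic); the channel $s$ is absent if $\gamma=D$ (dataspace) and present if $\gamma=C$ (channel); the channel and the $t_i$ are names unless $\delta=I$ (intensional), when they are arbitrary terms;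 the $p_i$ are binding names if $\delta=\mathit{NO}$, binding names or name-matches if $\delta=\mathit{NM}$, and arbitrary patterns if $\delta=I$. The binding names of an input are pairwise distinct and bind in its continuation; processes are taken up to $\alpha$-conversion. Substitutions have finite domain and map names to names, or to terms if $\delta=I$. **Semantics.** A term $t$ matches $x$ with substitution $\{t/x\}$, a name $a$ matches $\ulcorner a\urcorner$ with the empty substitution, and $s\bullet t$ matches $p\bullet q$ if $s$ matches $p$ and $t$ matches $q$, with the union of the two substitutions; sequences match componentwise and need equal length. Structural equivalence $\equiv$ is the least equivalence relation, closed under parallel composition and restriction, that contains $\alpha$-conversion and satisfies $P|\mathbf 0\equiv P$, commutativity and associativity of $|$, $\mathbf{if}\ s=t\ \mathbf{then}\ P\ \mathbf{else}\ Q\equiv P$ when $s$ and $t$ are the same term and $\equiv Q$ otherwise, $(\nu a)\mathbf 0\equiv\mathbf 0$, $(\nu a)(\nu b)P\equiv(\nu b)(\nu a)P$, $P|(\nu a)Q\equiv(\nu a)(P|Q)$ if $a\notin \mathsf{fn}(P)$, and ${*P}\equiv P|{*P}$. Reduction $\mapsto$ is the least relation closed under parallel composition, restriction and $\equiv$ such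 that $$\overline{s_1}\langle\tilde t_1\rangle.P_1|\dots|\overline{s_k}\langle\tilde t_k\rangle.P_k\,|\,(s_1(\tilde p_1)|\dots|s_k(\tilde p_k))\triangleright Q\ \mapsto\ P_1|\dots|P_k|\sigma Q$$ whenever each $\tilde t_i$ matches $\tilde p_i$ and $\sigma$ is the union of the resulting substitutions ($k=1$ in binary languages; the $P_i$ are omitted if $\alpha=A$, the $s_i$ if $\gamma=D$). Let $\Mapsto$ be its reflexive transitive closure, let $P\mapsto^\omega$ mean that $P$ has an infinite reduction sequence, and let $P\Downarrow$ mean $P\Mapsto P'\equiv P''|\surd$ for some $P',P''$. For each language fix a reference behavioural equivalence $\simeq$, which may be any equivalence relation that contains $\equiv$ and is reduction-sensitive (if $P\simeq Q$ and $Q$ can reduce, then $P$ can reduce). **Valid encodings.** An encoding of $\mathcal L_1$ into $\mathcal L_2$ is a map $[\![\cdot]\!]$ from $\mathcal L_1$-processes to $\mathcal L_2$-processes with a map $\varphi$ from names to $k$-tuples of names, for some fixed $k>0$; $\varphi$ is applied to compound terms componentwise. It is valid if: 1. for every $k$-ary operator $\mathsf{op}$ of $\mathcal L_1$ and every set $N$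 of names there is a context $C$ of $\mathcal L_2$, with $k$ holes each occurring exactly once, such that $[\![\mathsf{op}(S_1,\dots,S_k)]\!]=C[[\![S_1]\!];\dots;[\![S_k]\!]]$ whenever $\mathsf{fn}(S_1,\dots,S_k)=N$; 2. for every substitution $\sigma$ there is a substitution $\sigma'$ with $\varphi(\sigma(a))=\sigma'(\varphi(a))$ for every name $a$, such that for every $S$, $[\![\sigma S]\!]=\sigma'[\![S]\!]$ if $\sigma$ is injective as a map on all names, and $[\![\sigma S]\!]\simeq_2\sigma'[\![S]\!]$ otherwise; 3. if $S\Mapsto_1S'$ then $[\![S]\!]\Mapsto_2\simeq_2[\![S']\!]$; and if $[\![S]\!]\Mapsto_2T$ then there is $S'$ with $S\Mapsto_1S'$ and $T\Mapsto_2\simeq_2[\![S']\!]$; 4. if $[\![S]\!]\mapsto_2^\omega$ then $S\mapsto_1^\omega$; 5. $S\Downarrow_1$ if and only if $[\![S]\!]\Downarrow_2$. **Corollary.** Let $\alpha\in\{A,S\}$, $\gamma\in\{D,C\}$ and $\delta\in\{\mathit{NO},\mathit{NM},I\}$. If there exists no valid encoding from $\mathcal L_{\alpha,P,\gamma,\delta,B}$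 into $\mathcal L_{\alpha,M,\gamma,\delta,B}$, then for each $\epsilon\in\{B,J\}$ there exists no valid encoding from $\mathcal L_{\alpha,P,\gamma,\delta,\epsilon}$ into $\mathcal L_{\alpha,M,\gamma,\delta,J}$. -/

import Mathlib

namespace JoinCalc

/-! ### Names, terms, patterns -/

/-- A countably infinite set of names. -/
abbrev Name : Type := ℕ

/-- Terms `s, t ::= a | s • t`. -/
inductive Term : Type
  | name (a : Name) : Term
  | comp (s t : Term) : Term
  deriving DecidableEq

namespace Term

/-- The names occurring in a term. -/
def names : Term → Finset Name
  | name a => {a}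
  | comp s t => s.names ∪ t.names

/-- Homomorphic extension of a map from names to terms. -/
def subst (σ : Name → Term) : Term → Term
  | name a => σ a
  | comp s t => comp (s.subst σ) (t.subst σ)

/-- Renaming of the names of a term. -/
def rename (f : Name → Name) (t : Term) : Term := t.subst fun a => name (f a)

end Term

/-- Intensional patterns: binding names `x`, name-matches `⌜a⌝`, compounds `p • q`. -/
inductive Pat : Type
  | bind (x : Name) : Pat
  | mtch (a : Name) : Pat
  | comp (p q : Pat) : Pat

/-- The name-match syntax extended to terms: `⌜s • t⌝ = ⌜s⌝ • ⌜t⌝`. -/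
def Term.quote : Term → Pat
  | .name a => .mtch a
  | .comp s t => .comp s.quote t.quote

namespace Pat

/-- The binding names of a pattern, from left to right. -/
def binders : Pat → List Name
  | bind x => [x]
  | mtch _ => []
  | comp p q => p.binders ++ q.binders

/-- The free names of a pattern: the names it matches. -/
def fn : Pat → Finset Name
  | bind _ => ∅
  | mtch a => {a}
  | comp p q => p.fn ∪ q.fn

/-- Rename the binding names by `f` and the matched names by `g`. -/
def map (f g : Name → Name) : Pat → Pat
  | bind x => bind (f x)
  | mtch a => mtch (g a)
  | comp p q => comp (p.map f g) (q.map f g)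

/-- Rename the binding names by `ρ`, apply the substitution `σ` to the matched names. -/
def subst (ρ : Name → Name) (σ : Name → Term) : Pat → Pat
  | bind x => bind (ρ x)
  | mtch a => (σ a).quote
  | comp p q => comp (p.subst ρ σ) (q.subst ρ σ)

end Pat

/-! ### Outputs and inputs -/

/-- The output `s̄⟨t₁,…,tₙ⟩`, without continuation; the channel is absent (`none`)
in dataspace-based communication. -/
structure Msg : Type where
  chan : Option Term
  args : List Term

/-- One input pattern `s(p₁,…,pₙ)` of an input; the channel is absent (`none`)
in dataspace-based communication. -/
structure InPart : Type where
  chan : Option Term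
  pats : List Pat

/-- The names of an optional channel. -/
def chanNames : Option Term → Finset Name
  | none => ∅
  | some s => s.names

/-- The names of a list of terms. -/
def argNames (ts : List Term) : Finset Name := ts.foldr (fun t X => t.names ∪ X) ∅

def Msg.names (m : Msg) : Finset Name := chanNames m.chan ∪ argNames m.args

def Msg.subst (σ : Name → Term) (m : Msg) : Msg :=
  ⟨m.chan.map (Term.subst σ), m.args.map (Term.subst σ)⟩

namespace InPart

def binders (i : InPart) : List Name := i.pats.flatMap Pat.binders

/-- The free names of an input pattern; its binding names do not bind in its channel. -/
def fn (i : InPart) : Finset Name :=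
  chanNames i.chan ∪ i.pats.foldr (fun p X => p.fn ∪ X) ∅

/-- Rename the binding names by `f` and all other names by `g`. -/
def map (f g : Name → Name) (i : InPart) : InPart :=
  ⟨i.chan.map (Term.rename g), i.pats.map (Pat.map f g)⟩

def subst (ρ : Name → Name) (σ : Name → Term) (i : InPart) : InPart :=
  ⟨i.chan.map (Term.subst σ), i.pats.map (Pat.subst ρ σ)⟩

end InPart

/-- The binding names of a joint input, from left to right. -/
def inBinders (I : List InPart) : List Name := I.flatMap InPart.binders

/-- The free names of a joint input. -/
def inFn (I : List InPart) : Finset Name := I.foldr (fun i X => i.fn ∪ X) ∅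

/-! ### Raw processes

The common syntax of all languages; `Lang.Wf` below cuts out each single language. -/

inductive Raw : Type
  /-- the null process -/
  | nil : Raw
  /-- the success process -/
  | ok : Raw
  /-- asynchronous output `s̄⟨t̃⟩` -/
  | outA (m : Msg) : Raw
  /-- synchronous output `s̄⟨t̃⟩.P` -/
  | outS (m : Msg) (P : Raw) : Raw
  /-- input `(s₁(p̃₁) | … | sₖ(p̃ₖ)) ▷ P`; for `k = 1` this is `s₁(p̃₁).P` -/
  | inp (I : List InPart) (P : Raw) : Raw
  /-- restriction `(νa)P` -/
  | res (a : Name) (P : Raw) : Raw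
  /-- parallel composition -/
  | par (P Q : Raw) : Raw
  /-- `if s = t then P else Q` -/
  | cond (s t : Term) (P Q : Raw) : Raw
  /-- replication `*P` -/
  | rep (P : Raw) : Raw

/-- A name outside `X`; every larger name is outside `X` as well. -/
def fresh (X : Finset Name) : Name := X.sup id + 1

namespace Raw

/-- Free names. -/
def fn : Raw → Finset Name
  | nil => ∅
  | ok => ∅
  | outA m => m.names
  | outS m P => m.names ∪ P.fn
  | inp I P => inFn I ∪ (P.fn \ (inBinders I).toFinset)
  | res a P => P.fn \ {a}
  | par P Q => P.fn ∪ Q.fn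
  | cond s t P Q => s.names ∪ t.names ∪ P.fn ∪ Q.fn
  | rep P => P.fn

/-- A permutation of names acting on all (free, bound and binding) names of a process. -/
def perm (π : Equiv.Perm Name) : Raw → Raw
  | nil => nil
  | ok => ok
  | outA m => outA (m.subst fun a => .name (π a))
  | outS m P => outS (m.subst fun a => .name (π a)) (P.perm π)
  | inp I P => inp (I.map (InPart.map π π)) (P.perm π)
  | res a P => res (π a) (P.perm π)
  | par P Q => par (P.perm π) (Q.perm π)
  | cond s t P Q => cond (s.rename π) (t.rename π) (P.perm π) (Q.perm π)
  | rep P => rep (P.perm π)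

/-- Capture-avoiding simultaneous substitution: every binder is renamed to a name
that does not occur in the images of the free names of its scope. -/
def subst : (Name → Term) → Raw → Raw
  | _, nil => nil
  | _, ok => ok
  | σ, outA m => outA (m.subst σ)
  | σ, outS m P => outS (m.subst σ) (P.subst σ)
  | σ, inp I P =>
      let xs := inBinders I
      let b := fresh ((P.fn \ xs.toFinset).biUnion fun c => (σ c).names)
      let ρ : Name → Name := fun x => b + xs.idxOf x
      inp (I.map (InPart.subst ρ σ)) (P.subst fun c => if c ∈ xs then .name (ρ c) else σ c)
  | σ, res a P =>
      let b := fresh ((P.fn \ {a}).biUnion fun c => (σ c).names)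
      res b (P.subst fun c => if c = a then .name b else σ c)
  | σ, par P Q => par (P.subst σ) (Q.subst σ)
  | σ, cond s t P Q => cond (s.subst σ) (t.subst σ) (P.subst σ) (Q.subst σ)
  | σ, rep P => rep (P.subst σ)

end Raw

/-- Alpha-equivalence: the least congruence that allows an injective renaming of the names bound
by a restriction or by an input, leaving the other free names of the scope fixed. -/
inductive Alpha : Raw → Raw → Prop
  | refl (P) : Alpha P P
  | symm {P Q} : Alpha P Q → Alpha Q P
  | trans {P Q R} : Alpha P Q → Alpha Q R → Alpha P R
  | res_rename (π : Equiv.Perm Name) (a P) (h : ∀ c ∈ P.fn, c ≠ a → π c = c) :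
      Alpha (.res a P) (.res (π a) (P.perm π))
  | inp_rename (π : Equiv.Perm Name) (I P) (h : ∀ c ∈ P.fn, c ∉ inBinders I → π c = c) :
      Alpha (.inp I P) (.inp (I.map (InPart.map π id)) (P.perm π))
  | outS (m) {P Q} : Alpha P Q → Alpha (.outS m P) (.outS m Q)
  | inp (I) {P Q} : Alpha P Q → Alpha (.inp I P) (.inp I Q)
  | res (a) {P Q} : Alpha P Q → Alpha (.res a P) (.res a Q)
  | par {P P' Q Q'} : Alpha P P' → Alpha Q Q' → Alpha (.par P Q) (.par P' Q')
  | cond (s t) {P P' Q Q'} : Alpha P P' → Alpha Q Q' → Alpha (.cond s t P Q) (.cond s t P' Q')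
  | rep {P Q} : Alpha P Q → Alpha (.rep P) (.rep Q)

/-! ### The 48 languages -/

/-- Asynchronous or synchronous communication. -/
inductive Synchronism : Type | asynch | synch

/-- Monadic or polyadic data. -/
inductive Arity : Type | monadic | polyadic

/-- Dataspace-based or channel-based communication. -/
inductive Medium : Type | dataspace | channel

/-- No matching, name-matching, intensionality. -/
inductive Matching : Type | noMatching | nameMatching | intensional

/-- Binary or joining communication. -/
inductive Coordination : Type | binary | joining

/-- The language with the given five features. -/
structure Lang : Type where
  sync : Synchronism
  arity : Arity
  medium : Medium
  matching : Matching
  coord : Coordination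

namespace Lang

/-- Communicable terms: arbitrary in the intensional languages, names in the others. -/
def TermOk (L : Lang) (t : Term) : Prop := L.matching ≠ .intensional → ∃ a, t = .name a

def ChanOk (L : Lang) (c : Option Term) : Prop :=
  match L.medium with
  | .dataspace => c = none
  | .channel => ∃ s, c = some s ∧ L.TermOk s

def PatOk (L : Lang) (p : Pat) : Prop :=
  match L.matching with
  | .noMatching => ∃ x, p = .bind x
  | .nameMatching => (∃ x, p = .bind x) ∨ ∃ a, p = .mtch a
  | .intensional => True

def ArityOk (L : Lang) (n : ℕ) : Prop := L.arity = .monadic → n = 1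

def MsgOk (L : Lang) (m : Msg) : Prop :=
  L.ChanOk m.chan ∧ L.ArityOk m.args.length ∧ ∀ t ∈ m.args, L.TermOk t

def PartOk (L : Lang) (i : InPart) : Prop :=
  L.ChanOk i.chan ∧ L.ArityOk i.pats.length ∧ ∀ p ∈ i.pats, L.PatOk p

/-- An input has at least one input pattern, exactly one in the binary languages, and
its binding names are pairwise distinct. -/
def InputOk (L : Lang) (I : List InPart) : Prop :=
  I ≠ [] ∧ (L.coord = .binary → I.length = 1) ∧ (∀ i ∈ I, L.PartOk i) ∧ (inBinders I).Nodup

/-- `L.Wf P`: `P` is a process of the language `L`. -/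
def Wf (L : Lang) : Raw → Prop
  | .nil => True
  | .ok => True
  | .outA m => L.sync = .asynch ∧ L.MsgOk m
  | .outS m P => L.sync = .synch ∧ L.MsgOk m ∧ L.Wf P
  | .inp I P => L.InputOk I ∧ L.Wf P
  | .res _ P => L.Wf P
  | .par P Q => L.Wf P ∧ L.Wf Q
  | .cond _ _ P Q => L.Wf P ∧ L.Wf Q
  | .rep P => L.Wf P

/-- The processes of `L`. -/
def Proc (L : Lang) : Type := {P : Raw // L.Wf P}

end Lang

/-! ### Operational semantics -/

/-- The match rule `{t // p}`; the resulting substitution is a list of pairs. -/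
def matchTerm : Term → Pat → Option (List (Name × Term))
  | t, .bind x => some [(x, t)]
  | .name a, .mtch b => if a = b then some [] else none
  | .comp s t, .comp p q => do
      let σ ← matchTerm s p
      let ρ ← matchTerm t q
      return σ ++ ρ
  | .name _, .comp _ _ => none
  | .comp _ _, .mtch _ => none

/-- The poly-match rule. -/
def polyMatch : List Term → List Pat → Option (List (Name × Term))
  | [], [] => some []
  | t :: ts, p :: ps => do
      let σ ← matchTerm t p
      let ρ ← polyMatch ts ps
      return σ ++ ρ
  | _, _ => none

/-- Outputs against the input patterns of a joint input, in order:
the channels agree and the data poly-match. -/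
def joinMatch : List Msg → List InPart → Option (List (Name × Term))
  | [], [] => some []
  | m :: ms, i :: is =>
      if m.chan = i.chan then do
        let σ ← polyMatch m.args i.pats
        let ρ ← joinMatch ms is
        return σ ++ ρ
      else none
  | _, _ => none

/-- The substitution given by a list of pairs. -/
def listSubst (l : List (Name × Term)) (x : Name) : Term := (l.lookup x).getD (.name x)

/-- Structural equivalence of `L`: the least equivalence relation that satisfies the axioms
and is closed under parallel composition and restriction. -/
inductive Struct (L : Lang) : Raw → Raw → Prop
  | refl (P) : Struct L P P
  | symm {P Q} : Struct L P Q → Struct L Q P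
  | trans {P Q R} : Struct L P Q → Struct L Q R → Struct L P R
  | alpha {P Q} : Alpha P Q → Struct L P Q
  | par_nil (P) : Struct L (.par P .nil) P
  | par_comm (P Q) : Struct L (.par P Q) (.par Q P)
  | par_assoc (P Q R) : Struct L (.par P (.par Q R)) (.par (.par P Q) R)
  | cond_eq (s t P Q) (h : s = t) (hQ : L.Wf Q) : Struct L (.cond s t P Q) P
  | cond_ne (s t P Q) (h : s ≠ t) (hP : L.Wf P) : Struct L (.cond s t P Q) Q
  | res_nil (a) : Struct L (.res a .nil) .nil
  | res_comm (a b P) : Struct L (.res a (.res b P)) (.res b (.res a P))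
  | extrude (a P Q) (h : a ∉ P.fn) : Struct L (.par P (.res a Q)) (.res a (.par P Q))
  | rep_unfold (P) : Struct L (.rep P) (.par P (.rep P))
  | par {P P' Q Q'} : Struct L P P' → Struct L Q Q' → Struct L (.par P Q) (.par P' Q')
  | res (a) {P Q} : Struct L P Q → Struct L (.res a P) (.res a Q)

/-- Reduction of `L`. The two axioms are the interaction of `k` asynchronous (resp. synchronous)
outputs with an input of `k` input patterns; `k = 1` in the binary languages. -/
inductive Red (L : Lang) : Raw → Raw → Prop
  | commA (ms : List Msg) (I : List InPart) (Q : Raw) (σ : List (Name × Term))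
      (h : joinMatch ms I = some σ) :
      Red L (ms.foldr (fun m R => .par (.outA m) R) (.inp I Q)) (Q.subst (listSubst σ))
  | commS (ms : List (Msg × Raw)) (I : List InPart) (Q : Raw) (σ : List (Name × Term))
      (h : joinMatch (ms.map Prod.fst) I = some σ) :
      Red L (ms.foldr (fun m R => .par (.outS m.1 m.2) R) (.inp I Q))
        (ms.foldr (fun m R => .par m.2 R) (Q.subst (listSubst σ)))
  | par {P P'} (Q) : Red L P P' → Red L (.par P Q) (.par P' Q)
  | res (a) {P P'} : Red L P P' → Red L (.res a P) (.res a P')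
  | struct {P Q Q' P'} : Struct L P Q → Red L Q Q' → Struct L Q' P' → Red L P P'

namespace Lang

variable {L : Lang}

/-- One reduction step. -/
def Proc.Step (P Q : L.Proc) : Prop := Red L P.1 Q.1

/-- Reflexive transitive closure of reduction. -/
def Proc.Steps (P Q : L.Proc) : Prop := Relation.ReflTransGen Proc.Step P Q

/-- `P` has an infinite sequence of reductions. -/
def Proc.Diverges (P : L.Proc) : Prop :=
  ∃ f : ℕ → L.Proc, f 0 = P ∧ ∀ n, (f n).Step (f (n + 1))

/-- `P` may reduce to a process with a top-level success. -/
def Proc.Succeeds (P : L.Proc) : Prop :=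
  ∃ P' P'' : L.Proc, P.Steps P' ∧ Struct L P'.1 (.par P''.1 .ok)

/-- `R` can serve as a reference behavioural equivalence of `L`: an equivalence relation that
contains structural equivalence and is reduction-sensitive. -/
structure IsReferenceEquivalence (L : Lang) (R : L.Proc → L.Proc → Prop) : Prop where
  equivalence : Equivalence R
  of_struct : ∀ P Q : L.Proc, Struct L P.1 Q.1 → R P Q
  reduction_sensitive : ∀ P Q : L.Proc, R P Q → (∃ Q', Q.Step Q') → ∃ P', P.Step P'

/-! ### Substitutions -/

/-- Substitutions of `L`: finite domain, to terms in the intensional languages and to names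
in the others. -/
structure Subst (L : Lang) : Type where
  toFun : Name → Term
  finite_domain : {a | toFun a ≠ .name a}.Finite
  termOk : ∀ a, L.TermOk (toFun a)

theorem TermOk.subst {σ : Name → Term} (hσ : ∀ a, L.TermOk (σ a)) {t : Term}
    (ht : L.TermOk t) : L.TermOk (t.subst σ) := by
  intro h
  obtain ⟨a, rfl⟩ := ht h
  exact hσ a h

theorem ChanOk.subst {σ : Name → Term} (hσ : ∀ a, L.TermOk (σ a)) {c : Option Term}
    (hc : L.ChanOk c) : L.ChanOk (c.map (Term.subst σ)) := by
  unfold ChanOk at *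
  split at hc
  · simp [hc]
  · obtain ⟨s, rfl, hs⟩ := hc
    exact ⟨_, rfl, hs.subst hσ⟩

theorem MsgOk.subst {σ : Name → Term} (hσ : ∀ a, L.TermOk (σ a)) {m : Msg}
    (hm : L.MsgOk m) : L.MsgOk (m.subst σ) := by
  refine ⟨hm.1.subst hσ, ?_, ?_⟩
  · simpa [Msg.subst] using hm.2.1
  · intro t ht
    obtain ⟨s, hs, rfl⟩ := List.mem_map.1 ht
    exact (hm.2.2 s hs).subst hσ

theorem PatOk.subst {σ : Name → Term} (hσ : ∀ a, L.TermOk (σ a)) (ρ : Name → Name) {p : Pat}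
    (hp : L.PatOk p) : L.PatOk (p.subst ρ σ) := by
  unfold PatOk at *
  split at hp
  · obtain ⟨x, rfl⟩ := hp
    exact ⟨_, rfl⟩
  · rename_i h
    rcases hp with ⟨x, rfl⟩ | ⟨a, rfl⟩
    · exact Or.inl ⟨_, rfl⟩
    · obtain ⟨b, hb⟩ := hσ a (by simp [h])
      exact Or.inr ⟨b, by simp [Pat.subst, hb, Term.quote]⟩
  · trivial

theorem PartOk.subst {σ : Name → Term} (hσ : ∀ a, L.TermOk (σ a)) (ρ : Name → Name) {i : InPart}
    (hi : L.PartOk i) : L.PartOk (i.subst ρ σ) := by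
  refine ⟨hi.1.subst hσ, ?_, ?_⟩
  · simpa [InPart.subst] using hi.2.1
  · intro t ht
    obtain ⟨s, hs, rfl⟩ := List.mem_map.1 ht
    exact (hi.2.2 s hs).subst hσ ρ

theorem quote_binders (t : Term) : t.quote.binders = [] := by
  induction t with
  | name a => rfl
  | comp s t hs ht => simp [Term.quote, Pat.binders, hs, ht]

theorem pat_binders_subst (ρ : Name → Name) (σ : Name → Term) (p : Pat) :
    (p.subst ρ σ).binders = p.binders.map ρ := by
  induction p with
  | bind x => rfl
  | mtch a => simp [Pat.subst, Pat.binders, quote_binders]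
  | comp p q hp hq => simp [Pat.subst, Pat.binders, hp, hq]

theorem inBinders_subst (ρ : Name → Name) (σ : Name → Term) (I : List InPart) :
    inBinders (I.map (InPart.subst ρ σ)) = (inBinders I).map ρ := by
  simp [inBinders, InPart.binders, InPart.subst, List.flatMap_map, List.map_flatMap,
    pat_binders_subst]

/-- Substitution stays inside the language. -/
theorem Wf.subst : ∀ (P : Raw) (σ : Name → Term), (∀ a, L.TermOk (σ a)) → L.Wf P →
    L.Wf (P.subst σ)
  | .nil, _, _, _ => trivial
  | .ok, _, _, _ => trivial
  | .outA _, _, hσ, h => ⟨h.1, h.2.subst hσ⟩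
  | .outS _ P, _, hσ, h => ⟨h.1, h.2.1.subst hσ, Wf.subst P _ hσ h.2.2⟩
  | .inp I P, σ, hσ, h => by
      obtain ⟨⟨hne, hc, hi, hn⟩, hP⟩ := h
      refine ⟨⟨by simpa using hne, by simpa using hc, ?_, ?_⟩, Wf.subst P _ ?_ hP⟩
      · intro i hi'
        obtain ⟨j, hj, rfl⟩ := List.mem_map.1 hi'
        exact (hi j hj).subst hσ _
      · rw [inBinders_subst]
        refine hn.map_on fun x hx y _ hxy => ?_
        exact (List.idxOf_inj hx).1 (Nat.add_left_cancel hxy)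
      · intro a
        split_ifs
        · exact fun _ => ⟨_, rfl⟩
        · exact hσ a
  | .res a P, σ, hσ, h => by
      refine Wf.subst P _ ?_ h
      intro c
      split_ifs
      · exact fun _ => ⟨_, rfl⟩
      · exact hσ c
  | .par P Q, _, hσ, h => ⟨Wf.subst P _ hσ h.1, Wf.subst Q _ hσ h.2⟩
  | .cond _ _ P Q, _, hσ, h => ⟨Wf.subst P _ hσ h.1, Wf.subst Q _ hσ h.2⟩
  | .rep P, _, hσ, h => Wf.subst P _ hσ h

/-- `σP` for a process `P` of `L`. -/
def Subst.app (σ : L.Subst) (P : L.Proc) : L.Proc :=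
  ⟨P.1.subst σ.toFun, Wf.subst P.1 σ.toFun σ.termOk P.2⟩

end Lang

/-! ### Operators and contexts -/

/-- The operators of the syntax. -/
inductive Op : Type
  | nil | ok
  | outA (m : Msg)
  | outS (m : Msg)
  | inp (I : List InPart)
  | res (a : Name)
  | par
  | cond (s t : Term)
  | rep

namespace Op

/-- Number of process arguments. -/
def arity : Op → ℕ
  | nil | ok | outA _ => 0
  | outS _ | inp _ | res _ | rep => 1
  | par | cond _ _ => 2

/-- `op(S₁,…,Sₖ)`. -/
def app : (op : Op) → (Fin op.arity → Raw) → Raw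
  | nil, _ => .nil
  | ok, _ => .ok
  | outA m, _ => .outA m
  | outS m, S => .outS m (S (0 : Fin 1))
  | inp I, S => .inp I (S (0 : Fin 1))
  | res a, S => .res a (S (0 : Fin 1))
  | par, S => .par (S (0 : Fin 2)) (S (1 : Fin 2))
  | cond s t, S => .cond s t (S (0 : Fin 2)) (S (1 : Fin 2))
  | rep, S => .rep (S (0 : Fin 1))

end Op

/-- Processes with holes indexed by `Fin k`. -/
inductive Ctx (k : ℕ) : Type
  | hole (i : Fin k) : Ctx k
  | nil : Ctx k
  | ok : Ctx k
  | outA (m : Msg) : Ctx k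
  | outS (m : Msg) (C : Ctx k) : Ctx k
  | inp (I : List InPart) (C : Ctx k) : Ctx k
  | res (a : Name) (C : Ctx k) : Ctx k
  | par (C D : Ctx k) : Ctx k
  | cond (s t : Term) (C D : Ctx k) : Ctx k
  | rep (C : Ctx k) : Ctx k

namespace Ctx

variable {k : ℕ}

/-- Fill the holes; names of the filling processes may be captured. -/
def fill : Ctx k → (Fin k → Raw) → Raw
  | hole i, T => T i
  | nil, _ => .nil
  | ok, _ => .ok
  | outA m, _ => .outA m
  | outS m C, T => .outS m (C.fill T)
  | inp I C, T => .inp I (C.fill T)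
  | res a C, T => .res a (C.fill T)
  | par C D, T => .par (C.fill T) (D.fill T)
  | cond s t C D, T => .cond s t (C.fill T) (D.fill T)
  | rep C, T => .rep (C.fill T)

/-- The occurrences of holes. -/
def holes : Ctx k → List (Fin k)
  | hole i => [i]
  | nil | ok | outA _ => []
  | outS _ C | inp _ C | res _ C | rep C => C.holes
  | par C D | cond _ _ C D => C.holes ++ D.holes

/-- `C` is a `k`-ary context of `L`: every hole occurs exactly once, and filling `C` with processes
of `L` gives a process of `L`. -/
def IsContext (L : Lang) (C : Ctx k) : Prop :=
  (∀ i, C.holes.count i = 1) ∧ ∀ T : Fin k → L.Proc, L.Wf (C.fill fun i => (T i).1)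

end Ctx

/-! ### Encodings -/

/-- An encoding of `L₁` into `L₂`: a translation of processes, which are taken up to
alpha-equivalence, and a renaming policy that maps every name to a `k`-tuple of names. -/
structure Encoding (L₁ L₂ : Lang) : Type where
  enc : L₁.Proc → L₂.Proc
  alpha : ∀ P Q : L₁.Proc, Alpha P.1 Q.1 → Alpha (enc P).1 (enc Q).1
  k : ℕ
  k_pos : 0 < k
  policy : Name → Fin k → Name

namespace Encoding

variable {L₁ L₂ : Lang}

/-- `σ'` renames translated names as `σ` renames source names: `φ(σ(a)) = σ'(φ(a))` for every
name `a`, where `φ` is applied componentwise to the names of a term. -/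
def Corresponds (E : Encoding L₁ L₂) (σ : L₁.Subst) (σ' : L₂.Subst) : Prop :=
  ∀ a i, (σ.toFun a).rename (fun b => E.policy b i) = σ'.toFun (E.policy a i)

/-- Valid encodings with respect to a behavioural equivalence `beq` of the target language;
equality of processes is alpha-equivalence. -/
structure IsValid (E : Encoding L₁ L₂) (beq : L₂.Proc → L₂.Proc → Prop) : Prop where
  compositionality : ∀ (op : Op) (N : Set Name), ∃ C : Ctx op.arity, C.IsContext L₂ ∧
    ∀ (S : Fin op.arity → L₁.Proc) (h : L₁.Wf (op.app fun i => (S i).1)),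
      (⋃ i, ((S i).1.fn : Set Name)) = N →
      Alpha (E.enc ⟨op.app fun i => (S i).1, h⟩).1 (C.fill fun i => (E.enc (S i)).1)
  name_invariance : ∀ σ : L₁.Subst, ∃ σ' : L₂.Subst, E.Corresponds σ σ' ∧
    ∀ S : L₁.Proc,
      (Function.Injective σ.toFun → Alpha (E.enc (σ.app S)).1 (σ'.app (E.enc S)).1) ∧
      (¬ Function.Injective σ.toFun → beq (E.enc (σ.app S)) (σ'.app (E.enc S)))
  completeness : ∀ S S' : L₁.Proc, S.Steps S' →
    ∃ T : L₂.Proc, (E.enc S).Steps T ∧ beq T (E.enc S')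
  soundness : ∀ (S : L₁.Proc) (T : L₂.Proc), (E.enc S).Steps T →
    ∃ S' : L₁.Proc, S.Steps S' ∧ ∃ T' : L₂.Proc, T.Steps T' ∧ beq T' (E.enc S')
  divergence_reflection : ∀ S : L₁.Proc, (E.enc S).Diverges → S.Diverges
  success_sensitiveness : ∀ S : L₁.Proc, S.Succeeds ↔ (E.enc S).Succeeds

end Encoding

/-- There is a valid encoding of `L₁` into `L₂`. -/
def ValidlyEncodable (L₁ L₂ : Lang) (beq : L₂.Proc → L₂.Proc → Prop) : Prop :=
  ∃ E : Encoding L₁ L₂, E.IsValid beq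

end JoinCalc

namespace JoinCalc

/-! ### Names, renamings and substitutions -/

/-! The proof splits on `δ`. With intensionality the hypothesis is contradictory, because a polyadic
datum can be sent as one compound term. Without intensionality the conclusion holds outright: even
joint inputs cannot make up for the missing arity.

Separation (`not_validlyEncodable_of_ne_intensional`). Whether a process can react depends only on
the messages it offers at top level and on the demands of its unguarded inputs. A message of a
monadic non-intensional language shows its environment at most two names, a channel and a datum;
this is its `Shape`. The predicates `Offers` and `Needs` compute with shapes, are invariant under
structural equivalence, and `Needs _ 0` holds exactly when a process reduces or has a success at top
level (`needs_of_red`, `needs_of_struct_ok`, `reacts_of_needs`). By soundness, divergence reflection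
and success sensitiveness, a valid encoding never lets an inert process react (`not_needs_enc`).

The source has outputs and inputs of infinitely many arities `n + 2`. By pigeonhole over shapes, and
by name invariance for the messages whose names lie outside a finite set, there is an `n` such that
every message offered by the translation of such a probe is also offered by the translation of a
probe of another arity or with other names, one that does not match the original partner
(`exists_sharing`). Now a matching pair of probes reacts, so the translation of its parallel
composition reacts, and by compositionality this translation is `C[·;·]`. The input that reacts lies
in at most one of the two holes (`Ctx.needs_fill`); the other hole merely delivers finitely many
messages, however many input patterns are joined. In that other hole the probe is exchanged for
sufficiently many copies of the mismatched probes, which deliver the same messages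
(`Ctx.offersLe_nested`). The translation still reacts, but its source is now inert (`Confined`): a
contradiction.

Packing (`validlyEncodable_intensional`). The name `0` is reserved, all other names are shifted by
one, and `t₁,…,tₙ` is sent as `t₁ • (… • (tₙ • 0))`; patterns are packed alike with terminator
`⌜0⌝`. Packed matching is exactly polyadic matching (`matchTerm_pack`), so reductions are preserved.
For the converse, target processes are decoded. Structural equivalence may place arbitrary processes
in the branches of conditionals that are not taken, so these branches are trimmed away first. The
relation `Represents` between a target process and its decoding is then a step-by-step simulation,
from which soundness, divergence reflection and success sensitiveness follow. -/

theorem lt_fresh {X : Finset Name} {a : Name} (h : a ∈ X) : a < fresh X :=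
  Nat.lt_succ_of_le (Finset.le_sup (f := id) h)

theorem List.idxOf_map_of_injOn {f : Name → Name} {x : Name} : ∀ {xs : List Name},
    (∀ y ∈ xs, f x = f y → x = y) → (xs.map f).idxOf (f x) = xs.idxOf x
  | [], _ => rfl
  | y :: ys, h => by
      have ih := List.idxOf_map_of_injOn (f := f) (x := x) (xs := ys)
        fun z hz => h z (by simp [hz])
      by_cases hxy : y = x
      · simp [hxy]
      · have : f y ≠ f x := fun e => hxy (h y (by simp) e.symm).symm
        simp [List.idxOf_cons_ne _ hxy, List.idxOf_cons_ne _ this, ih]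

namespace Term

theorem subst_congr {σ τ : Name → Term} : ∀ {t : Term}, (∀ a ∈ t.names, σ a = τ a) →
    t.subst σ = t.subst τ
  | name a, h => h a (by simp [names])
  | comp s t, h => by
      simp only [subst]
      rw [subst_congr fun a ha => h a (by simp [names, ha]),
        subst_congr fun a ha => h a (by simp [names, ha])]

theorem subst_subst (σ τ : Name → Term) : ∀ t : Term,
    (t.subst σ).subst τ = t.subst fun a => (σ a).subst τ
  | name _ => rfl
  | comp s t => by simp only [subst, subst_subst σ τ s, subst_subst σ τ t]

theorem mem_names_subst {σ : Name → Term} {b : Name} : ∀ {t : Term},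
    b ∈ (t.subst σ).names ↔ ∃ a ∈ t.names, b ∈ (σ a).names
  | name a => by simp [subst, names]
  | comp s t => by
      simp only [subst, names, Finset.mem_union, mem_names_subst (t := s),
        mem_names_subst (t := t)]
      grind

@[simp] theorem subst_name : ∀ t : Term, t.subst name = t
  | name _ => rfl
  | comp s t => by simp only [subst, subst_name s, subst_name t]

theorem quote_subst (ρ : Name → Name) (τ : Name → Term) : ∀ t : Term,
    t.quote.subst ρ τ = (t.subst τ).quote
  | name _ => rfl
  | comp s t => by simp only [subst, quote, Pat.subst, quote_subst ρ τ s, quote_subst ρ τ t]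

theorem fn_quote : ∀ t : Term, t.quote.fn = t.names
  | name _ => rfl
  | comp s t => by simp only [quote, Pat.fn, names, fn_quote s, fn_quote t]

theorem rename_injective {f : Name → Name} (hf : Function.Injective f) :
    Function.Injective (rename f) := by
  intro s
  induction s with
  | name a =>
      rintro (b | ⟨u, v⟩) h
      · have h' : name (f a) = name (f b) := h
        injection h' with h'
        rw [hf h']
      · exact absurd h (by simp [rename, subst])
  | comp s t hs ht =>
      rintro (b | ⟨u, v⟩) h
      · exact absurd h (by simp [rename, subst])
      · have h' : comp (s.rename f) (t.rename f) = comp (u.rename f) (v.rename f) := h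
        injection h' with h₁ h₂
        rw [hs h₁, ht h₂]

end Term

namespace Pat

theorem subst_congr {ρ ρ' : Name → Name} {σ τ : Name → Term} : ∀ {p : Pat},
    (∀ x ∈ p.binders, ρ x = ρ' x) → (∀ a ∈ p.fn, σ a = τ a) → p.subst ρ σ = p.subst ρ' τ
  | bind x, h, _ => by simp [subst, h x (by simp [binders])]
  | mtch a, _, h => by simp [subst, h a (by simp [fn])]
  | comp p q, h, h' => by
      simp only [subst]
      rw [subst_congr (p := p) (fun a ha => h a (by simp [binders, ha]))
          fun a ha => h' a (by simp [fn, ha]),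
        subst_congr (p := q) (fun a ha => h a (by simp [binders, ha]))
          fun a ha => h' a (by simp [fn, ha])]

theorem subst_subst (ρ ρ' : Name → Name) (σ τ : Name → Term) : ∀ p : Pat,
    (p.subst ρ σ).subst ρ' τ = p.subst (fun x => ρ' (ρ x)) fun a => (σ a).subst τ
  | bind _ => rfl
  | mtch a => by simp only [subst, Term.quote_subst]
  | comp p q => by simp only [subst, subst_subst ρ ρ' σ τ p, subst_subst ρ ρ' σ τ q]

theorem mem_fn_subst {ρ : Name → Name} {σ : Name → Term} {b : Name} : ∀ {p : Pat},
    b ∈ (p.subst ρ σ).fn ↔ ∃ a ∈ p.fn, b ∈ (σ a).names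
  | bind x => by simp [subst, fn]
  | mtch a => by simp [subst, fn, Term.fn_quote]
  | comp p q => by
      simp only [subst, fn, Finset.mem_union, mem_fn_subst (p := p), mem_fn_subst (p := q)]
      grind

theorem map_eq_subst (f g : Name → Name) : ∀ p : Pat,
    p.map f g = p.subst f fun a => .name (g a)
  | bind _ => rfl
  | mtch _ => rfl
  | comp p q => by simp only [map, subst, map_eq_subst f g p, map_eq_subst f g q]

end Pat

/-! ### Free names and substitution in messages and inputs -/

theorem mem_argNames {ts : List Term} {a : Name} : a ∈ argNames ts ↔ ∃ t ∈ ts, a ∈ t.names := by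
  induction ts with
  | nil => simp [argNames]
  | cons t ts ih =>
      have : argNames (t :: ts) = t.names ∪ argNames ts := rfl
      simp [this, ih]

theorem mem_chanNames {c : Option Term} {a : Name} :
    a ∈ chanNames c ↔ ∃ t, c = some t ∧ a ∈ t.names := by
  cases c <;> simp [chanNames]

theorem mem_names_msg {m : Msg} {a : Name} :
    a ∈ m.names ↔ a ∈ chanNames m.chan ∨ ∃ t ∈ m.args, a ∈ t.names := by
  simp [Msg.names, mem_argNames]

theorem chan_subst_congr {σ τ : Name → Term} {c : Option Term}
    (h : ∀ a ∈ chanNames c, σ a = τ a) : c.map (Term.subst σ) = c.map (Term.subst τ) := by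
  cases c with
  | none => rfl
  | some t => simpa using Term.subst_congr h

theorem mem_chanNames_subst {σ : Name → Term} {c : Option Term} {b : Name} :
    b ∈ chanNames (c.map (Term.subst σ)) ↔ ∃ a ∈ chanNames c, b ∈ (σ a).names := by
  cases c with
  | none => simp [chanNames]
  | some t => simpa [chanNames] using Term.mem_names_subst

namespace Msg

theorem subst_congr {σ τ : Name → Term} {m : Msg} (h : ∀ a ∈ m.names, σ a = τ a) :
    m.subst σ = m.subst τ := by
  simp only [subst, mk.injEq]
  refine ⟨chan_subst_congr fun a ha => h a (mem_names_msg.2 (Or.inl ha)), ?_⟩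
  exact List.map_congr_left fun t ht =>
    Term.subst_congr fun a ha => h a (mem_names_msg.2 (Or.inr ⟨t, ht, ha⟩))

theorem subst_subst (σ τ : Name → Term) (m : Msg) :
    (m.subst σ).subst τ = m.subst fun a => (σ a).subst τ := by
  simp only [subst, mk.injEq, Option.map_map, List.map_map]
  exact ⟨congrArg (fun f => m.chan.map f) (funext fun t => Term.subst_subst σ τ t),
    congrArg (fun f => m.args.map f) (funext fun t => Term.subst_subst σ τ t)⟩

theorem mem_names_subst {σ : Name → Term} {m : Msg} {b : Name} :
    b ∈ (m.subst σ).names ↔ ∃ a ∈ m.names, b ∈ (σ a).names := by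
  simp only [mem_names_msg, subst, mem_chanNames_subst, List.mem_map]
  constructor
  · rintro (⟨a, h, h'⟩ | ⟨_, ⟨t, ht, rfl⟩, h⟩)
    · exact ⟨a, Or.inl h, h'⟩
    · obtain ⟨a, ha, h⟩ := Term.mem_names_subst.1 h
      exact ⟨a, Or.inr ⟨t, ht, ha⟩, h⟩
  · rintro ⟨a, h | ⟨t, ht, h⟩, h'⟩
    · exact Or.inl ⟨a, h, h'⟩
    · exact Or.inr ⟨_, ⟨t, ht, rfl⟩, Term.mem_names_subst.2 ⟨a, h, h'⟩⟩

end Msg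

theorem InPart.mem_fn {i : InPart} {a : Name} :
    a ∈ i.fn ↔ a ∈ chanNames i.chan ∨ ∃ p ∈ i.pats, a ∈ p.fn := by
  have : ∀ ps : List Pat, a ∈ ps.foldr (fun p X => p.fn ∪ X) ∅ ↔ ∃ p ∈ ps, a ∈ p.fn := by
    intro ps
    induction ps with
    | nil => simp
    | cons p ps ih => simp [ih]
  simp only [fn, Finset.mem_union, this]

theorem mem_inFn {I : List InPart} {a : Name} : a ∈ inFn I ↔ ∃ i ∈ I, a ∈ i.fn := by
  induction I with
  | nil => simp [inFn]
  | cons i I ih =>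
      have : inFn (i :: I) = i.fn ∪ inFn I := rfl
      simp [this, ih]

theorem mem_inBinders {I : List InPart} {x : Name} :
    x ∈ inBinders I ↔ ∃ i ∈ I, ∃ p ∈ i.pats, x ∈ p.binders := by
  simp [inBinders, InPart.binders]

theorem inPart_subst_congr {ρ ρ' : Name → Name} {σ τ : Name → Term} {I : List InPart}
    (h : ∀ x ∈ inBinders I, ρ x = ρ' x) (h' : ∀ a ∈ inFn I, σ a = τ a) :
    I.map (InPart.subst ρ σ) = I.map (InPart.subst ρ' τ) := by
  refine List.map_congr_left fun i hi => ?_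
  simp only [InPart.subst, InPart.mk.injEq]
  refine ⟨chan_subst_congr fun a ha => h' a (mem_inFn.2 ⟨i, hi, InPart.mem_fn.2 (Or.inl ha)⟩), ?_⟩
  refine List.map_congr_left fun p hp => Pat.subst_congr
    (fun x hx => h x (mem_inBinders.2 ⟨i, hi, p, hp, hx⟩))
    fun a ha => h' a (mem_inFn.2 ⟨i, hi, InPart.mem_fn.2 (Or.inr ⟨p, hp, ha⟩)⟩)

theorem inPart_subst_subst (ρ ρ' : Name → Name) (σ τ : Name → Term) (I : List InPart) :
    (I.map (InPart.subst ρ σ)).map (InPart.subst ρ' τ) =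
      I.map (InPart.subst (fun x => ρ' (ρ x)) fun a => (σ a).subst τ) := by
  rw [List.map_map]
  refine List.map_congr_left fun i _ => ?_
  simp only [InPart.subst, Function.comp, InPart.mk.injEq, Option.map_map, List.map_map]
  exact ⟨congrArg (fun f => i.chan.map f) (funext fun t => Term.subst_subst σ τ t),
    congrArg (fun f => i.pats.map f) (funext fun p => Pat.subst_subst ρ ρ' σ τ p)⟩

theorem mem_inFn_subst {ρ : Name → Name} {σ : Name → Term} {I : List InPart} {b : Name} :
    b ∈ inFn (I.map (InPart.subst ρ σ)) ↔ ∃ a ∈ inFn I, b ∈ (σ a).names := by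
  simp only [mem_inFn, List.mem_map, InPart.mem_fn]
  constructor
  · rintro ⟨_, ⟨i, hi, rfl⟩, h | ⟨p, hp, h⟩⟩
    · obtain ⟨a, ha, h⟩ := mem_chanNames_subst.1 h
      exact ⟨a, ⟨i, hi, Or.inl ha⟩, h⟩
    · obtain ⟨q, hq, rfl⟩ := List.mem_map.1 hp
      obtain ⟨a, ha, h⟩ := Pat.mem_fn_subst.1 h
      exact ⟨a, ⟨i, hi, Or.inr ⟨q, hq, ha⟩⟩, h⟩
  · rintro ⟨a, ⟨i, hi, ha | ⟨p, hp, ha⟩⟩, h⟩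
    · exact ⟨_, ⟨i, hi, rfl⟩, Or.inl (mem_chanNames_subst.2 ⟨a, ha, h⟩)⟩
    · exact ⟨_, ⟨i, hi, rfl⟩, Or.inr ⟨_, List.mem_map.2 ⟨p, hp, rfl⟩,
        Pat.mem_fn_subst.2 ⟨a, ha, h⟩⟩⟩

theorem inPart_map_eq_subst (f g : Name → Name) (I : List InPart) :
    I.map (InPart.map f g) = I.map (InPart.subst f fun a => .name (g a)) := by
  refine List.map_congr_left fun i _ => ?_
  simp only [InPart.map, InPart.subst, InPart.mk.injEq]
  exact ⟨rfl, List.map_congr_left fun p _ => Pat.map_eq_subst f g p⟩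

theorem inBinders_map (f g : Name → Name) (I : List InPart) :
    inBinders (I.map (InPart.map f g)) = (inBinders I).map f := by
  rw [inPart_map_eq_subst, Lang.inBinders_subst]

theorem mem_inFn_map {f g : Name → Name} {I : List InPart} {b : Name} :
    b ∈ inFn (I.map (InPart.map f g)) ↔ ∃ a ∈ inFn I, b = g a := by
  simp [inPart_map_eq_subst, mem_inFn_subst, Term.names]

/-! ### Composition of capture-avoiding substitutions -/

namespace Raw

/-- The name chosen by `Raw.subst` for the binders with scope `P` and binding names `xs`. -/
def pick (σ : Name → Term) (P : Raw) (xs : List Name) : Name :=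
  fresh ((P.fn \ xs.toFinset).biUnion fun c => (σ c).names)

/-- The substitution that `Raw.subst` applies below the binding names `xs`. -/
def under (σ : Name → Term) (P : Raw) (xs : List Name) (c : Name) : Term :=
  if c ∈ xs then .name (pick σ P xs + xs.idxOf c) else σ c

theorem subst_inp (σ : Name → Term) (I : List InPart) (P : Raw) :
    (inp I P).subst σ =
      inp (I.map (InPart.subst (fun x => pick σ P (inBinders I) + (inBinders I).idxOf x) σ))
        (P.subst (under σ P (inBinders I))) := rfl

theorem subst_res (σ : Name → Term) (a : Name) (P : Raw) :
    (res a P).subst σ = res (pick σ P [a]) (P.subst (under σ P [a])) := by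
  have h : pick σ P [a] = fresh ((P.fn \ {a}).biUnion fun c => (σ c).names) := by simp [pick]
  have h' : under σ P [a] = fun c => if c = a then .name (pick σ P [a]) else σ c := by
    funext c
    by_cases hc : c = a <;> simp [under, hc]
  rw [h', h]
  simp only [subst]

theorem lt_pick {σ : Name → Term} {P : Raw} {xs : List Name} {c d : Name} (hc : c ∈ P.fn)
    (hx : c ∉ xs) (hd : d ∈ (σ c).names) : d < pick σ P xs :=
  lt_fresh (Finset.mem_biUnion.2 ⟨c, by simp [hc, hx], hd⟩)

theorem one_le_pick (σ : Name → Term) (P : Raw) (xs : List Name) : 1 ≤ pick σ P xs :=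
  Nat.succ_le_succ (Nat.zero_le _)

theorem pick_congr {σ τ : Name → Term} {P : Raw} {xs : List Name}
    (h : ∀ c ∈ P.fn, c ∉ xs → σ c = τ c) : pick σ P xs = pick τ P xs := by
  unfold pick
  congr 1
  refine Finset.biUnion_congr rfl fun c hc => ?_
  simp only [Finset.mem_sdiff, List.mem_toFinset] at hc
  rw [h c hc.1 hc.2]

theorem under_congr {σ τ : Name → Term} {P : Raw} {xs : List Name}
    (h : ∀ c ∈ P.fn, c ∉ xs → σ c = τ c) : ∀ c ∈ P.fn, under σ P xs c = under τ P xs c := by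
  intro c hc
  unfold under
  rw [pick_congr h]
  split_ifs with hx
  · rfl
  · exact h c hc hx

theorem subst_congr : ∀ {P : Raw} {σ τ : Name → Term}, (∀ c ∈ P.fn, σ c = τ c) →
    P.subst σ = P.subst τ
  | nil, _, _, _ => by simp only [subst]
  | ok, _, _, _ => by simp only [subst]
  | outA m, _, _, h => by simp only [subst]; rw [Msg.subst_congr h]
  | outS m P, _, _, h => by
      simp only [subst]
      rw [Msg.subst_congr fun a ha => h a (by simp [fn, ha]),
        subst_congr fun a ha => h a (by simp [fn, ha])]
  | inp I P, σ, τ, h => by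
      have hP : ∀ c ∈ P.fn, c ∉ inBinders I → σ c = τ c := fun c hc hx =>
        h c (by simp [fn, hc, hx])
      rw [subst_inp, subst_inp, subst_congr (under_congr hP), pick_congr hP,
        inPart_subst_congr (fun _ _ => rfl) fun a ha => h a (by simp [fn, ha])]
  | res a P, σ, τ, h => by
      have hP : ∀ c ∈ P.fn, c ∉ [a] → σ c = τ c := fun c hc hx =>
        h c (by simpa [fn, hc] using hx)
      rw [subst_res, subst_res, subst_congr (under_congr hP), pick_congr hP]
  | par P Q, _, _, h => by
      simp only [subst]
      rw [subst_congr (P := P) fun a ha => h a (by simp [fn, ha]),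
        subst_congr (P := Q) fun a ha => h a (by simp [fn, ha])]
  | cond s t P Q, _, _, h => by
      simp only [subst]
      rw [subst_congr (P := P) fun a ha => h a (by simp [fn, ha]),
        subst_congr (P := Q) fun a ha => h a (by simp [fn, ha]),
        Term.subst_congr (t := s) fun a ha => h a (by simp [fn, ha]),
        Term.subst_congr (t := t) fun a ha => h a (by simp [fn, ha])]
  | rep P, _, _, h => by
      simp only [subst]
      rw [subst_congr (P := P) fun a ha => h a (by simp [fn, ha])]

/-- The free names of a scope after substitution, apart from the binding names. -/
theorem mem_fn_scope {σ : Name → Term} {P : Raw} {xs : List Name} {b : Name} :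
    ((∃ a ∈ P.fn, b ∈ (under σ P xs a).names) ∧ b ∉ xs.map fun x => pick σ P xs + xs.idxOf x) ↔
      ∃ a ∈ P.fn, a ∉ xs ∧ b ∈ (σ a).names := by
  constructor
  · rintro ⟨⟨a, ha, hb⟩, hx⟩
    by_cases hax : a ∈ xs
    · simp only [under, hax, if_true, Term.names, Finset.mem_singleton] at hb
      exact absurd (List.mem_map.2 ⟨a, hax, hb.symm⟩) hx
    · exact ⟨a, ha, hax, by simpa [under, hax] using hb⟩
  · rintro ⟨a, ha, hax, hb⟩
    refine ⟨⟨a, ha, by simpa [under, hax] using hb⟩, fun h => ?_⟩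
    obtain ⟨x, _, rfl⟩ := List.mem_map.1 h
    exact absurd (lt_pick ha hax hb) (Nat.not_lt.2 (Nat.le_add_right _ _))

theorem mem_fn_subst : ∀ {P : Raw} {σ : Name → Term} {b : Name},
    b ∈ (P.subst σ).fn ↔ ∃ a ∈ P.fn, b ∈ (σ a).names
  | nil, _, _ => by simp [subst, fn]
  | ok, _, _ => by simp [subst, fn]
  | outA m, _, _ => by simp only [subst, fn, Msg.mem_names_subst]
  | outS m P, _, _ => by
      simp only [subst, fn, Finset.mem_union, Msg.mem_names_subst, mem_fn_subst (P := P)]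
      grind
  | inp I P, σ, b => by
      rw [subst_inp]
      simp only [fn, Finset.mem_union, Finset.mem_sdiff, List.mem_toFinset, mem_inFn_subst,
        Lang.inBinders_subst, mem_fn_subst (P := P), mem_fn_scope]
      grind
  | res a P, σ, b => by
      rw [subst_res]
      have := mem_fn_scope (σ := σ) (P := P) (xs := [a]) (b := b)
      simp only [fn, Finset.mem_sdiff, Finset.mem_singleton, mem_fn_subst (P := P)]
      simp only [List.map_cons, List.map_nil, List.mem_singleton, List.idxOf_cons_self,
        Nat.add_zero] at this
      rw [this]
      grind
  | par P Q, _, _ => by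
      simp only [subst, fn, Finset.mem_union, mem_fn_subst (P := P), mem_fn_subst (P := Q)]
      grind
  | cond s t P Q, _, _ => by
      simp only [subst, fn, Finset.mem_union, mem_fn_subst (P := P), mem_fn_subst (P := Q),
        Term.mem_names_subst]
      grind
  | rep P, _, _ => by simp only [subst, fn, mem_fn_subst (P := P)]

/-- The picked name depends only on the names in the images of the free names of the restricted
scope, and this set is computed by composing images. -/
theorem pick_subst (σ τ : Name → Term) (P : Raw) (xs : List Name) :
    pick τ (P.subst (under σ P xs)) (xs.map fun x => pick σ P xs + xs.idxOf x) =
      pick (fun c => (σ c).subst τ) P xs := by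
  unfold pick
  congr 1
  ext b
  simp only [Finset.mem_biUnion, Finset.mem_sdiff, List.mem_toFinset, mem_fn_subst,
    Term.mem_names_subst]
  constructor
  · rintro ⟨a, h, hb⟩
    obtain ⟨c, hc, hx, ha⟩ := mem_fn_scope.1 h
    exact ⟨c, ⟨hc, hx⟩, a, ha, hb⟩
  · rintro ⟨c, ⟨hc, hx⟩, a, ha, hb⟩
    exact ⟨a, mem_fn_scope.2 ⟨c, hc, hx, ha⟩, hb⟩

theorem idxOf_pick (n : ℕ) (xs : List Name) {x : Name} (hx : x ∈ xs) :
    (xs.map fun y => n + xs.idxOf y).idxOf (n + xs.idxOf x) = xs.idxOf x :=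
  List.idxOf_map_of_injOn (f := fun y => n + xs.idxOf y) fun _ _ h =>
    (List.idxOf_inj hx).1 (Nat.add_left_cancel h)

/-- A binding name goes, on both sides, to the same offset from the same picked name. Any other free
name suffers no capture, because all names in its image are smaller than the picked name. -/
theorem under_subst (σ τ : Name → Term) (P : Raw) (xs : List Name) :
    ∀ c ∈ P.fn, (under σ P xs c).subst
      (under τ (P.subst (under σ P xs)) (xs.map fun x => pick σ P xs + xs.idxOf x)) =
      under (fun c => (σ c).subst τ) P xs c := by
  intro c hc
  by_cases hx : c ∈ xs
  · have : (pick σ P xs + xs.idxOf c) ∈ xs.map fun x => pick σ P xs + xs.idxOf x :=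
      List.mem_map.2 ⟨c, hx, rfl⟩
    simp only [under, hx, if_true, Term.subst, this, idxOf_pick _ _ hx]
    exact congrArg (fun n => Term.name (n + xs.idxOf c)) (pick_subst σ τ P xs)
  · simp only [under, hx, if_false]
    refine Term.subst_congr fun d hd => ?_
    have : d ∉ xs.map fun x => pick σ P xs + xs.idxOf x := by
      intro h
      obtain ⟨x, _, rfl⟩ := List.mem_map.1 h
      exact absurd (lt_pick hc hx hd) (Nat.not_lt.2 (Nat.le_add_right _ _))
    exact if_neg this

/-- An equality and not just an alpha-equivalence: the binders after a substitution are determined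
by the images of the free names, so the intermediate choice of binders leaves no trace. -/
theorem subst_subst : ∀ (P : Raw) (σ τ : Name → Term),
    (P.subst σ).subst τ = P.subst fun a => (σ a).subst τ
  | nil, _, _ => by simp only [subst]
  | ok, _, _ => by simp only [subst]
  | outA m, _, _ => by simp only [subst, Msg.subst_subst]
  | outS m P, _, _ => by simp only [subst, Msg.subst_subst, subst_subst P]
  | inp I P, σ, τ => by
      rw [subst_inp, subst_inp, subst_inp, Lang.inBinders_subst, subst_subst P,
        subst_congr (under_subst σ τ P (inBinders I)), inPart_subst_subst, pick_subst]
      congr 1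
      refine inPart_subst_congr (fun x hx => ?_) fun _ _ => rfl
      rw [idxOf_pick _ _ hx]
  | res a P, σ, τ => by
      rw [subst_res, subst_res, subst_res]
      have h₁ := pick_subst σ τ P [a]
      have h₂ := under_subst σ τ P [a]
      simp only [List.map_cons, List.map_nil, List.idxOf_cons_self, Nat.add_zero] at h₁ h₂
      rw [subst_subst P, subst_congr h₂, h₁]
  | par P Q, _, _ => by simp only [subst, subst_subst P, subst_subst Q]
  | cond s t P Q, _, _ => by simp only [subst, subst_subst P, subst_subst Q, Term.subst_subst]
  | rep P, _, _ => by simp only [subst, subst_subst P]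

/-! ### Permutations of names -/

theorem mem_fn_perm {π : Equiv.Perm Name} : ∀ {P : Raw} {b : Name},
    b ∈ (P.perm π).fn ↔ ∃ a ∈ P.fn, b = π a
  | nil, _ => by simp [perm, fn]
  | ok, _ => by simp [perm, fn]
  | outA m, _ => by simp [perm, fn, Msg.mem_names_subst, Term.names]
  | outS m P, _ => by
      simp only [perm, fn, Finset.mem_union, Msg.mem_names_subst, mem_fn_perm (P := P),
        Term.names, Finset.mem_singleton]
      grind
  | inp I P, b => by
      simp only [perm, fn, Finset.mem_union, Finset.mem_sdiff, List.mem_toFinset, mem_inFn_map,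
        inBinders_map, mem_fn_perm (P := P), List.mem_map]
      constructor
      · rintro (⟨a, ha, rfl⟩ | ⟨⟨a, ha, rfl⟩, h⟩)
        · exact ⟨a, Or.inl ha, rfl⟩
        · exact ⟨a, Or.inr ⟨ha, fun hx => h ⟨a, hx, rfl⟩⟩, rfl⟩
      · rintro ⟨a, ha | ⟨ha, hx⟩, rfl⟩
        · exact Or.inl ⟨a, ha, rfl⟩
        · exact Or.inr ⟨⟨a, ha, rfl⟩, by simpa using hx⟩
  | res a P, b => by
      simp only [perm, fn, Finset.mem_sdiff, Finset.mem_singleton, mem_fn_perm (P := P)]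
      constructor
      · rintro ⟨⟨c, hc, rfl⟩, h⟩
        exact ⟨c, ⟨hc, fun e => h (e ▸ rfl)⟩, rfl⟩
      · rintro ⟨c, ⟨hc, h⟩, rfl⟩
        exact ⟨⟨c, hc, rfl⟩, by simpa using h⟩
  | par P Q, _ => by
      simp only [perm, fn, Finset.mem_union, mem_fn_perm (P := P), mem_fn_perm (P := Q)]
      grind
  | cond s t P Q, _ => by
      simp only [perm, fn, Finset.mem_union, mem_fn_perm (P := P), mem_fn_perm (P := Q),
        Term.rename, Term.mem_names_subst, Term.names, Finset.mem_singleton]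
      grind
  | rep P, _ => by simp only [perm, fn, mem_fn_perm (P := P)]

theorem pick_perm (π : Equiv.Perm Name) (σ : Name → Term) (P : Raw) (xs : List Name) :
    pick σ (P.perm π) (xs.map π) = pick (fun a => σ (π a)) P xs := by
  unfold pick
  congr 1
  ext b
  simp only [Finset.mem_biUnion, Finset.mem_sdiff, List.mem_toFinset, mem_fn_perm, List.mem_map]
  constructor
  · rintro ⟨_, ⟨⟨a, ha, rfl⟩, h⟩, hb⟩
    exact ⟨a, ⟨ha, fun hx => h ⟨a, hx, rfl⟩⟩, hb⟩
  · rintro ⟨a, ⟨ha, h⟩, hb⟩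
    exact ⟨π a, ⟨⟨a, ha, rfl⟩, by simpa using h⟩, hb⟩

theorem under_perm (π : Equiv.Perm Name) (σ : Name → Term) (P : Raw) (xs : List Name) (c : Name) :
    under σ (P.perm π) (xs.map π) (π c) = under (fun a => σ (π a)) P xs c := by
  unfold under
  rw [pick_perm, List.idxOf_map_of_injOn fun y _ h => π.injective h]
  simp

/-- The permutation also moves the binders, but substitution renames all of these anew, so only its
effect on free names survives. -/
theorem perm_subst : ∀ (P : Raw) (π : Equiv.Perm Name) (σ : Name → Term),
    (P.perm π).subst σ = P.subst fun a => σ (π a)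
  | nil, _, _ => by simp only [subst, perm]
  | ok, _, _ => by simp only [subst, perm]
  | outA m, _, _ => by simp only [subst, perm, Msg.subst_subst, Term.subst]
  | outS m P, _, _ => by simp only [subst, perm, Msg.subst_subst, perm_subst P, Term.subst]
  | inp I P, π, σ => by
      rw [perm, subst_inp, subst_inp, inBinders_map, perm_subst P, pick_perm,
        inPart_map_eq_subst, inPart_subst_subst]
      simp only [under_perm, Term.subst]
      congr 1
      refine inPart_subst_congr (fun x hx => ?_) fun _ _ => rfl
      rw [List.idxOf_map_of_injOn fun y _ h => π.injective h]
  | res a P, π, σ => by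
      rw [perm, subst_res, subst_res, perm_subst P]
      have h₁ := pick_perm π σ P [a]
      have h₂ := under_perm π σ P [a]
      simp only [List.map_cons, List.map_nil] at h₁ h₂
      simp only [h₁, h₂]
  | par P Q, _, _ => by simp only [subst, perm, perm_subst P, perm_subst Q]
  | cond s t P Q, _, _ => by
      simp only [subst, perm, perm_subst P, perm_subst Q, Term.rename, Term.subst_subst,
        Term.subst]
  | rep P, _, _ => by simp only [subst, perm, perm_subst P]

end Raw
/-! ### Alpha-equivalence -/

/-- A map that is injective on a finite set of names agrees there with a permutation. -/
theorem exists_perm_eq_on (X : Finset Name) (f : Name → Name) (hf : Set.InjOn f X) :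
    ∃ π : Equiv.Perm Name, ∀ a ∈ X, π a = f a := by
  induction X using Finset.induction_on with
  | empty => exact ⟨1, by simp⟩
  | insert b X hb ih =>
      obtain ⟨π, hπ⟩ := ih (hf.mono (by simp))
      -- The transposition corrects the value at `b`; by injectivity it touches none of the values
      -- on `X`.
      refine ⟨(Equiv.swap (π b) (f b)) * π, fun a ha => ?_⟩
      rw [Finset.mem_insert] at ha
      rcases ha with rfl | ha
      · simp
      · have hab : a ≠ b := fun e => hb (e ▸ ha)
        have h₁ : π a ≠ π b := fun e => hab (π.injective e)
        have h₂ : π a ≠ f b := by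
          rw [hπ a ha]
          exact fun e => hab (hf (by simp [ha]) (by simp) e)
        rw [Equiv.Perm.mul_apply, Equiv.swap_apply_of_ne_of_ne h₁ h₂, hπ a ha]

theorem inPart_map_map (f f' g g' : Name → Name) (I : List InPart) :
    (I.map (InPart.map f g)).map (InPart.map f' g') = I.map (InPart.map (f' ∘ f) (g' ∘ g)) := by
  rw [inPart_map_eq_subst, inPart_map_eq_subst, inPart_map_eq_subst, inPart_subst_subst]
  rfl

namespace Raw

theorem perm_perm (π κ : Equiv.Perm Name) : ∀ P : Raw, (P.perm π).perm κ = P.perm (κ * π)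
  | nil => rfl
  | ok => rfl
  | outA m => by simp only [perm, Msg.subst_subst, Term.subst, Equiv.Perm.mul_apply]
  | outS m P => by
      simp only [perm, Msg.subst_subst, Term.subst, Equiv.Perm.mul_apply, perm_perm π κ P]
  | inp I P => by
      simp only [perm, inPart_map_map, perm_perm π κ P]
      rfl
  | res a P => by simp only [perm, perm_perm π κ P, Equiv.Perm.mul_apply]
  | par P Q => by simp only [perm, perm_perm π κ P, perm_perm π κ Q]
  | cond s t P Q => by
      simp only [perm, perm_perm π κ P, perm_perm π κ Q, Term.rename, Term.subst_subst,
        Term.subst, Equiv.Perm.mul_apply]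
  | rep P => by simp only [perm, perm_perm π κ P]

theorem subst_name_fn (P : Raw) : (P.subst Term.name).fn = P.fn := by
  ext b
  simp [mem_fn_subst, Term.names]

/-- Alpha-equivalent processes have the same substitution instances. -/
theorem subst_eq_of_alpha {P Q : Raw} (h : Alpha P Q) : ∀ σ, P.subst σ = Q.subst σ := by
  induction h with
  | refl P => exact fun _ => rfl
  | symm _ ih => exact fun σ => (ih σ).symm
  | trans _ _ ih ih' => exact fun σ => (ih σ).trans (ih' σ)
  | res_rename π a P h =>
      intro σ
      have h₁ := pick_perm π σ P [a]
      have h₂ := under_perm π σ P [a]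
      simp only [List.map_cons, List.map_nil] at h₁ h₂
      have h₃ : ∀ c ∈ P.fn, c ∉ [a] → σ (π c) = σ c := fun c hc hca => by
        rw [h c hc (by simpa using hca)]
      rw [subst_res, subst_res, perm_subst, h₁, pick_congr h₃]
      congr 1
      refine subst_congr fun c hc => ?_
      rw [h₂, under_congr h₃ c hc]
  | inp_rename π I P h =>
      intro σ
      have h₃ : ∀ c ∈ P.fn, c ∉ inBinders I → σ (π c) = σ c := fun c hc hca => by
        rw [h c hc hca]
      rw [subst_inp, subst_inp, perm_subst, inBinders_map, pick_perm, pick_congr h₃,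
        inPart_map_eq_subst, inPart_subst_subst]
      congr 1
      · refine inPart_subst_congr (fun x _ => ?_) fun a _ => rfl
        rw [List.idxOf_map_of_injOn fun _ _ h => π.injective h]
      · refine subst_congr fun c hc => ?_
        rw [under_perm, under_congr h₃ c hc]
  | outS m _ ih => intro σ; simp only [subst, ih]
  | @inp I P Q _ ih =>
      intro σ
      have hfn : P.fn = Q.fn := by rw [← subst_name_fn P, ih, subst_name_fn]
      have hp : pick σ P (inBinders I) = pick σ Q (inBinders I) := by
        unfold pick
        rw [hfn]
      have hu : under σ P (inBinders I) = under σ Q (inBinders I) := by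
        funext c
        unfold under
        rw [hp]
      rw [subst_inp, subst_inp, ih, hp, hu]
  | @res a P Q _ ih =>
      intro σ
      have hfn : P.fn = Q.fn := by rw [← subst_name_fn P, ih, subst_name_fn]
      have hp : pick σ P [a] = pick σ Q [a] := by
        unfold pick
        rw [hfn]
      have hu : under σ P [a] = under σ Q [a] := by
        funext c
        unfold under
        rw [hp]
      rw [subst_res, subst_res, ih, hp, hu]
  | par _ _ ih ih' => intro σ; simp only [subst, ih, ih']
  | cond s t _ _ ih ih' => intro σ; simp only [subst, ih, ih']
  | rep _ ih => intro σ; simp only [subst, ih]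

theorem fn_eq_of_alpha {P Q : Raw} (h : Alpha P Q) : P.fn = Q.fn := by
  rw [← subst_name_fn P, subst_eq_of_alpha h, subst_name_fn]

/-- Below a binder the substitution induced by a permutation stays injective on the free names of
the scope: binding names go to `n` or above, all others below `n`. Hence it is again given by a
permutation, and the induction for `alpha_perm_subst` can pass the binder. -/
theorem under_perm_eq (π : Equiv.Perm Name) (P : Raw) (xs : List Name) :
    ∃ κ : Equiv.Perm Name,
      (∀ c ∈ P.fn, under (fun a => .name (π a)) P xs c = .name (κ c)) ∧
      (∀ x ∈ xs, κ x = pick (fun a => .name (π a)) P xs + xs.idxOf x) ∧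
      ∀ c ∈ P.fn, c ∉ xs → κ c = π c := by
  set n := pick (fun a => .name (π a)) P xs with hn
  have hlt : ∀ c ∈ P.fn, c ∉ xs → π c < n := fun c hc hx =>
    lt_pick (σ := fun a => .name (π a)) hc hx (by simp [Term.names])
  obtain ⟨κ, hκ⟩ := exists_perm_eq_on (P.fn ∪ xs.toFinset)
    (fun c => if c ∈ xs then n + xs.idxOf c else π c) (by
      intro c hc d hd h
      simp only [Finset.coe_union, Set.mem_union, Finset.mem_coe, List.mem_toFinset] at hc hd
      by_cases hcx : c ∈ xs <;> by_cases hdx : d ∈ xs <;> simp only [hcx, hdx, if_true, if_false] at h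
      · exact (List.idxOf_inj hcx).1 (Nat.add_left_cancel h)
      · have := hlt d (hd.resolve_right hdx) hdx
        exact absurd this (by rw [← h]; exact Nat.not_lt.2 (Nat.le_add_right _ _))
      · have := hlt c (hc.resolve_right hcx) hcx
        exact absurd this (by rw [h]; exact Nat.not_lt.2 (Nat.le_add_right _ _))
      · exact π.injective h)
  refine ⟨κ, fun c hc => ?_, fun x hx => ?_, fun c hc hx => ?_⟩
  · rw [hκ c (by simp [hc])]
    unfold under
    rw [← hn]
    split_ifs <;> rfl
  · rw [hκ x (by simp [hx])]
    simp [hx]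
  · rw [hκ c (by simp [hc])]
    simp [hx]

theorem alpha_perm_subst : ∀ (P : Raw) (π : Equiv.Perm Name),
    Alpha (P.perm π) (P.subst fun a => .name (π a))
  | nil, _ => by simp only [perm, subst]; exact .refl _
  | ok, _ => by simp only [perm, subst]; exact .refl _
  | outA m, _ => by simp only [perm, subst]; exact .refl _
  | outS m P, π => by simp only [perm, subst]; exact .outS _ (alpha_perm_subst P π)
  | inp I P, π => by
      obtain ⟨κ, h₁, h₂, h₃⟩ := under_perm_eq π P (inBinders I)
      rw [subst_inp, subst_congr h₁, perm]
      -- `κ * π⁻¹` takes the permuted binders to the picked ones and fixes the other free names of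
      -- the permuted scope.
      refine .trans (.inp_rename (κ * π⁻¹) _ _ ?_) ?_
      · intro c hc hx
        obtain ⟨a, ha, rfl⟩ := mem_fn_perm.1 hc
        rw [inBinders_map] at hx
        have hax : a ∉ inBinders I := fun h => hx (List.mem_map.2 ⟨a, h, rfl⟩)
        simp [h₃ a ha hax]
      · rw [perm_perm, inPart_map_map, inPart_map_eq_subst]
        have : I.map (InPart.subst (⇑(κ * π⁻¹) ∘ ⇑π) fun a => .name ((id ∘ ⇑π) a)) =
            I.map (InPart.subst (fun x => pick (fun a => .name (π a)) P (inBinders I) +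
              (inBinders I).idxOf x) fun a => .name (π a)) :=
          inPart_subst_congr (fun x hx => by simp [h₂ x hx]) fun _ _ => rfl
        rw [this, inv_mul_cancel_right]
        exact .inp _ (alpha_perm_subst P κ)
  | res a P, π => by
      obtain ⟨κ, h₁, h₂, h₃⟩ := under_perm_eq π P [a]
      have h₂ : κ a = pick (fun a => .name (π a)) P [a] := by simpa using h₂ a (by simp)
      rw [subst_res, subst_congr h₁, perm, ← h₂]
      refine .trans (.res_rename (κ * π⁻¹) _ _ ?_) ?_
      · intro c hc hx
        obtain ⟨b, hb, rfl⟩ := mem_fn_perm.1 hc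
        have : b ≠ a := fun e => hx (e ▸ rfl)
        simp [h₃ b hb (by simpa using this)]
      · rw [perm_perm, inv_mul_cancel_right]
        simpa using Alpha.res (κ a) (alpha_perm_subst P κ)
  | par P Q, π => by
      simp only [perm, subst]; exact .par (alpha_perm_subst P π) (alpha_perm_subst Q π)
  | cond s t P Q, π => by
      simp only [perm, subst]; exact .cond _ _ (alpha_perm_subst P π) (alpha_perm_subst Q π)
  | rep P, π => by simp only [perm, subst]; exact .rep (alpha_perm_subst P π)

theorem perm_one (P : Raw) : P.perm 1 = P := by
  have hpat : ∀ p : Pat, p.map (⇑(1 : Equiv.Perm Name)) (⇑(1 : Equiv.Perm Name)) = p := by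
    intro p
    induction p with
    | bind => rfl
    | mtch => rfl
    | comp p q hp hq => simp only [Pat.map, hp, hq]
  have hterm : ∀ t : Term, t.subst (fun a => .name ((1 : Equiv.Perm Name) a)) = t :=
    fun t => Term.subst_name t
  have hmsg : ∀ m : Msg, m.subst (fun a => .name ((1 : Equiv.Perm Name) a)) = m := by
    rintro ⟨c, ts⟩
    simp only [Msg.subst, Msg.mk.injEq]
    constructor
    · cases c
      · rfl
      · simp
    · exact (List.map_congr_left fun t _ => hterm t).trans (List.map_id _)
  have hpart : ∀ i : InPart, i.map (⇑(1 : Equiv.Perm Name)) (⇑(1 : Equiv.Perm Name)) = i := by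
    rintro ⟨c, ps⟩
    simp only [InPart.map, InPart.mk.injEq]
    constructor
    · cases c
      · rfl
      · exact congrArg some (hterm _)
    · exact (List.map_congr_left fun t _ => hpat t).trans (List.map_id _)
  induction P with
  | nil => rfl
  | ok => rfl
  | outA m => simp only [perm, hmsg]
  | outS m P ih => simp only [perm, hmsg, ih]
  | inp I P ih =>
      simp only [perm, ih]
      rw [(List.map_congr_left fun i _ => hpart i).trans (List.map_id _)]
  | res a P ih => simp only [perm, ih, Equiv.Perm.one_apply]
  | par P Q ih ih' => simp only [perm, ih, ih']
  | cond s t P Q ih ih' => simp only [perm, ih, ih', Term.rename, hterm]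
  | rep P ih => simp only [perm, ih]

theorem alpha_subst_name (P : Raw) : Alpha P (P.subst Term.name) := by
  have := alpha_perm_subst P 1
  rwa [perm_one] at this

/-- The identity substitution renames all binders canonically, so it computes normal forms for
alpha-equivalence. -/
theorem alpha_iff {P Q : Raw} : Alpha P Q ↔ P.subst Term.name = Q.subst Term.name :=
  ⟨fun h => subst_eq_of_alpha h _, fun h =>
    (alpha_subst_name P).trans (h ▸ (alpha_subst_name Q).symm)⟩

/-- A restricted name can be replaced by any name that is not free in the restriction. -/
theorem alpha_res_swap {a c : Name} {P : Raw} (h : c ∉ (res a P).fn) :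
    Alpha (res a P) (res c (P.perm (Equiv.swap a c))) := by
  have := Alpha.res_rename (Equiv.swap a c) a P fun d hd hda => by
    refine Equiv.swap_apply_of_ne_of_ne hda ?_
    rintro rfl
    exact h (by simp [fn, hd, hda])
  simpa using this

end Raw

/-! ### Reduction stays inside the language -/

namespace Lang

variable {L : Lang}

theorem termOk_rename {f : Name → Name} {t : Term} : L.TermOk (t.rename f) ↔ L.TermOk t := by
  refine imp_congr_right fun _ => ?_
  cases t <;> simp [Term.rename, Term.subst]

theorem chanOk_rename {f : Name → Name} {c : Option Term} :
    L.ChanOk (c.map (Term.rename f)) ↔ L.ChanOk c := by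
  unfold ChanOk
  cases L.medium <;> cases c <;> simp [termOk_rename]

theorem patOk_map {f g : Name → Name} {p : Pat} : L.PatOk (p.map f g) ↔ L.PatOk p := by
  unfold PatOk
  cases L.matching <;> cases p <;> simp [Pat.map]

theorem partOk_map {f g : Name → Name} {i : InPart} : L.PartOk (i.map f g) ↔ L.PartOk i := by
  simp [PartOk, InPart.map, chanOk_rename, patOk_map]

theorem inputOk_map {f g : Name → Name} (hf : Function.Injective f) {I : List InPart} :
    L.InputOk (I.map (InPart.map f g)) ↔ L.InputOk I := by
  simp only [InputOk, inBinders_map, List.nodup_map_iff hf]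
  simp [partOk_map]

theorem msgOk_rename {f : Name → Name} {m : Msg} :
    L.MsgOk (m.subst fun a => .name (f a)) ↔ L.MsgOk m := by
  have h₁ : L.ChanOk (m.chan.map (Term.subst fun a => .name (f a))) ↔ L.ChanOk m.chan :=
    chanOk_rename
  have h₂ : ∀ t : Term, L.TermOk (t.subst fun a => .name (f a)) ↔ L.TermOk t :=
    fun t => termOk_rename
  simp [MsgOk, Msg.subst, h₁, h₂]

theorem wf_perm {π : Equiv.Perm Name} : ∀ {P : Raw}, L.Wf (P.perm π) ↔ L.Wf P
  | .nil => Iff.rfl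
  | .ok => Iff.rfl
  | .outA m => by simp only [Raw.perm, Wf, msgOk_rename]
  | .outS m P => by simp only [Raw.perm, Wf, msgOk_rename, wf_perm (P := P)]
  | .inp I P => by simp only [Raw.perm, Wf, inputOk_map π.injective, wf_perm (P := P)]
  | .res a P => by simp only [Raw.perm, Wf, wf_perm (P := P)]
  | .par P Q => by simp only [Raw.perm, Wf, wf_perm (P := P), wf_perm (P := Q)]
  | .cond s t P Q => by simp only [Raw.perm, Wf, wf_perm (P := P), wf_perm (P := Q)]
  | .rep P => by simp only [Raw.perm, Wf, wf_perm (P := P)]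

theorem wf_of_alpha {P Q : Raw} (h : Alpha P Q) : L.Wf P ↔ L.Wf Q := by
  induction h with
  | refl => rfl
  | symm _ ih => exact ih.symm
  | trans _ _ ih ih' => exact ih.trans ih'
  | res_rename π a P _ => simp only [Wf, wf_perm]
  | inp_rename π I P _ => simp only [Wf, wf_perm, inputOk_map π.injective]
  | outS _ _ ih => simp only [Wf, ih]
  | inp _ _ ih => simp only [Wf, ih]
  | res _ _ ih => simp only [Wf, ih]
  | par _ _ ih ih' => simp only [Wf, ih, ih']
  | cond _ _ _ _ ih ih' => simp only [Wf, ih, ih']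
  | rep _ ih => simp only [Wf, ih]

/-- The side conditions of the two conditional axioms matter here: without them, reading such an
axiom from right to left could introduce a branch from outside the language. -/
theorem wf_of_struct {P Q : Raw} (h : Struct L P Q) : L.Wf P ↔ L.Wf Q := by
  induction h with
  | refl => rfl
  | symm _ ih => exact ih.symm
  | trans _ _ ih ih' => exact ih.trans ih'
  | alpha h => exact wf_of_alpha h
  | par _ _ ih ih' => simp only [Wf, ih, ih']
  | res _ _ ih => simp only [Wf, ih]
  | cond_eq s t P Q h hQ => simp only [Wf, hQ, and_true]
  | cond_ne s t P Q h hP => simp only [Wf, hP, true_and]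
  | par_nil | res_nil | res_comm | extrude => simp [Wf]
  | par_comm P Q => simp only [Wf, and_comm]
  | par_assoc P Q R => simp only [Wf, and_assoc]
  | rep_unfold P => simp only [Wf, and_self]

theorem termOk_matchTerm : ∀ {t : Term} {p : Pat} {σ : List (Name × Term)},
    matchTerm t p = some σ → L.TermOk t → ∀ x ∈ σ, L.TermOk x.2
  | t, .bind x, σ, h, ht => by
      have : matchTerm t (.bind x) = some [(x, t)] := by cases t <;> rfl
      rw [this] at h
      cases h
      simpa using ht
  | .name a, .mtch b, σ, h, ht => by
      simp only [matchTerm] at h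
      split_ifs at h
      cases h
      simp
  | .comp s t, .comp p q, σ, h, ht => by
      simp only [matchTerm, Option.bind_eq_bind, Option.bind_eq_some_iff, Option.pure_def,
        Option.some.injEq] at h
      have hI : L.matching = .intensional := by
        by_contra hc
        obtain ⟨a, ha⟩ := ht hc
        cases ha
      exact fun x _ hc => absurd hI hc
  | .name _, .comp _ _, _, h, _ => by simp [matchTerm] at h
  | .comp _ _, .mtch _, _, h, _ => by simp [matchTerm] at h

theorem termOk_polyMatch : ∀ {ts : List Term} {ps : List Pat} {σ : List (Name × Term)},
    polyMatch ts ps = some σ → (∀ t ∈ ts, L.TermOk t) → ∀ x ∈ σ, L.TermOk x.2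
  | [], [], σ, h, _ => by cases h; simp
  | t :: ts, p :: ps, σ, h, ht => by
      simp only [polyMatch, Option.bind_eq_bind, Option.bind_eq_some_iff, Option.pure_def,
        Option.some.injEq] at h
      obtain ⟨σ₁, h₁, σ₂, h₂, rfl⟩ := h
      intro x hx
      rcases List.mem_append.1 hx with hx | hx
      · exact termOk_matchTerm h₁ (ht t (by simp)) x hx
      · exact termOk_polyMatch h₂ (fun t h => ht t (by simp [h])) x hx
  | [], _ :: _, _, h, _ => by simp [polyMatch] at h
  | _ :: _, [], _, h, _ => by simp [polyMatch] at h

theorem termOk_joinMatch : ∀ {ms : List Msg} {I : List InPart} {σ : List (Name × Term)},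
    joinMatch ms I = some σ → (∀ m ∈ ms, L.MsgOk m) → ∀ x ∈ σ, L.TermOk x.2
  | [], [], σ, h, _ => by cases h; simp
  | m :: ms, i :: I, σ, h, hm => by
      simp only [joinMatch] at h
      split_ifs at h
      simp only [Option.bind_eq_bind, Option.bind_eq_some_iff, Option.pure_def,
        Option.some.injEq] at h
      obtain ⟨σ₁, h₁, σ₂, h₂, rfl⟩ := h
      intro x hx
      rcases List.mem_append.1 hx with hx | hx
      · exact termOk_polyMatch h₁ (hm m (by simp)).2.2 x hx
      · exact termOk_joinMatch h₂ (fun t h => hm t (by simp [h])) x hx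
  | [], _ :: _, _, h, _ => by simp [joinMatch] at h
  | _ :: _, [], _, h, _ => by simp [joinMatch] at h

theorem termOk_listSubst {σ : List (Name × Term)} (h : ∀ x ∈ σ, L.TermOk x.2) (a : Name) :
    L.TermOk (listSubst σ a) := by
  unfold listSubst
  cases hl : σ.lookup a with
  | none => exact fun _ => ⟨a, rfl⟩
  | some t =>
      have : (a, t) ∈ σ := by
        induction σ with
        | nil => simp at hl
        | cons y σ ih =>
            obtain ⟨b, u⟩ := y
            by_cases hab : a = b
            · subst hab
              simp only [List.lookup_cons, beq_self_eq_true, Option.some.injEq] at hl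
              simp [hl]
            · have hb : (a == b) = false := by simpa using hab
              simp only [List.lookup_cons, hb] at hl
              exact List.mem_cons_of_mem _ (ih (fun x hx => h x (by simp [hx])) hl)
      simpa using h _ this

theorem wf_foldr {β : Type} (f : β → Raw) (bs : List β) (R : Raw) :
    L.Wf (bs.foldr (fun b R => .par (f b) R) R) ↔ (∀ b ∈ bs, L.Wf (f b)) ∧ L.Wf R := by
  induction bs with
  | nil => simp
  | cons b bs ih => simp only [List.foldr_cons, Wf, ih, List.forall_mem_cons, and_assoc]

theorem wf_of_red {P Q : Raw} (h : Red L P Q) : L.Wf P → L.Wf Q := by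
  induction h with
  | commA ms I Q σ h =>
      intro hw
      obtain ⟨hm, -, hQ⟩ := (wf_foldr Raw.outA ms _).1 hw
      exact Wf.subst Q _ (termOk_listSubst (termOk_joinMatch h fun m h => (hm m h).2)) hQ
  | commS ms I Q σ h =>
      intro hw
      obtain ⟨hm, -, hQ⟩ := (wf_foldr (fun x : Msg × Raw => Raw.outS x.1 x.2) ms _).1 hw
      refine (wf_foldr (fun x : Msg × Raw => x.2) ms _).2 ⟨fun m h => (hm m h).2.2, ?_⟩
      refine Wf.subst Q _ (termOk_listSubst (termOk_joinMatch h fun m h => ?_)) hQ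
      obtain ⟨x, hx, rfl⟩ := List.mem_map.1 h
      exact (hm x hx).2.1
  | par Q _ ih => exact fun hw => ⟨ih hw.1, hw.2⟩
  | res a _ ih => exact ih
  | struct h _ h' ih => exact fun hw => (wf_of_struct h').1 (ih ((wf_of_struct h).1 hw))

end Lang
/-! ### What a process offers to its environment

A message, or a demand for one, is abstracted to the names that decide whether the two match.
An argument `none` of a message is a name that no name-match can refer to; an argument `none`
of a demand is a binding name. -/

structure Shape : Type where
  chan : Option Name
  args : List (Option Name)

namespace Shape

def Mem (a : Name) (o : Shape) : Prop := o.chan = some a ∨ some a ∈ o.args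

/-- The demand `d` is satisfied by the message `o`. -/
def Fits (d o : Shape) : Prop :=
  d.chan = o.chan ∧ List.Forall₂ (fun p t => p = none ∨ p = t) d.args o.args

def ren (f : Name → Name) (o : Shape) : Shape := ⟨o.chan.map f, o.args.map (Option.map f)⟩

def hideArg (V : Finset Name) : Option Name → Option Name
  | none => none
  | some a => if a ∈ V then none else some a

/-- Outside a restriction a hidden datum can still be received by a binding name, but no name-match
can refer to it. Channels stay as they are: a message on a restricted channel is excluded altogether
by the side condition in `Offers`. -/
def hide (V : Finset Name) (o : Shape) : Shape := ⟨o.chan, o.args.map (hideArg V)⟩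

theorem hideArg_hideArg (V W : Finset Name) (t : Option Name) :
    hideArg V (hideArg W t) = hideArg (W ∪ V) t := by
  cases t with
  | none => rfl
  | some a => by_cases hW : a ∈ W <;> by_cases hV : a ∈ V <;> simp [hideArg, hW, hV]

theorem hide_hide (V W : Finset Name) (o : Shape) : (o.hide W).hide V = o.hide (W ∪ V) := by
  simp [hide, Function.comp_def, hideArg_hideArg]

theorem hide_eq_self {V : Finset Name} {o : Shape} (h : ∀ a ∈ V, some a ∉ o.args) :
    o.hide V = o := by
  obtain ⟨c, ts⟩ := o
  simp only [hide, mk.injEq, true_and]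
  refine (List.map_congr_left (g := id) fun t ht => ?_).trans (List.map_id _)
  cases t with
  | none => rfl
  | some a =>
      have : a ∉ V := fun ha => h a ha ht
      simp [hideArg, this]

@[simp] theorem hide_empty (o : Shape) : o.hide ∅ = o := hide_eq_self (by simp)

theorem mem_hide {V : Finset Name} {o : Shape} {a : Name} (h : Mem a (o.hide V)) : Mem a o := by
  rcases h with h | h
  · exact Or.inl h
  · obtain ⟨t, ht, hta⟩ := List.mem_map.1 h
    cases t with
    | none => simp [hideArg] at hta
    | some b =>
        by_cases hb : b ∈ V <;> simp only [hideArg, hb, if_true, if_false, reduceCtorEq] at hta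
        exact Or.inr (hta ▸ ht)

theorem not_mem_hide {V : Finset Name} {o : Shape} {a : Name} (ha : a ∈ V)
    (hc : o.chan ≠ some a) : ¬ Mem a (o.hide V) := by
  rintro (h | h)
  · exact hc h
  · obtain ⟨t, ht, hta⟩ := List.mem_map.1 h
    cases t with
    | none => simp [hideArg] at hta
    | some b =>
        by_cases hb : b ∈ V <;> simp only [hideArg, hb, if_true, if_false, reduceCtorEq] at hta
        cases hta
        exact hb ha

theorem ren_congr {f g : Name → Name} {o : Shape} (h : ∀ a, Mem a o → f a = g a) :
    o.ren f = o.ren g := by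
  obtain ⟨c, ts⟩ := o
  simp only [ren, mk.injEq]
  constructor
  · cases c with
    | none => rfl
    | some a => simp [h a (Or.inl rfl)]
  · refine List.map_congr_left fun t ht => ?_
    cases t with
    | none => rfl
    | some a => simp [h a (Or.inr ht)]

@[simp] theorem ren_id (o : Shape) : o.ren (fun a => a) = o := by
  obtain ⟨c, ts⟩ := o
  simp [ren]

theorem ren_ren (f g : Name → Name) (o : Shape) : (o.ren f).ren g = o.ren fun a => g (f a) := by
  obtain ⟨c, ts⟩ := o
  simp [ren, Function.comp_def]

theorem ren_hide (π : Equiv.Perm Name) (a : Name) (o : Shape) :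
    (o.hide {a}).ren π = (o.ren π).hide {π a} := by
  obtain ⟨c, ts⟩ := o
  simp only [ren, hide, mk.injEq, List.map_map, true_and]
  refine List.map_congr_left fun t _ => ?_
  cases t with
  | none => rfl
  | some b => by_cases hb : b = a <;> simp [hideArg, hb]

theorem mem_ren {π : Equiv.Perm Name} {o : Shape} {b : Name} :
    Mem b (o.ren π) ↔ Mem (π.symm b) o := by
  obtain ⟨c, ts⟩ := o
  have key : ∀ t : Option Name, t.map π = some b ↔ t = some (π.symm b) := by
    intro t
    cases t with
    | none => simp
    | some a => simp [Equiv.eq_symm_apply]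
  simp only [Mem, ren, key, List.mem_map]
  simp

/-- A demand that does not mention `V` cannot tell a hidden datum from a name in `V`: binding names
accept both, and a match for some other name rejects both. -/
theorem fits_hide_iff {d o : Shape} {V : Finset Name} (h : ∀ a ∈ V, ¬ Mem a d) :
    Fits d (o.hide V) ↔ Fits d o := by
  have key : ∀ (ps ts : List (Option Name)), (∀ a ∈ V, some a ∉ ps) →
      (List.Forall₂ (fun p t => p = none ∨ p = t) ps (ts.map (hideArg V)) ↔
        List.Forall₂ (fun p t => p = none ∨ p = t) ps ts) := by
    intro ps
    induction ps with
    | nil => intro ts _; cases ts <;> simp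
    | cons p ps ih =>
        intro ts hps
        cases ts with
        | nil => simp
        | cons t ts =>
            simp only [List.map_cons, List.forall₂_cons]
            rw [ih ts fun a ha h => hps a ha (by simp [h])]
            refine and_congr_left fun _ => ?_
            cases p with
            | none => simp
            | some c =>
                cases t with
                | none => simp [hideArg]
                | some b =>
                    by_cases hb : b ∈ V
                    · have hcb : c ≠ b := fun e => hps b hb (by simp [e])
                      simp [hideArg, hb, hcb]
                    · simp [hideArg, hb]
  exact and_congr_right fun _ => key _ _ fun a ha h' => h a ha (Or.inr h')

theorem Fits.ren {d o : Shape} (h : Fits d o) (f : Name → Name) : Fits (d.ren f) (o.ren f) := by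
  refine ⟨by simp [Shape.ren, h.1], ?_⟩
  simp only [Shape.ren, List.forall₂_map_left_iff, List.forall₂_map_right_iff]
  exact h.2.imp fun p t hpt => by rcases hpt with rfl | rfl <;> simp

end Shape

/-! ### Shapes of messages and of input patterns -/

def Term.asName : Term → Option Name
  | .name a => some a
  | .comp _ _ => none

theorem Term.asName_rename (f : Name → Name) (t : Term) :
    (t.subst fun a => .name (f a)).asName = t.asName.map f := by
  cases t <;> rfl

theorem Term.mem_names_of_asName {t : Term} {a : Name} (h : t.asName = some a) : a ∈ t.names := by
  cases t with
  | name b => cases h; simp [names]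
  | comp s t => cases h

/-- The names of the data count only if `nm` holds. -/
def argShape (nm : Bool) (t : Term) : Option Name := if nm then t.asName else none

def patShape (nm : Bool) : Pat → Option Name
  | .mtch a => if nm then some a else none
  | _ => none

def Msg.shape (nm : Bool) (m : Msg) : Shape :=
  ⟨m.chan.bind Term.asName, m.args.map (argShape nm)⟩

def InPart.shape (nm : Bool) (i : InPart) : Shape :=
  ⟨i.chan.bind Term.asName, i.pats.map (patShape nm)⟩

theorem Msg.shape_rename (nm : Bool) (f : Name → Name) (m : Msg) :
    (m.subst fun a => .name (f a)).shape nm = (m.shape nm).ren f := by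
  obtain ⟨c, ts⟩ := m
  simp only [shape, subst, Shape.ren, Shape.mk.injEq, List.map_map]
  constructor
  · cases c with
    | none => rfl
    | some t => exact Term.asName_rename f t
  · refine List.map_congr_left fun t _ => ?_
    cases nm
    · rfl
    · exact Term.asName_rename f t

theorem InPart.shape_map (nm : Bool) (f g : Name → Name) (i : InPart) :
    (i.map f g).shape nm = (i.shape nm).ren g := by
  obtain ⟨c, ps⟩ := i
  simp only [shape, map, Shape.ren, Shape.mk.injEq, List.map_map]
  constructor
  · cases c with
    | none => rfl
    | some t => exact Term.asName_rename g t
  · refine List.map_congr_left fun p _ => ?_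
    cases nm <;> cases p <;> rfl

theorem Msg.mem_names_of_shape {nm : Bool} {m : Msg} {a : Name} (h : (m.shape nm).Mem a) :
    a ∈ m.names := by
  rw [mem_names_msg, mem_chanNames]
  rcases h with h | h
  · obtain ⟨t, ht, h⟩ := Option.bind_eq_some_iff.1 h
    exact Or.inl ⟨t, ht, Term.mem_names_of_asName h⟩
  · obtain ⟨t, ht, h⟩ := List.mem_map.1 h
    cases nm
    · cases h
    · exact Or.inr ⟨t, ht, Term.mem_names_of_asName h⟩

theorem InPart.mem_fn_of_shape {nm : Bool} {i : InPart} {a : Name} (h : (i.shape nm).Mem a) :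
    a ∈ i.fn := by
  rw [InPart.mem_fn, mem_chanNames]
  rcases h with h | h
  · obtain ⟨t, ht, h⟩ := Option.bind_eq_some_iff.1 h
    exact Or.inl ⟨t, ht, Term.mem_names_of_asName h⟩
  · obtain ⟨p, hp, h⟩ := List.mem_map.1 h
    cases nm <;> cases p <;> simp only [patShape, if_true, reduceCtorEq] at h
    · simp at h
    · cases h
      exact Or.inr ⟨_, hp, by simp [Pat.fn]⟩

/-- `P` has the messages `M` at top level, none of them on a restricted channel. -/
inductive Offers (nm : Bool) : Raw → Multiset Shape → Prop
  | zero (P) : Offers nm P 0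
  | outA (m) : Offers nm (.outA m) {m.shape nm}
  | outS (m P) : Offers nm (.outS m P) {m.shape nm}
  | par {P Q M N} : Offers nm P M → Offers nm Q N → Offers nm (.par P Q) (M + N)
  | res {a P M} : Offers nm P M → (∀ o ∈ M, o.chan ≠ some a) →
      Offers nm (.res a P) (M.map (Shape.hide {a}))
  | cond_eq {s t P M} (Q) : s = t → Offers nm P M → Offers nm (.cond s t P Q) M
  | cond_ne {s t Q M} (P) : s ≠ t → Offers nm Q M → Offers nm (.cond s t P Q) M
  | rep {P M N} : Offers nm P M → Offers nm (.rep P) N → Offers nm (.rep P) (M + N)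

/-- `P` has a success, or an input at top level whose demands are met inside `P` up to the
demands `D`. -/
inductive Needs (nm : Bool) : Raw → Multiset Shape → Prop
  | ok : Needs nm .ok 0
  | inp (I P) : Needs nm (.inp I P) (I.map (InPart.shape nm) : List Shape)
  | parL {P Q D D' M} : Needs nm P (D + D') → Offers nm Q M → Multiset.Rel Shape.Fits D' M →
      Needs nm (.par P Q) D
  | parR {P Q D D' M} : Offers nm P M → Needs nm Q (D + D') → Multiset.Rel Shape.Fits D' M →
      Needs nm (.par P Q) D
  | res {a P D} : Needs nm P D → (∀ d ∈ D, ¬ d.Mem a) → Needs nm (.res a P) D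
  | cond_eq {s t P D} (Q) : s = t → Needs nm P D → Needs nm (.cond s t P Q) D
  | cond_ne {s t Q D} (P) : s ≠ t → Needs nm Q D → Needs nm (.cond s t P Q) D
  | repL {P D D' M} : Needs nm P (D + D') → Offers nm (.rep P) M →
      Multiset.Rel Shape.Fits D' M → Needs nm (.rep P) D
  | repR {P D D' M} : Offers nm P M → Needs nm (.rep P) (D + D') →
      Multiset.Rel Shape.Fits D' M → Needs nm (.rep P) D

variable {nm : Bool}

/-! ### Inversion rules for offers and needs -/

section Inversion

variable {P Q : Raw} {M D : Multiset Shape}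

theorem offers_nil : Offers nm .nil M ↔ M = 0 :=
  ⟨fun h => by cases h; rfl, fun h => h ▸ .zero _⟩

theorem offers_inp {I : List InPart} : Offers nm (.inp I P) M ↔ M = 0 :=
  ⟨fun h => by cases h; rfl, fun h => h ▸ .zero _⟩

theorem offers_outA {m : Msg} : Offers nm (.outA m) M ↔ M = 0 ∨ M = {m.shape nm} := by
  constructor
  · intro h
    cases h
    exacts [Or.inl rfl, Or.inr rfl]
  · rintro (rfl | rfl)
    exacts [.zero _, .outA _]

theorem offers_outS {m : Msg} : Offers nm (.outS m P) M ↔ M = 0 ∨ M = {m.shape nm} := by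
  constructor
  · intro h
    cases h
    exacts [Or.inl rfl, Or.inr rfl]
  · rintro (rfl | rfl)
    exacts [.zero _, .outS _ _]

theorem offers_par : Offers nm (.par P Q) M ↔
    ∃ M₁ M₂, Offers nm P M₁ ∧ Offers nm Q M₂ ∧ M = M₁ + M₂ := by
  constructor
  · intro h
    cases h with
    | zero => exact ⟨0, 0, .zero _, .zero _, rfl⟩
    | par h h' => exact ⟨_, _, h, h', rfl⟩
  · rintro ⟨M₁, M₂, h, h', rfl⟩
    exact .par h h'

theorem offers_res {a : Name} : Offers nm (.res a P) M ↔
    ∃ N, Offers nm P N ∧ (∀ o ∈ N, o.chan ≠ some a) ∧ M = N.map (Shape.hide {a}) := by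
  constructor
  · intro h
    cases h with
    | zero => exact ⟨0, .zero _, by simp, rfl⟩
    | res h h' => exact ⟨_, h, h', rfl⟩
  · rintro ⟨N, h, h', rfl⟩
    exact .res h h'

theorem offers_cond {s t : Term} : Offers nm (.cond s t P Q) M ↔
    Offers nm (if s = t then P else Q) M := by
  constructor
  · intro h
    cases h with
    | zero => exact .zero _
    | cond_eq _ e h => simpa [e] using h
    | cond_ne _ e h => simpa [e] using h
  · intro h
    split_ifs at h with e
    exacts [.cond_eq _ e h, .cond_ne _ e h]

theorem offers_rep : Offers nm (.rep P) M ↔ Offers nm (.par P (.rep P)) M := by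
  rw [offers_par]
  constructor
  · intro h
    cases h with
    | zero => exact ⟨0, 0, .zero _, .zero _, rfl⟩
    | rep h h' => exact ⟨_, _, h, h', rfl⟩
  · rintro ⟨M₁, M₂, h, h', rfl⟩
    exact .rep h h'

theorem needs_par : Needs nm (.par P Q) D ↔
    (∃ D' M, Needs nm P (D + D') ∧ Offers nm Q M ∧ Multiset.Rel Shape.Fits D' M) ∨
      ∃ D' M, Offers nm P M ∧ Needs nm Q (D + D') ∧ Multiset.Rel Shape.Fits D' M := by
  constructor
  · intro h
    cases h with
    | parL h h' h'' => exact Or.inl ⟨_, _, h, h', h''⟩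
    | parR h h' h'' => exact Or.inr ⟨_, _, h, h', h''⟩
  · rintro (⟨D', M, h, h', h''⟩ | ⟨D', M, h, h', h''⟩)
    exacts [.parL h h' h'', .parR h h' h'']

theorem needs_res {a : Name} : Needs nm (.res a P) D ↔ Needs nm P D ∧ ∀ d ∈ D, ¬ d.Mem a := by
  constructor
  · intro h
    cases h with
    | res h h' => exact ⟨h, h'⟩
  · exact fun h => .res h.1 h.2

theorem needs_cond {s t : Term} : Needs nm (.cond s t P Q) D ↔
    Needs nm (if s = t then P else Q) D := by
  constructor
  · intro h
    cases h with
    | cond_eq _ e h => simpa [e] using h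
    | cond_ne _ e h => simpa [e] using h
  · intro h
    split_ifs at h with e
    exacts [.cond_eq _ e h, .cond_ne _ e h]

theorem needs_rep : Needs nm (.rep P) D ↔ Needs nm (.par P (.rep P)) D := by
  rw [needs_par]
  constructor
  · intro h
    cases h with
    | repL h h' h'' => exact Or.inl ⟨_, _, h, h', h''⟩
    | repR h h' h'' => exact Or.inr ⟨_, _, h, h', h''⟩
  · rintro (⟨D', M, h, h', h''⟩ | ⟨D', M, h, h', h''⟩)
    exacts [.repL h h' h'', .repR h h' h'']

theorem not_needs_nil : ¬ Needs nm .nil D := fun h => by cases h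

theorem not_needs_outA {m : Msg} : ¬ Needs nm (.outA m) D := fun h => by cases h

theorem not_needs_outS {m : Msg} : ¬ Needs nm (.outS m P) D := fun h => by cases h

end Inversion

theorem Offers.rep_mono {P Q : Raw} (h : ∀ M, Offers nm P M → Offers nm Q M)
    {M : Multiset Shape} (hM : Offers nm (.rep P) M) : Offers nm (.rep Q) M := by
  generalize hR : Raw.rep P = R at hM
  induction hM with
  | zero => exact .zero _
  | rep h₁ _ _ ih => cases hR; exact .rep (h _ h₁) (ih rfl)
  | _ => cases hR

theorem Needs.rep_mono {P Q : Raw} (h : ∀ M, Offers nm P M → Offers nm Q M)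
    (h' : ∀ D, Needs nm P D → Needs nm Q D)
    {D : Multiset Shape} (hD : Needs nm (.rep P) D) : Needs nm (.rep Q) D := by
  generalize hR : Raw.rep P = R at hD
  induction hD with
  | repL h₁ h₂ h₃ => cases hR; exact .repL (h' _ h₁) (h₂.rep_mono h) h₃
  | repR h₁ _ h₃ ih => cases hR; exact .repR (h _ h₁) (ih rfl) h₃
  | _ => cases hR

theorem Offers.mem_fn {P : Raw} {M : Multiset Shape} (h : Offers nm P M) :
    ∀ o ∈ M, ∀ a, o.Mem a → a ∈ P.fn := by
  induction h with
  | zero => simp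
  | outA m => simpa [Raw.fn] using fun a => Msg.mem_names_of_shape
  | outS m P =>
      intro o ho a ha
      rw [Multiset.mem_singleton.1 ho] at ha
      exact Finset.mem_union_left _ (Msg.mem_names_of_shape ha)
  | par _ _ ih ih' =>
      intro o ho a ha
      rcases Multiset.mem_add.1 ho with ho | ho
      · exact Finset.mem_union_left _ (ih o ho a ha)
      · exact Finset.mem_union_right _ (ih' o ho a ha)
  | @res b P M _ hc ih =>
      intro o ho a ha
      obtain ⟨o, ho', rfl⟩ := Multiset.mem_map.1 ho
      refine Finset.mem_sdiff.2 ⟨ih o ho' a (Shape.mem_hide ha), ?_⟩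
      rw [Finset.mem_singleton]
      rintro rfl
      exact Shape.not_mem_hide (by simp) (hc o ho') ha
  | cond_eq _ _ _ ih => intro o ho a ha; simp [Raw.fn, ih o ho a ha]
  | cond_ne _ _ _ ih => intro o ho a ha; simp [Raw.fn, ih o ho a ha]
  | rep _ _ ih ih' =>
      intro o ho a ha
      rcases Multiset.mem_add.1 ho with ho | ho
      exacts [ih o ho a ha, ih' o ho a ha]

theorem Needs.mem_fn {P : Raw} {D : Multiset Shape} (h : Needs nm P D) :
    ∀ d ∈ D, ∀ a, d.Mem a → a ∈ P.fn := by
  induction h with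
  | ok => simp
  | inp I P =>
      intro d hd a ha
      obtain ⟨i, hi, rfl⟩ := List.mem_map.1 (Multiset.mem_coe.1 hd)
      exact Finset.mem_union_left _ (mem_inFn.2 ⟨i, hi, InPart.mem_fn_of_shape ha⟩)
  | parL _ _ _ ih => intro d hd a ha; simp [Raw.fn, ih d (by simp [hd]) a ha]
  | parR _ _ _ ih => intro d hd a ha; simp [Raw.fn, ih d (by simp [hd]) a ha]
  | @res b P D _ hc ih =>
      intro d hd a ha
      refine Finset.mem_sdiff.2 ⟨ih d hd a ha, ?_⟩
      rw [Finset.mem_singleton]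
      rintro rfl
      exact hc d hd ha
  | cond_eq _ _ _ ih => intro o ho a ha; simp [Raw.fn, ih o ho a ha]
  | cond_ne _ _ _ ih => intro o ho a ha; simp [Raw.fn, ih o ho a ha]
  | repL _ _ _ ih => intro d hd a ha; exact ih d (by simp [hd]) a ha
  | repR _ _ _ ih => intro d hd a ha; exact ih d (by simp [hd]) a ha

theorem Offers.perm {P : Raw} {M : Multiset Shape} (h : Offers nm P M) (π : Equiv.Perm Name) :
    Offers nm (P.perm π) (M.map (Shape.ren π)) := by
  induction h with
  | zero => exact .zero _
  | outA m => simpa [Raw.perm, Msg.shape_rename] using Offers.outA (nm := nm) (m.subst fun a => .name (π a))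
  | outS m P =>
      simpa [Raw.perm, Msg.shape_rename] using Offers.outS (nm := nm) (m.subst fun a => .name (π a)) _
  | par _ _ ih ih' => simpa [Raw.perm] using Offers.par ih ih'
  | @res a P M _ hc ih =>
      have := Offers.res (a := π a) ih fun o ho => by
        obtain ⟨o, ho', rfl⟩ := Multiset.mem_map.1 ho
        simpa [Shape.ren] using hc o ho'
      simpa [Shape.ren_hide, Raw.perm, Multiset.map_map] using this
  | cond_eq Q e _ ih => exact .cond_eq _ (congrArg _ e) ih
  | cond_ne Q e _ ih => exact .cond_ne _ ((Term.rename_injective π.injective).ne e) ih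
  | rep _ _ ih ih' => simpa [Raw.perm] using Offers.rep ih ih'

theorem Shape.rel_ren {D M : Multiset Shape} (h : Multiset.Rel Shape.Fits D M) (f : Name → Name) :
    Multiset.Rel Shape.Fits (D.map (Shape.ren f)) (M.map (Shape.ren f)) :=
  Multiset.rel_map.2 (h.mono fun _ _ _ _ h => h.ren f)

theorem Needs.perm {P : Raw} {D : Multiset Shape} (h : Needs nm P D) (π : Equiv.Perm Name) :
    Needs nm (P.perm π) (D.map (Shape.ren π)) := by
  induction h with
  | ok => exact .ok
  | inp I P =>
      have := Needs.inp (nm := nm) (I.map (InPart.map π π)) (P.perm π)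
      simpa [Raw.perm, Function.comp_def, InPart.shape_map] using this
  | parL _ h₂ h₃ ih => exact .parL (by simpa using ih) (h₂.perm π) (Shape.rel_ren h₃ π)
  | parR h₁ _ h₃ ih => exact .parR (h₁.perm π) (by simpa [Raw.perm] using ih) (Shape.rel_ren h₃ π)
  | res _ hc ih =>
      refine .res ih fun d hd => ?_
      obtain ⟨d, hd', rfl⟩ := Multiset.mem_map.1 hd
      simpa [Shape.mem_ren] using hc d hd'
  | cond_eq Q e _ ih => exact .cond_eq _ (congrArg _ e) ih
  | cond_ne Q e _ ih => exact .cond_ne _ ((Term.rename_injective π.injective).ne e) ih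
  | repL _ h₂ h₃ ih => exact .repL (by simpa [Raw.perm] using ih) (h₂.perm π) (Shape.rel_ren h₃ π)
  | repR h₁ _ h₃ ih => exact .repR (h₁.perm π) (by simpa [Raw.perm] using ih) (Shape.rel_ren h₃ π)

/-- The offers of a restriction mention only its free names. These are fixed by `π`, so applying `π`
to the whole process does not change the offers. -/
theorem Offers.res_rename {π : Equiv.Perm Name} {a : Name} {P : Raw}
    (hπ : ∀ c ∈ P.fn, c ≠ a → π c = c) {M : Multiset Shape} (h : Offers nm (.res a P) M) :
    Offers nm (.res (π a) (P.perm π)) M := by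
  have h' := h.perm π
  rwa [Multiset.map_congr (g := fun o => o) rfl fun o ho => ?_, Multiset.map_id'] at h'
  refine (Shape.ren_congr fun b hb => ?_).trans (Shape.ren_id o)
  have := h.mem_fn o ho b hb
  simp only [Raw.fn, Finset.mem_sdiff, Finset.mem_singleton] at this
  exact hπ b this.1 this.2

theorem Needs.res_rename {π : Equiv.Perm Name} {a : Name} {P : Raw}
    (hπ : ∀ c ∈ P.fn, c ≠ a → π c = c) {M : Multiset Shape} (h : Needs nm (.res a P) M) :
    Needs nm (.res (π a) (P.perm π)) M := by
  have h' := h.perm π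
  rwa [Multiset.map_congr (g := fun o => o) rfl fun o ho => ?_, Multiset.map_id'] at h'
  refine (Shape.ren_congr fun b hb => ?_).trans (Shape.ren_id o)
  have := h.mem_fn o ho b hb
  simp only [Raw.fn, Finset.mem_sdiff, Finset.mem_singleton] at this
  exact hπ b this.1 this.2

theorem res_rename_symm {π : Equiv.Perm Name} {a : Name} {P : Raw}
    (hπ : ∀ c ∈ P.fn, c ≠ a → π c = c) :
    ∀ c ∈ (P.perm π).fn, c ≠ π a → π⁻¹ c = c := by
  intro c hc hca
  obtain ⟨b, hb, rfl⟩ := Raw.mem_fn_perm.1 hc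
  have := hπ b hb fun e => hca (e ▸ rfl)
  rw [Equiv.Perm.inv_eq_iff_eq, this]
  exact this.symm

theorem Raw.perm_inv_perm (π : Equiv.Perm Name) (P : Raw) : (P.perm π).perm π⁻¹ = P := by
  rw [perm_perm, inv_mul_cancel, perm_one]

/-! ### Invariance under alpha-conversion -/

theorem offers_iff_of_alpha {P Q : Raw} (h : Alpha P Q) :
    ∀ {M}, Offers nm P M ↔ Offers nm Q M := by
  induction h with
  | refl => exact Iff.rfl
  | symm _ ih => exact ih.symm
  | trans _ _ ih ih' => exact ih.trans ih'
  | res_rename π a P hπ =>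
      refine ⟨Offers.res_rename hπ, fun h => ?_⟩
      simpa [Raw.perm_inv_perm] using h.res_rename (res_rename_symm hπ)
  | inp_rename => simp only [offers_inp, implies_true]
  | outS => simp only [offers_outS, implies_true]
  | inp => simp only [offers_inp, implies_true]
  | res _ _ ih => simp only [offers_res, ih, implies_true]
  | par _ _ ih ih' => simp only [offers_par, ih, ih', implies_true]
  | cond s t _ _ ih ih' =>
      intro M
      rw [offers_cond, offers_cond]
      split_ifs
      exacts [ih, ih']
  | rep _ ih => exact ⟨Offers.rep_mono fun _ => ih.1, Offers.rep_mono fun _ => ih.2⟩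

theorem needs_iff_of_alpha {P Q : Raw} (h : Alpha P Q) :
    ∀ {D}, Needs nm P D ↔ Needs nm Q D := by
  induction h with
  | refl => exact Iff.rfl
  | symm _ ih => exact ih.symm
  | trans _ _ ih ih' => exact ih.trans ih'
  | res_rename π a P hπ =>
      refine ⟨Needs.res_rename hπ, fun h => ?_⟩
      simpa [Raw.perm_inv_perm] using h.res_rename (res_rename_symm hπ)
  | inp_rename π I P =>
      have : (I.map (InPart.map π id)).map (InPart.shape nm) = I.map (InPart.shape nm) := by
        rw [List.map_map]
        refine List.map_congr_left fun i _ => ?_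
        rw [Function.comp, InPart.shape_map]
        exact Shape.ren_id _
      intro D
      constructor
      · intro h
        cases h
        rw [← this]
        exact .inp _ _
      · intro h
        cases h
        rw [this]
        exact .inp _ _
  | outS => exact ⟨fun h => absurd h not_needs_outS, fun h => absurd h not_needs_outS⟩
  | inp I _ =>
      intro D
      constructor
      · intro h
        cases h
        exact .inp _ _
      · intro h
        cases h
        exact .inp _ _
  | res _ _ ih => simp only [needs_res, ih, implies_true]
  | par h h' ih ih' =>
      simp only [needs_par, ih, ih', offers_iff_of_alpha h, offers_iff_of_alpha h', implies_true]
  | cond s t _ _ ih ih' =>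
      intro M
      rw [needs_cond, needs_cond]
      split_ifs
      exacts [ih, ih']
  | rep h ih =>
      exact ⟨Needs.rep_mono (fun _ => (offers_iff_of_alpha h).1) fun _ => ih.1,
        Needs.rep_mono (fun _ => (offers_iff_of_alpha h).2) fun _ => ih.2⟩

/-! ### Invariance under structural equivalence -/

variable {nm : Bool} {L : Lang}

theorem Shape.Fits.mem {d o : Shape} (h : Shape.Fits d o) {a : Name} (ha : d.Mem a) : o.Mem a := by
  rcases ha with ha | ha
  · exact Or.inl (h.1 ▸ ha)
  · right
    obtain ⟨c, ps⟩ := d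
    obtain ⟨c', ts⟩ := o
    have h₂ : List.Forall₂ (fun p t => p = none ∨ p = t) ps ts := h.2
    clear h
    simp only at ha ⊢
    induction h₂ with
    | nil => simp at ha
    | cons h _ ih =>
        rcases List.mem_cons.1 ha with rfl | ha
        · rcases h with h | h
          · cases h
          · simp [h]
        · exact List.mem_cons_of_mem _ (ih ha)

theorem Shape.rel_mem {D M : Multiset Shape} (h : Multiset.Rel Shape.Fits D M) {o : Shape}
    (ho : o ∈ M) : ∃ d ∈ D, d.Fits o := by
  have := Multiset.exists_mem_of_rel_of_mem (Multiset.rel_flip.2 h) ho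
  obtain ⟨d, hd, h⟩ := this
  exact ⟨d, hd, h⟩

theorem offers_iff_of_struct {P Q : Raw} (h : Struct L P Q) :
    ∀ {M}, Offers nm P M ↔ Offers nm Q M := by
  induction h with
  | refl => exact Iff.rfl
  | symm _ ih => exact ih.symm
  | trans _ _ ih ih' => exact ih.trans ih'
  | alpha h => exact offers_iff_of_alpha h
  | par_nil P => intro M; simp [offers_par, offers_nil]
  | par_comm P Q =>
      intro M
      simp only [offers_par]
      constructor
      · rintro ⟨M₁, M₂, h₁, h₂, rfl⟩
        exact ⟨M₂, M₁, h₂, h₁, add_comm _ _⟩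
      · rintro ⟨M₁, M₂, h₁, h₂, rfl⟩
        exact ⟨M₂, M₁, h₂, h₁, add_comm _ _⟩
  | par_assoc P Q R =>
      intro M
      simp only [offers_par]
      constructor
      · rintro ⟨M₁, _, h₁, ⟨M₂, M₃, h₂, h₃, rfl⟩, rfl⟩
        exact ⟨_, M₃, ⟨M₁, M₂, h₁, h₂, rfl⟩, h₃, (add_assoc _ _ _).symm⟩
      · rintro ⟨_, M₃, ⟨M₁, M₂, h₁, h₂, rfl⟩, h₃, rfl⟩
        exact ⟨M₁, _, h₁, ⟨M₂, M₃, h₂, h₃, rfl⟩, add_assoc _ _ _⟩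
  | cond_eq s t P Q h _ => intro M; simp [offers_cond, h]
  | cond_ne s t P Q h _ => intro M; simp [offers_cond, h]
  | res_nil a => intro M; simp [offers_res, offers_nil]
  | res_comm a b P =>
      have key : ∀ {a b : Name} {M}, Offers nm (.res a (.res b P)) M →
          Offers nm (.res b (.res a P)) M := by
        intro a b M
        simp only [offers_res]
        rintro ⟨_, ⟨N, hN, hb, rfl⟩, ha, rfl⟩
        refine ⟨_, ⟨N, hN, fun o ho => ha (o.hide {b}) (Multiset.mem_map_of_mem _ ho), rfl⟩, ?_, ?_⟩
        · intro o ho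
          obtain ⟨o, ho', rfl⟩ := Multiset.mem_map.1 ho
          exact hb o ho'
        · simp only [Multiset.map_map, Function.comp, Shape.hide_hide, Finset.union_comm]
      exact fun {M} => ⟨key, key⟩
  | extrude a P Q ha =>
      intro M
      simp only [offers_par, offers_res]
      have hself : ∀ {N}, Offers nm P N → N.map (Shape.hide {a}) = N := fun {N} hN => by
        refine (Multiset.map_congr rfl fun o ho => ?_).trans (Multiset.map_id' N)
        refine Shape.hide_eq_self fun b hb h => ha ?_
        rw [Finset.mem_singleton] at hb
        exact hb ▸ hN.mem_fn o ho b (Or.inr h)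
      constructor
      · rintro ⟨M₁, _, h₁, ⟨M₂, h₂, hc, rfl⟩, rfl⟩
        refine ⟨_, ⟨M₁, M₂, h₁, h₂, rfl⟩, fun o ho => ?_, by rw [Multiset.map_add, hself h₁]⟩
        rcases Multiset.mem_add.1 ho with ho | ho
        · exact fun h => ha (h₁.mem_fn o ho a (Or.inl h))
        · exact hc o ho
      · rintro ⟨_, ⟨M₁, M₂, h₁, h₂, rfl⟩, hc, rfl⟩
        exact ⟨M₁, _, h₁, ⟨M₂, h₂, fun o ho => hc o (by simp [ho]), rfl⟩,
          by rw [Multiset.map_add, hself h₁]⟩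
  | rep_unfold P => exact offers_rep
  | par _ _ ih ih' => simp only [offers_par, ih, ih', implies_true]
  | res _ _ ih => simp only [offers_res, ih, implies_true]

/-- Scope extrusion is the case with content. A demand of `P` cannot mention the extruded name, so
hiding this name in the messages of `Q` is invisible to it. A demand of `Q` met by a message of `P`
cannot mention the name either, as it would then be free in `P`. Associativity only splits or merges
the messages that meet the demands. -/
theorem needs_iff_of_struct {P Q : Raw} (h : Struct L P Q) :
    ∀ {D}, Needs nm P D ↔ Needs nm Q D := by
  induction h with
  | refl => exact Iff.rfl
  | symm _ ih => exact ih.symm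
  | trans _ _ ih ih' => exact ih.trans ih'
  | alpha h => exact needs_iff_of_alpha h
  | par_nil P =>
      intro D
      simp only [needs_par, offers_nil, not_needs_nil, and_false, false_and, exists_false, or_false]
      constructor
      · rintro ⟨D', _, h, rfl, hr⟩
        rw [Multiset.rel_zero_right.1 hr, add_zero] at h
        exact h
      · exact fun h => ⟨0, 0, by simpa using h, rfl, .zero⟩
  | par_comm P Q =>
      intro D
      simp only [needs_par]
      constructor
      · rintro (⟨D', M, h₁, h₂, h₃⟩ | ⟨D', M, h₁, h₂, h₃⟩)
        exacts [Or.inr ⟨D', M, h₂, h₁, h₃⟩, Or.inl ⟨D', M, h₂, h₁, h₃⟩]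
      · rintro (⟨D', M, h₁, h₂, h₃⟩ | ⟨D', M, h₁, h₂, h₃⟩)
        exacts [Or.inr ⟨D', M, h₂, h₁, h₃⟩, Or.inl ⟨D', M, h₂, h₁, h₃⟩]
  | par_assoc P Q R =>
      intro D
      constructor
      · intro h
        rcases needs_par.1 h with ⟨D', M, h₁, h₂, h₃⟩ | ⟨D', M, h₁, h₂, h₃⟩
        · obtain ⟨M₁, M₂, hq, hr, rfl⟩ := offers_par.1 h₂
          obtain ⟨D₁, D₂, r₁, r₂, rfl⟩ := Multiset.rel_add_right.1 h₃
          exact .parL (.parL (by rwa [add_assoc, add_comm D₂]) hq r₁) hr r₂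
        · rcases needs_par.1 h₂ with ⟨D'', N, h₄, h₅, h₆⟩ | ⟨D'', N, h₄, h₅, h₆⟩
          · exact .parL (.parR h₁ (by rwa [add_assoc, add_comm D'', ← add_assoc]) h₃) h₅ h₆
          · exact .parR (.par h₁ h₄) (by rwa [← add_assoc]) (h₃.add h₆)
      · intro h
        rcases needs_par.1 h with ⟨D', M, h₁, h₂, h₃⟩ | ⟨D', M, h₁, h₂, h₃⟩
        · rcases needs_par.1 h₁ with ⟨D'', N, h₄, h₅, h₆⟩ | ⟨D'', N, h₄, h₅, h₆⟩
          · exact .parL (by rwa [add_assoc, add_comm D'] at h₄) (.par h₅ h₂) (h₆.add h₃)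
          · refine .parR h₄ (.parL ?_ h₂ h₃) h₆
            rwa [add_assoc, add_comm D', ← add_assoc] at h₅
        · obtain ⟨M₁, M₂, hp, hq, rfl⟩ := offers_par.1 h₁
          obtain ⟨D₁, D₂, r₁, r₂, rfl⟩ := Multiset.rel_add_right.1 h₃
          exact .parR hp (.parR hq (by rwa [add_assoc]) r₂) r₁
  | cond_eq s t P Q h _ => intro M; simp [needs_cond, h]
  | cond_ne s t P Q h _ => intro M; simp [needs_cond, h]
  | res_nil a => intro M; simp [needs_res, not_needs_nil]
  | res_comm a b P => intro M; simp only [needs_res]; tauto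
  | extrude a P Q ha =>
      intro D
      constructor
      · intro h
        rcases needs_par.1 h with ⟨D', M, h₁, h₂, h₃⟩ | ⟨D', M, h₁, h₂, h₃⟩
        · obtain ⟨N, hN, hc, rfl⟩ := offers_res.1 h₂
          have hD : ∀ d ∈ D + D', ¬ d.Mem a := fun d hd h => ha (h₁.mem_fn d hd a h)
          refine .res (.parL h₁ hN ?_) fun d hd => hD d (by simp [hd])
          rw [Multiset.rel_map_right] at h₃
          refine h₃.mono fun d hd o _ h => (Shape.fits_hide_iff fun b hb => ?_).1 h
          rw [Finset.mem_singleton] at hb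
          exact hb ▸ hD d (by simp [hd])
        · obtain ⟨h₄, h₅⟩ := needs_res.1 h₂
          exact .res (.parR h₁ h₄ h₃) fun d hd => h₅ d (by simp [hd])
      · intro h
        obtain ⟨h, hD⟩ := needs_res.1 h
        rcases needs_par.1 h with ⟨D', M, h₁, h₂, h₃⟩ | ⟨D', M, h₁, h₂, h₃⟩
        · have hD : ∀ d ∈ D + D', ¬ d.Mem a := fun d hd h => ha (h₁.mem_fn d hd a h)
          refine .parL h₁ (.res h₂ fun o ho hoc => ?_) (?_ : Multiset.Rel _ D' _)
          · obtain ⟨d, hd, hf⟩ := Shape.rel_mem h₃ ho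
            exact hD d (by simp [hd]) (Or.inl (hf.1.trans hoc))
          · rw [Multiset.rel_map_right]
            refine h₃.mono fun d hd o _ h => (Shape.fits_hide_iff fun b hb => ?_).2 h
            rw [Finset.mem_singleton] at hb
            exact hb ▸ hD d (by simp [hd])
        · refine .parR h₁ (.res h₂ fun d hd hda => ?_) h₃
          rcases Multiset.mem_add.1 hd with hd | hd
          · exact hD d hd hda
          · obtain ⟨o, ho, hf⟩ := Multiset.exists_mem_of_rel_of_mem h₃ hd
            exact ha (h₁.mem_fn o ho a (hf.mem hda))
  | rep_unfold P => exact needs_rep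
  | par h h' ih ih' =>
      simp only [needs_par, ih, ih', offers_iff_of_struct h, offers_iff_of_struct h', implies_true]
  | res _ _ ih => simp only [needs_res, ih, implies_true]

/-! ### Reductions and successes require all demands to be met -/

theorem patShape_of_matchTerm {t : Term} {p : Pat} {σ : List (Name × Term)}
    (h : matchTerm t p = some σ) : patShape nm p = none ∨ patShape nm p = argShape nm t := by
  cases p with
  | bind x => exact Or.inl rfl
  | comp p q => exact Or.inl rfl
  | mtch b =>
      right
      cases t with
      | comp s t => simp [matchTerm] at h
      | name a =>
          simp only [matchTerm] at h
          split_ifs at h with e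
          subst e
          rfl

theorem fits_of_polyMatch : ∀ {ts : List Term} {ps : List Pat} {σ : List (Name × Term)},
    polyMatch ts ps = some σ → List.Forall₂ (fun p t => p = none ∨ p = t)
      (ps.map (patShape nm)) (ts.map (argShape nm))
  | [], [], _, _ => .nil
  | t :: ts, p :: ps, σ, h => by
      simp only [polyMatch, Option.bind_eq_bind, Option.bind_eq_some_iff, Option.pure_def,
        Option.some.injEq] at h
      obtain ⟨σ₁, h₁, σ₂, h₂, rfl⟩ := h
      exact .cons (patShape_of_matchTerm h₁) (fits_of_polyMatch h₂)
  | [], _ :: _, _, h => by simp [polyMatch] at h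
  | _ :: _, [], _, h => by simp [polyMatch] at h

theorem rel_of_joinMatch : ∀ {ms : List Msg} {I : List InPart} {σ : List (Name × Term)},
    joinMatch ms I = some σ → Multiset.Rel Shape.Fits
      (I.map (InPart.shape nm) : List Shape) (ms.map (Msg.shape nm) : List Shape)
  | [], [], _, _ => .zero
  | m :: ms, i :: I, σ, h => by
      simp only [joinMatch] at h
      split_ifs at h with e
      simp only [Option.bind_eq_bind, Option.bind_eq_some_iff, Option.pure_def,
        Option.some.injEq] at h
      obtain ⟨σ₁, h₁, σ₂, h₂, rfl⟩ := h
      exact .cons ⟨by simp [InPart.shape, Msg.shape, e], fits_of_polyMatch h₁⟩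
        (rel_of_joinMatch h₂)
  | [], _ :: _, _, h => by simp [joinMatch] at h
  | _ :: _, [], _, h => by simp [joinMatch] at h

/-- The outputs in front of `R` discharge the demands `D'` one at a time, while `D` stays open. -/
theorem needs_foldr {β : Type} {f : β → Raw} {s : β → Shape} (hf : ∀ b, Offers nm (f b) {s b})
    {R : Raw} : ∀ {bs : List β} {D D' : Multiset Shape}, Needs nm R (D + D') →
      Multiset.Rel Shape.Fits D' (bs.map s : List Shape) →
      Needs nm (bs.foldr (fun b R => .par (f b) R) R) D
  | [], D, D', h, hr => by
      rw [List.map_nil, Multiset.coe_nil, Multiset.rel_zero_right] at hr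
      simpa [hr] using h
  | b :: bs, D, D', h, hr => by
      rw [List.map_cons, ← Multiset.cons_coe, Multiset.rel_cons_right] at hr
      obtain ⟨d, D'', hd, hr, rfl⟩ := hr
      refine .parR (hf b) (needs_foldr hf (D' := D'') ?_ hr) (D' := {d}) (.cons hd .zero)
      rwa [add_assoc, Multiset.singleton_add]

/-- A process that can reduce has an input all of whose demands are met. -/
theorem needs_of_red {P Q : Raw} (h : Red L P Q) : Needs nm P 0 := by
  induction h with
  | commA ms I Q σ h =>
      exact needs_foldr (fun m => .outA m) (by simpa using Needs.inp I Q) (rel_of_joinMatch h)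
  | commS ms I Q σ h =>
      refine needs_foldr (f := fun x : Msg × Raw => .outS x.1 x.2)
        (s := fun x => x.1.shape nm) (fun x => .outS x.1 x.2) (by simpa using Needs.inp I Q) ?_
      simpa [Function.comp_def] using rel_of_joinMatch (nm := nm) h
  | par Q _ ih => exact .parL (by simpa using ih) (.zero _) .zero
  | res a _ ih => exact .res ih (by simp)
  | struct h _ _ ih => exact (needs_iff_of_struct h).2 ih

theorem needs_of_struct_ok {P Q : Raw} (h : Struct L P (.par Q .ok)) : Needs nm P 0 :=
  (needs_iff_of_struct h).2 (.parR (.zero _) (by simpa using Needs.ok) .zero)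

/-- If the success lies some reductions ahead, the first of these already proves the claim. -/
theorem needs_of_succeeds {P : L.Proc} (h : P.Succeeds) : Needs nm P.1 0 := by
  obtain ⟨P', P'', hs, hok⟩ := h
  rcases Relation.ReflTransGen.cases_head hs with rfl | ⟨Q, hQ, _⟩
  · exact needs_of_struct_ok hok
  · exact needs_of_red hQ

/-! ### Processes whose demands are met can react -/

variable {nm : Bool} {L : Lang}

/-- `P` can reduce or has a success at top level. -/
def Reacts (L : Lang) (P : Raw) : Prop := (∃ Q, Red L P Q) ∨ ∃ Q, Struct L P (.par Q .ok)

theorem Struct.par_left_comm (P Q R : Raw) :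
    Struct L (.par P (.par Q R)) (.par Q (.par P R)) :=
  (Struct.par_assoc P Q R).trans
    (((Struct.par_comm P Q).par (.refl R)).trans (Struct.par_assoc Q P R).symm)

theorem Reacts.struct {P Q : Raw} (h : Struct L P Q) : Reacts L Q → Reacts L P
  | .inl ⟨R, hR⟩ => .inl ⟨R, .struct h hR (.refl R)⟩
  | .inr ⟨R, hR⟩ => .inr ⟨R, h.trans hR⟩

theorem Reacts.parL {P : Raw} (Q : Raw) : Reacts L P → Reacts L (.par P Q)
  | .inl ⟨_, hR⟩ => .inl ⟨_, .par Q hR⟩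
  | .inr ⟨R, hR⟩ => .inr ⟨.par Q R, (Struct.par_comm P Q).trans
      (((Struct.refl Q).par hR).trans (.par_assoc Q R .ok))⟩

theorem Reacts.parR (P : Raw) {Q : Raw} (h : Reacts L Q) : Reacts L (.par P Q) :=
  .struct (.par_comm P Q) (h.parL P)

theorem Reacts.res (a : Name) {P : Raw} : Reacts L P → Reacts L (.res a P)
  | .inl ⟨_, hR⟩ => .inl ⟨_, .res a hR⟩
  | .inr ⟨R, hR⟩ => .inr ⟨.res a R, (Struct.res a (hR.trans (.par_comm R .ok))).trans
      ((Struct.extrude a .ok R (by simp [Raw.fn])).symm.trans (.par_comm _ _))⟩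

/-- The output of `L` with message `x.1`, and continuation `x.2` in the synchronous languages. -/
def outP (L : Lang) (x : Msg × Raw) : Raw :=
  match L.sync with
  | .asynch => .outA x.1
  | .synch => .outS x.1 x.2

def parList (L : Lang) (os : List (Msg × Raw)) (U : Raw) : Raw :=
  os.foldr (fun x R => .par (outP L x) R) U

def shapes (nm : Bool) (os : List (Msg × Raw)) : Multiset Shape :=
  (os.map fun x => x.1.shape nm : List Shape)

theorem shapes_append (os os' : List (Msg × Raw)) :
    shapes nm (os ++ os') = shapes nm os + shapes nm os' := by
  simp [shapes]

theorem parList_append (os os' : List (Msg × Raw)) (U : Raw) :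
    parList L (os ++ os') U = parList L os (parList L os' U) := List.foldr_append

theorem struct_par_parList (P : Raw) (os : List (Msg × Raw)) (U : Raw) :
    Struct L (.par P (parList L os U)) (parList L os (.par P U)) := by
  induction os with
  | nil => exact .refl _
  | cons x os ih => exact (Struct.par_left_comm P _ _).trans ((Struct.refl _).par ih)

theorem struct_parList_par (os : List (Msg × Raw)) (P U : Raw) :
    Struct L (parList L os (.par P U)) (.par (parList L os P) U) := by
  induction os with
  | nil => exact .refl _
  | cons x os ih => exact ((Struct.refl _).par ih).trans (.par_assoc _ _ _)

theorem struct_parList_perm {os os' : List (Msg × Raw)} (h : os.Perm os') (U : Raw) :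
    Struct L (parList L os U) (parList L os' U) := by
  induction h with
  | nil => exact .refl _
  | cons x _ ih => exact (Struct.refl _).par ih
  | swap x y l => exact .par_left_comm _ _ _
  | trans _ _ ih ih' => exact ih.trans ih'

/-! ### From fitting shapes to matches -/

namespace Shape

theorem Fits.refl (o : Shape) : Fits o o := ⟨rfl, List.forall₂_same.2 fun _ _ => Or.inr rfl⟩

theorem Fits.trans {a b c : Shape} (h : Fits a b) (h' : Fits b c) : Fits a c := by
  obtain ⟨ca, as⟩ := a
  obtain ⟨cb, bs⟩ := b
  obtain ⟨cc, cs⟩ := c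
  refine ⟨h.1.trans h'.1, ?_⟩
  have h₁ : List.Forall₂ (fun p t => p = none ∨ p = t) as bs := h.2
  have h₂ : List.Forall₂ (fun p t => p = none ∨ p = t) bs cs := h'.2
  clear h h'
  show List.Forall₂ (fun p t => p = none ∨ p = t) as cs
  induction h₁ generalizing cs with
  | nil => exact h₂
  | cons h _ ih =>
      cases h₂ with
      | cons h' ht =>
          refine .cons ?_ (ih _ ht)
          rcases h with rfl | rfl
          exacts [Or.inl rfl, h']

instance : IsTrans Shape Fits := ⟨fun _ _ _ => Fits.trans⟩

theorem fits_hide (V : Finset Name) (o : Shape) : Fits (o.hide V) o := by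
  obtain ⟨c, ts⟩ := o
  refine ⟨rfl, ?_⟩
  simp only [hide, List.forall₂_map_left_iff]
  refine List.forall₂_same.2 fun t _ => ?_
  cases t with
  | none => exact Or.inl rfl
  | some a => by_cases h : a ∈ V <;> simp [hideArg, h]

theorem rel_refl (M : Multiset Shape) : Multiset.Rel Fits M M :=
  Multiset.rel_refl_of_refl_on fun o _ => Fits.refl o

end Shape

/-- Converse to `patShape_of_matchTerm`. Without intensionality, a shape retains all that matching
depends on, provided that data names are recorded whenever the language has name-matches. -/
theorem matchTerm_of_fits (hI : L.matching ≠ .intensional)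
    (hnm : L.matching = .nameMatching → nm = true) {t : Term} {p : Pat} (ht : L.TermOk t)
    (hp : L.PatOk p) (h : patShape nm p = none ∨ patShape nm p = argShape nm t) :
    ∃ σ, matchTerm t p = some σ := by
  obtain ⟨a, rfl⟩ := ht hI
  cases p with
  | bind x => exact ⟨_, rfl⟩
  | comp p q =>
      unfold Lang.PatOk at hp
      split at hp
      · simp at hp
      · simp at hp
      · exact absurd ‹_› hI
  | mtch b =>
      have hm : L.matching = .nameMatching := by
        unfold Lang.PatOk at hp
        split at hp
        · simp at hp
        · assumption
        · exact absurd ‹_› hI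
      simp only [patShape, argShape, hnm hm, if_true, Term.asName, reduceCtorEq, false_or,
        Option.some.injEq] at h
      subst h
      exact ⟨[], by simp [matchTerm]⟩

theorem polyMatch_of_fits (hI : L.matching ≠ .intensional)
    (hnm : L.matching = .nameMatching → nm = true) : ∀ {ts : List Term} {ps : List Pat},
    (∀ t ∈ ts, L.TermOk t) → (∀ p ∈ ps, L.PatOk p) →
    List.Forall₂ (fun p t => p = none ∨ p = t) (ps.map (patShape nm)) (ts.map (argShape nm)) →
    ∃ σ, polyMatch ts ps = some σ
  | [], [], _, _, _ => ⟨[], rfl⟩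
  | t :: ts, p :: ps, ht, hp, h => by
      simp only [List.map_cons, List.forall₂_cons] at h
      obtain ⟨σ, hσ⟩ := matchTerm_of_fits hI hnm (ht t (by simp)) (hp p (by simp)) h.1
      obtain ⟨τ, hτ⟩ := polyMatch_of_fits hI hnm (fun t h => ht t (by simp [h]))
        (fun p h => hp p (by simp [h])) h.2
      exact ⟨σ ++ τ, by simp [polyMatch, hσ, hτ]⟩
  | [], _ :: _, _, _, h => by simp at h
  | _ :: _, [], _, _, h => by simp at h

theorem chan_eq_of_fits (hI : L.matching ≠ .intensional) {c c' : Option Term} (hc : L.ChanOk c)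
    (hc' : L.ChanOk c') (h : c.bind Term.asName = c'.bind Term.asName) : c = c' := by
  unfold Lang.ChanOk at hc hc'
  cases hm : L.medium <;> simp only [hm] at hc hc'
  · rw [hc, hc']
  · obtain ⟨s, rfl, hs⟩ := hc
    obtain ⟨t, rfl, ht⟩ := hc'
    obtain ⟨a, rfl⟩ := hs hI
    obtain ⟨b, rfl⟩ := ht hI
    simpa [Term.asName] using h

/-- `Multiset.Rel` pairs input patterns with outputs in no particular order, whereas `joinMatch`
compares two lists in order; hence the rearrangement `os'`. -/
theorem joinMatch_of_fits (hI : L.matching ≠ .intensional)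
    (hnm : L.matching = .nameMatching → nm = true) : ∀ {I : List InPart} {os : List (Msg × Raw)},
    (∀ i ∈ I, L.PartOk i) → (∀ x ∈ os, L.MsgOk x.1) →
    Multiset.Rel Shape.Fits (I.map (InPart.shape nm) : List Shape) (shapes nm os) →
    ∃ os' : List (Msg × Raw), os'.Perm os ∧ ∃ σ, joinMatch (os'.map Prod.fst) I = some σ
  | [], os, _, _, h => by
      rw [List.map_nil, Multiset.coe_nil, Multiset.rel_zero_left] at h
      have : os = [] := by simpa [shapes] using h
      subst this
      exact ⟨[], .nil, [], rfl⟩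
  | i :: I, os, hi, hos, h => by
      rw [List.map_cons, ← Multiset.cons_coe, Multiset.rel_cons_left] at h
      obtain ⟨b, M, hb, hM, he⟩ := h
      have hbm : b ∈ shapes nm os := he ▸ Multiset.mem_cons_self b M
      obtain ⟨x, hx, rfl⟩ := List.mem_map.1 (Multiset.mem_coe.1 hbm)
      obtain ⟨l₁, l₂, rfl⟩ := List.append_of_mem hx
      have he' : shapes nm (l₁ ++ l₂) = M := by
        have : shapes nm (l₁ ++ x :: l₂) = x.1.shape nm ::ₘ shapes nm (l₁ ++ l₂) := by
          simp [shapes]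
        rw [this] at he
        exact (Multiset.cons_inj_right _).1 he
      obtain ⟨os', hp, σ, hσ⟩ := joinMatch_of_fits hI hnm (I := I) (os := l₁ ++ l₂)
        (fun j hj => hi j (by simp [hj]))
        (fun y hy => hos y (by
          rw [List.mem_append] at hy
          rcases hy with hy | hy <;> simp [hy])) (he' ▸ hM)
      have hm := hos x hx
      have hp' := hi i (by simp)
      obtain ⟨τ, hτ⟩ := polyMatch_of_fits hI hnm hm.2.2 hp'.2.2 hb.2
      refine ⟨x :: os', (hp.cons x).trans List.perm_middle.symm, τ ++ σ, ?_⟩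
      have hc := chan_eq_of_fits hI hm.1 hp'.1 hb.1.symm
      simp [joinMatch, hc, hτ, hσ]

theorem reacts_inp (hI : L.matching ≠ .intensional)
    (hnm : L.matching = .nameMatching → nm = true) {I : List InPart} {P : Raw}
    {os : List (Msg × Raw)} (hi : ∀ i ∈ I, L.PartOk i) (hos : ∀ x ∈ os, L.MsgOk x.1)
    (h : Multiset.Rel Shape.Fits (I.map (InPart.shape nm) : List Shape) (shapes nm os))
    (U : Raw) : Reacts L (.par (.inp I P) (parList L os U)) := by
  obtain ⟨os', hp, σ, hσ⟩ := joinMatch_of_fits hI hnm hi hos h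
  refine .struct ((struct_par_parList _ _ _).trans ((struct_parList_perm hp.symm _).trans
    (struct_parList_par _ _ _))) (.parL _ (.inl ?_))
  cases hs : L.sync with
  | asynch =>
      have : parList L os' (.inp I P) =
          (os'.map Prod.fst).foldr (fun m R => .par (.outA m) R) (.inp I P) := by
        simp [parList, outP, hs, List.foldr_map]
      rw [this]
      exact ⟨_, .commA _ _ _ _ hσ⟩
  | synch =>
      have : parList L os' (.inp I P) =
          os'.foldr (fun m R => .par (.outS m.1 m.2) R) (.inp I P) := by
        simp [parList, outP, hs]
      rw [this]
      exact ⟨_, .commS _ _ _ _ hσ⟩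

theorem fresh_notMem (X : Finset Name) : fresh X ∉ X := fun h => lt_irrefl _ (lt_fresh h)

/-- Alpha-conversion of a renamed restriction to a fresh name. -/
theorem exists_fresh_res (a : Name) (P : Raw) (π : Equiv.Perm Name) (X : Finset Name) :
    ∃ (c : Name) (κ : Equiv.Perm Name), c ∉ X ∧ κ a = c ∧
      (∀ b ∈ P.fn, b ≠ a → κ b = π b ∧ π b ≠ c) ∧
      Alpha ((Raw.res a P).perm π) (.res c (P.perm κ)) := by
  let Y := X ∪ ((Raw.res a P).perm π).fn
  have hY := fresh_notMem Y
  simp only [Y, Finset.mem_union, not_or] at hY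
  refine ⟨fresh Y, Equiv.swap (π a) (fresh Y) * π, hY.1, by simp, fun b hb hba => ?_, ?_⟩
  · have h₂ : π b ≠ fresh Y := fun e => hY.2 (e ▸ Raw.mem_fn_perm.2
      ⟨b, by simp [Raw.fn, hb, hba], rfl⟩)
    exact ⟨Equiv.swap_apply_of_ne_of_ne (π.injective.ne hba) h₂, h₂⟩
  · have := Raw.alpha_res_swap (a := π a) (P := P.perm π) hY.2
    rwa [Raw.perm_perm] at this

/-- The restricted name is made fresh for `U`, so that the restriction can be extruded over `U`. The
renaming that this costs is absorbed into the permutation; this is why the next two statements are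
quantified over permutations. -/
theorem reacts_of_res_perm {a : Name} {P U : Raw} {π : Equiv.Perm Name}
    (h : ∀ (c : Name) (κ : Equiv.Perm Name), κ a = c → (∀ b ∈ P.fn, b ≠ a → κ b = π b) →
      Reacts L (.par (P.perm κ) U)) : Reacts L (.par ((Raw.res a P).perm π) U) := by
  obtain ⟨c, κ, hU, hc, hκ, hα⟩ := exists_fresh_res a P π U.fn
  refine .struct ((Struct.par (.alpha hα) (.refl U)).trans ((Struct.par_comm _ _).trans
    (.extrude c U _ hU))) (.res c (.struct (.par_comm _ _) (h c κ hc fun b hb hba => ?_)))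
  exact (hκ b hb hba).1

/-- The environment cannot distinguish a process from the messages that it offers. -/
theorem reacts_of_offers {P : Raw} {M : Multiset Shape} (h : Offers nm P M) (hP : L.Wf P) :
    ∀ (π : Equiv.Perm Name) (U : Raw), (∀ os : List (Msg × Raw), (∀ x ∈ os, L.MsgOk x.1) →
      Multiset.Rel Shape.Fits (M.map (Shape.ren π)) (shapes nm os) → Reacts L (parList L os U)) →
    Reacts L (.par (P.perm π) U) := by
  -- Used for parallel composition and for unfolded replication. The outputs extracted from `P`
  -- become part of the environment in which `Q` is treated.
  have hpar : ∀ {P Q U : Raw} {M N : Multiset Shape} {π : Equiv.Perm Name},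
      (∀ U : Raw, (∀ os : List (Msg × Raw), (∀ x ∈ os, L.MsgOk x.1) →
        Multiset.Rel Shape.Fits (M.map (Shape.ren π)) (shapes nm os) →
        Reacts L (parList L os U)) → Reacts L (.par P U)) →
      (∀ U : Raw, (∀ os : List (Msg × Raw), (∀ x ∈ os, L.MsgOk x.1) →
        Multiset.Rel Shape.Fits (N.map (Shape.ren π)) (shapes nm os) →
        Reacts L (parList L os U)) → Reacts L (.par Q U)) →
      (∀ os : List (Msg × Raw), (∀ x ∈ os, L.MsgOk x.1) →
        Multiset.Rel Shape.Fits ((M + N).map (Shape.ren π)) (shapes nm os) →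
        Reacts L (parList L os U)) → Reacts L (.par (.par P Q) U) := by
    intro P Q U M N π ihP ihQ hU
    refine .struct (Struct.par_assoc P Q U).symm (ihP _ fun os hos hr => ?_)
    refine .struct (struct_par_parList Q os U).symm (ihQ _ fun os' hos' hr' => ?_)
    rw [← parList_append]
    refine hU _ (fun x hx => ?_) ?_
    · rcases List.mem_append.1 hx with hx | hx
      exacts [hos' x hx, hos x hx]
    · rw [Multiset.map_add, shapes_append, add_comm]
      exact hr'.add hr
  induction h with
  | zero P =>
      intro π U hU
      exact .parR _ (hU [] (by simp) .zero)
  | outA m =>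
      intro π U hU
      have := hU [(m.subst fun a => .name (π a), .nil)]
        (by simpa using Lang.msgOk_rename.2 hP.2)
        (by simpa [shapes, Msg.shape_rename] using Shape.rel_refl _)
      simpa [parList, outP, hP.1, Raw.perm] using this
  | outS m P =>
      intro π U hU
      have := hU [(m.subst fun a => .name (π a), P.perm π)]
        (by simpa using Lang.msgOk_rename.2 hP.2.1)
        (by simpa [shapes, Msg.shape_rename] using Shape.rel_refl _)
      simpa [parList, outP, hP.1, Raw.perm] using this
  | par _ _ ih ih' => exact fun π U hU => hpar (ih hP.1 π) (ih' hP.2 π) hU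
  | @res a P M hM hc ih =>
      intro π U hU
      refine reacts_of_res_perm fun c κ hκa hκ => ih hP κ U fun os hos hr => hU os hos ?_
      refine Multiset.Rel.trans Shape.Fits ?_ hr
      -- The assumption on `U` only asks for outputs that fit the messages with `a` hidden. The
      -- actual ones, which carry the fresh name instead of `a`, fit these.
      rw [Multiset.map_map, Multiset.rel_map]
      refine Multiset.rel_refl_of_refl_on fun o ho => ?_
      have : (o.hide {a}).ren π = (o.hide {a}).ren κ := by
        refine Shape.ren_congr fun b hb => (hκ b (hM.mem_fn o ho b (Shape.mem_hide hb)) ?_).symm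
        rintro rfl
        exact Shape.not_mem_hide (by simp) (hc o ho) hb
      rw [Function.comp, this, Shape.ren_hide]
      exact Shape.fits_hide _ _
  | cond_eq Q e _ ih =>
      intro π U hU
      exact .struct (.par (.cond_eq _ _ _ _ (congrArg _ e) (Lang.wf_perm.2 hP.2)) (.refl U))
        (ih hP.1 π U hU)
  | cond_ne Q e _ ih =>
      intro π U hU
      exact .struct (.par (.cond_ne _ _ _ _ ((Term.rename_injective π.injective).ne e)
        (Lang.wf_perm.2 hP.1)) (.refl U)) (ih hP.2 π U hU)
  | rep _ _ ih ih' =>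
      intro π U hU
      exact .struct (.par (.rep_unfold _) (.refl U)) (hpar (ih hP π) (ih' hP π) hU)

/-- Generalised for the induction: the open demands `D` are met by the outputs `os` of the
environment, and the permutation accounts for restrictions that have been freshened. -/
theorem reacts_of_needs_aux (hI : L.matching ≠ .intensional)
    (hnm : L.matching = .nameMatching → nm = true) {P : Raw} {D : Multiset Shape}
    (h : Needs nm P D) (hP : L.Wf P) :
    ∀ (π : Equiv.Perm Name) (os : List (Msg × Raw)) (U : Raw), (∀ x ∈ os, L.MsgOk x.1) →
      Multiset.Rel Shape.Fits (D.map (Shape.ren π)) (shapes nm os) →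
      Reacts L (.par (P.perm π) (parList L os U)) := by
  have hpar : ∀ {P Q : Raw} {D D' M : Multiset Shape} {π : Equiv.Perm Name}
      {os : List (Msg × Raw)} {U : Raw}, Offers nm Q M → L.Wf Q → Multiset.Rel Shape.Fits D' M →
      (∀ (os : List (Msg × Raw)) (U : Raw), (∀ x ∈ os, L.MsgOk x.1) →
        Multiset.Rel Shape.Fits ((D + D').map (Shape.ren π)) (shapes nm os) →
        Reacts L (.par P (parList L os U))) →
      (∀ x ∈ os, L.MsgOk x.1) → Multiset.Rel Shape.Fits (D.map (Shape.ren π)) (shapes nm os) →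
      Reacts L (.par (Q.perm π) (.par P (parList L os U))) := by
    intro P Q D D' M π os U hQ hw hr ih hos hro
    refine reacts_of_offers hQ hw π _ fun os' hos' hr' => ?_
    refine .struct (struct_par_parList P os' _).symm ?_
    rw [← parList_append]
    refine ih _ _ (fun x hx => ?_) ?_
    · rcases List.mem_append.1 hx with hx | hx
      exacts [hos' x hx, hos x hx]
    · rw [Multiset.map_add, shapes_append, add_comm]
      exact (Multiset.Rel.trans Shape.Fits (Shape.rel_ren hr π) hr').add hro
  induction h with
  | ok => exact fun π os U _ _ => .inr ⟨_, .par_comm _ _⟩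
  | inp I P =>
      intro π os U hos hr
      refine reacts_inp hI hnm (fun i hi => ?_) hos ?_ U
      · obtain ⟨j, hj, rfl⟩ := List.mem_map.1 hi
        exact Lang.partOk_map.2 (hP.1.2.2.1 j hj)
      · simpa [Function.comp_def, InPart.shape_map] using hr
  | parL h₁ h₂ h₃ ih =>
      intro π os U hos hr
      exact .struct ((Struct.par_comm _ _).par (.refl _)|>.trans (Struct.par_assoc _ _ _).symm)
        (hpar h₂ hP.2 h₃ (ih hP.1 π) hos hr)
  | parR h₁ h₂ h₃ ih =>
      intro π os U hos hr
      exact .struct (Struct.par_assoc _ _ _).symm (hpar h₁ hP.1 h₃ (ih hP.2 π) hos hr)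
  | @res a P D hD hc ih =>
      intro π os U hos hr
      refine reacts_of_res_perm fun c κ hκa hκ => ih hP κ os U hos ?_
      rwa [Multiset.map_congr (g := Shape.ren π) rfl fun d hd => ?_]
      refine Shape.ren_congr fun b hb => hκ b (hD.mem_fn d hd b hb) ?_
      rintro rfl
      exact hc d hd hb
  | cond_eq Q e _ ih =>
      intro π os U hos hr
      exact .struct (.par (.cond_eq _ _ _ _ (congrArg _ e) (Lang.wf_perm.2 hP.2)) (.refl _))
        (ih hP.1 π os U hos hr)
  | cond_ne Q e _ ih =>
      intro π os U hos hr
      exact .struct (.par (.cond_ne _ _ _ _ ((Term.rename_injective π.injective).ne e)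
        (Lang.wf_perm.2 hP.1)) (.refl _)) (ih hP.2 π os U hos hr)
  | @repL P _ _ _ h₁ h₂ h₃ ih =>
      intro π os U hos hr
      exact .struct (((Struct.rep_unfold _).trans (.par_comm _ _)).par (.refl _)|>.trans
        (Struct.par_assoc _ _ _).symm) (hpar (Q := .rep P) h₂ hP h₃ (ih hP π) hos hr)
  | repR h₁ h₂ h₃ ih =>
      intro π os U hos hr
      exact .struct ((Struct.rep_unfold _).par (.refl _)|>.trans (Struct.par_assoc _ _ _).symm)
        (hpar h₁ hP h₃ (ih hP π) hos hr)

/-- Together with `needs_of_red` and `needs_of_struct_ok` this characterises reactivity by a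
predicate that sees the messages of a process only through their shapes. -/
theorem reacts_of_needs (hI : L.matching ≠ .intensional)
    (hnm : L.matching = .nameMatching → nm = true) {P : Raw} (h : Needs nm P 0) (hP : L.Wf P) :
    Reacts L P := by
  have := reacts_of_needs_aux hI hnm h hP 1 [] .nil (by simp) .zero
  rw [Raw.perm_one] at this
  exact .struct (Struct.par_nil P).symm this

variable {nm : Bool}

/-! ### Contexts -/

theorem Offers.rep_add {P : Raw} {M N : Multiset Shape} (h : Offers nm (.rep P) M)
    (h' : Offers nm (.rep P) N) : Offers nm (.rep P) (M + N) := by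
  generalize hR : Raw.rep P = R at h
  induction h with
  | zero => cases hR; simpa using h'
  | rep h₁ _ _ ih =>
      cases hR
      rw [add_assoc]
      exact .rep h₁ (ih rfl)
  | _ => cases hR

theorem Offers.rep_of {P : Raw} {M : Multiset Shape} (h : Offers nm P M) :
    Offers nm (.rep P) M := by
  simpa using Offers.rep h (.zero _)

theorem Offers.singleton {P : Raw} {M : Multiset Shape} (h : Offers nm P M) :
    ∀ o ∈ M, Offers nm P {o} := by
  induction h with
  | zero => simp
  | outA m =>
      intro o ho
      rw [Multiset.mem_singleton.1 ho]
      exact .outA m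
  | outS m P =>
      intro o ho
      rw [Multiset.mem_singleton.1 ho]
      exact .outS m P
  | par _ _ ih ih' =>
      intro o ho
      rcases Multiset.mem_add.1 ho with ho | ho
      · simpa using Offers.par (ih o ho) (.zero _)
      · simpa using Offers.par (.zero _) (ih' o ho)
  | res _ hc ih =>
      intro o ho
      obtain ⟨o, ho', rfl⟩ := Multiset.mem_map.1 ho
      simpa using Offers.res (ih o ho') (by simpa using hc o ho')
  | cond_eq Q e _ ih => exact fun o ho => .cond_eq _ e (ih o ho)
  | cond_ne Q e _ ih => exact fun o ho => .cond_ne _ e (ih o ho)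
  | rep _ _ ih ih' =>
      intro o ho
      rcases Multiset.mem_add.1 ho with ho | ho
      exacts [(ih o ho).rep_of, ih' o ho]

/-- Up to `n` messages at a time, everything that `P` offers is also offered by `Q`. -/
def OffersLe (nm : Bool) (n : ℕ) (P Q : Raw) : Prop :=
  ∀ M, M.card ≤ n → Offers nm P M → Offers nm Q M

theorem OffersLe.mono {n n' : ℕ} {P Q : Raw} (h : OffersLe nm n P Q) (hn : n' ≤ n) :
    OffersLe nm n' P Q := fun M hM => h M (hM.trans hn)

theorem OffersLe.refl (n : ℕ) (P : Raw) : OffersLe nm n P P := fun _ _ => id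

theorem OffersLe.rep {n : ℕ} {P Q : Raw} (h : OffersLe nm n P Q) :
    OffersLe nm n (.rep P) (.rep Q) := by
  intro M hM hP
  generalize hR : Raw.rep P = R at hP
  induction hP with
  | zero => exact .zero _
  | rep h₁ _ _ ih =>
      cases hR
      rw [Multiset.card_add] at hM
      exact .rep (h _ (by omega) h₁) (ih (by omega) rfl)
  | _ => cases hR

namespace Ctx

variable {k : ℕ}

theorem offersLe_fill {T T' : Fin k → Raw} {n : ℕ} (h : ∀ j, OffersLe nm n (T j) (T' j)) :
    ∀ C : Ctx k, OffersLe nm n (C.fill T) (C.fill T')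
  | hole i => h i
  | nil => .refl _ _
  | ok => .refl _ _
  | outA m => .refl _ _
  | outS m C => fun M _ hM => offers_outS.2 (offers_outS.1 hM)
  | inp I C => fun M _ hM => offers_inp.2 (offers_inp.1 hM)
  | res a C => fun M hn hM => by
      obtain ⟨N, hN, hc, rfl⟩ := offers_res.1 hM
      exact .res (offersLe_fill h C N (by simpa using hn) hN) hc
  | par C D => fun M hn hM => by
      obtain ⟨M₁, M₂, h₁, h₂, rfl⟩ := offers_par.1 hM
      rw [Multiset.card_add] at hn
      exact .par (offersLe_fill h C _ (by omega) h₁) (offersLe_fill h D _ (by omega) h₂)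
  | cond s t C D => fun M hn hM => by
      refine offers_cond.2 ?_
      have := offers_cond.1 hM
      split_ifs at this ⊢
      exacts [offersLe_fill h C M hn this, offersLe_fill h D M hn this]
  | rep C => (offersLe_fill h C).rep

/-- An input of `C.fill T` all of whose demands are met lies in at most one of the holes; the
processes in the other holes only provide messages. -/
theorem needs_fill {T : Fin 2 → Raw} : ∀ (C : Ctx 2) {D : Multiset Shape},
    Needs nm (C.fill T) D → ∃ (n : ℕ) (i : Fin 2), ∀ T' : Fin 2 → Raw, T' i = T i →
      (∀ j, OffersLe nm n (T j) (T' j)) → Needs nm (C.fill T') D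
  | hole i, D, h => ⟨0, i, fun T' e _ => by simpa [fill, e] using h⟩
  | nil, D, h => absurd h not_needs_nil
  | ok, D, h => ⟨0, 0, fun T' _ _ => h⟩
  | outA m, D, h => absurd h not_needs_outA
  | outS m C, D, h => absurd h not_needs_outS
  | inp I C, D, h => ⟨0, 0, fun T' _ _ => by cases h; exact .inp _ _⟩
  | res a C, D, h => by
      obtain ⟨h, hD⟩ := needs_res.1 h
      obtain ⟨n, i, hi⟩ := needs_fill C h
      exact ⟨n, i, fun T' e hT => .res (hi T' e hT) hD⟩
  | par C C', D, h => by
      rcases needs_par.1 h with ⟨D', M, h₁, h₂, h₃⟩ | ⟨D', M, h₁, h₂, h₃⟩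
      · obtain ⟨n, i, hi⟩ := needs_fill C h₁
        -- The bound has to cover the messages used inside `C` and those supplied by `C'`.
        exact ⟨max n M.card, i, fun T' e hT => .parL
          (hi T' e fun j => (hT j).mono (le_max_left _ _))
          (offersLe_fill hT C' M (le_max_right _ _) h₂) h₃⟩
      · obtain ⟨n, i, hi⟩ := needs_fill C' h₂
        exact ⟨max n M.card, i, fun T' e hT => .parR
          (offersLe_fill hT C M (le_max_right _ _) h₁)
          (hi T' e fun j => (hT j).mono (le_max_left _ _)) h₃⟩
  | cond s t C C', D, h => by
      have h := needs_cond.1 h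
      split_ifs at h with e
      · obtain ⟨n, i, hi⟩ := needs_fill C h
        exact ⟨n, i, fun T' e' hT => .cond_eq _ e (hi T' e' hT)⟩
      · obtain ⟨n, i, hi⟩ := needs_fill C' h
        exact ⟨n, i, fun T' e' hT => .cond_ne _ e (hi T' e' hT)⟩
  | rep C, D, h => by
      -- The recursive call is fixed first; the induction on the derivation then unfolds the
      -- replication copy by copy.
      have ih := fun D => needs_fill (T := T) C (D := D)
      generalize hR : (rep C).fill T = R at h
      induction h with
      | repL h₁ h₂ h₃ =>
          cases hR
          obtain ⟨n, i, hi⟩ := ih _ h₁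
          exact ⟨max n (Multiset.card _), i, fun T' e hT => .repL
            (hi T' e fun j => (hT j).mono (le_max_left _ _))
            (offersLe_fill hT (rep C) _ (le_max_right _ _) h₂) h₃⟩
      | repR h₁ _ h₃ ih' =>
          cases hR
          obtain ⟨n, i, hi⟩ := ih' rfl
          exact ⟨max n (Multiset.card _), i, fun T' e hT => .repR
            (offersLe_fill hT C _ (le_max_right _ _) h₁)
            (hi T' e fun j => (hT j).mono (le_max_left _ _)) h₃⟩
      | _ => cases hR

/-- The names captured at a hole, and whether the hole is under a replication; `none` if the hole
is guarded. -/
def cap : Ctx k → Fin k → Option (Finset Name × Bool)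
  | hole i, j => if i = j then some (∅, false) else none
  | nil, _ | ok, _ | outA _, _ | outS _ _, _ | inp _ _, _ => none
  | res a C, j => (C.cap j).map fun c => (insert a c.1, c.2)
  | par C D, j => (C.cap j).or (D.cap j)
  | cond s t C D, j => if s = t then C.cap j else D.cap j
  | rep C, j => (C.cap j).map fun c => (c.1, true)

theorem mem_holes_of_cap {j : Fin k} : ∀ {C : Ctx k}, C.cap j ≠ none → j ∈ C.holes
  | hole i, h => by
      by_cases e : i = j
      · simp [holes, e]
      · simp [cap, e] at h
  | nil, h | ok, h | outA _, h | outS _ _, h | inp _ _, h => by simp [cap] at h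
  | res a C, h => mem_holes_of_cap (C := C) (by simpa [cap] using h)
  | par C D, h => by
      by_cases hC : C.cap j = none
      · exact List.mem_append_right _ (mem_holes_of_cap (by simpa [cap, hC] using h))
      · exact List.mem_append_left _ (mem_holes_of_cap hC)
  | cond s t C D, h => by
      unfold cap at h
      split_ifs at h
      · exact List.mem_append_left _ (mem_holes_of_cap h)
      · exact List.mem_append_right _ (mem_holes_of_cap h)
  | rep C, h => mem_holes_of_cap (C := C) (by simpa [cap] using h)

end Ctx

/-- No message of `M` has its channel in `V`. -/
def Free (V : Finset Name) (M : Multiset Shape) : Prop := ∀ o ∈ M, ∀ a ∈ V, o.chan ≠ some a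

/-- Sums of elements of `S`; just the elements of `S` unless `r` holds. -/
def sums (r : Bool) (S : Set (Multiset Shape)) : Set (Multiset Shape) :=
  if r then AddSubmonoid.closure S else S

/-- The messages that pass a hole filled with a process that offers `S`. -/
def Contrib : Option (Finset Name × Bool) → Set (Multiset Shape) → Multiset Shape → Prop
  | none, _, m => m = 0
  | some (V, r), S, m => ∃ n ∈ sums r S, Free V n ∧ m = n.map (Shape.hide V)

theorem subset_sums (r : Bool) (S : Set (Multiset Shape)) : S ⊆ sums r S := by
  cases r
  · exact subset_rfl
  · exact AddSubmonoid.subset_closure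

theorem sums_subset_closure (r : Bool) (S : Set (Multiset Shape)) :
    sums r S ⊆ AddSubmonoid.closure S := by
  cases r
  · exact AddSubmonoid.subset_closure
  · exact subset_rfl

theorem Free.add {V : Finset Name} {M N : Multiset Shape} (h : Free V M) (h' : Free V N) :
    Free V (M + N) := fun o ho => (Multiset.mem_add.1 ho).elim (h o) (h' o)

theorem Free.hide {V W : Finset Name} {M : Multiset Shape} (h : Free V M) :
    Free V (M.map (Shape.hide W)) := by
  intro o ho
  obtain ⟨o, ho', rfl⟩ := Multiset.mem_map.1 ho
  exact h o ho'

theorem Free.mono {V : Finset Name} {M N : Multiset Shape} (h : Free V M) (hN : ∀ o ∈ N, o ∈ M) :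
    Free V N := fun o ho => h o (hN o ho)

theorem Contrib.zero {S : Set (Multiset Shape)} (hS : 0 ∈ S) :
    ∀ c, Contrib c S 0
  | none => rfl
  | some (_, r) => ⟨0, subset_sums r S hS, by simp [Free], rfl⟩

/-- All messages offered by processes with the offers of `P`. -/
abbrev offerSet (nm : Bool) (P : Raw) : Set (Multiset Shape) := {M | Offers nm P M}

/-! ### The offers of a filled context -/

namespace Ctx

variable {k : ℕ}

/-- With its converse `contrib_of_offers_fill`, this says that a filled context offers sums of its
own messages and of what passes each hole. The processes in the holes thus matter only through their
offers. -/
theorem offers_fill_of_contrib {T : Fin k → Raw} : ∀ (C : Ctx k) (B : Multiset Shape)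
    (m : Fin k → Multiset Shape), Offers nm (C.fill fun _ => .nil) B →
    (∀ j, Contrib (C.cap j) (offerSet nm (T j)) (m j)) → Offers nm (C.fill T) (B + ∑ j, m j)
  | hole i, B, m, hB, hm => by
      have hB : B = 0 := offers_nil.1 hB
      have h : ∑ j, m j = m i := by
        refine Finset.sum_eq_single i (fun j _ hj => ?_) (by simp)
        have := hm j
        rwa [cap, if_neg (Ne.symm hj)] at this
      have hi := hm i
      rw [cap, if_pos rfl] at hi
      obtain ⟨n, hn, -, e⟩ := hi
      rw [h, hB, zero_add, e]
      have h : Offers nm (T i) n := by simpa [sums] using hn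
      simpa [fill] using h
  | nil, B, m, hB, hm => by
      have : ∀ j, m j = 0 := hm
      simpa [this, fill] using hB
  | ok, B, m, hB, hm => by
      have : ∀ j, m j = 0 := hm
      simpa [this, fill] using hB
  | outA _, B, m, hB, hm => by
      have : ∀ j, m j = 0 := hm
      simpa [this, fill] using hB
  | outS _ _, B, m, hB, hm => by
      have : ∀ j, m j = 0 := hm
      simpa [this, fill, offers_outS] using hB
  | inp _ _, B, m, hB, hm => by
      have : ∀ j, m j = 0 := hm
      simpa [this, fill, offers_inp] using hB
  | res a C, B, m, hB, hm => by
      obtain ⟨B', hB', hBa, rfl⟩ := offers_res.1 hB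
      have key : ∀ j, ∃ m', Contrib (C.cap j) (offerSet nm (T j)) m' ∧ Free {a} m' ∧
          m j = m'.map (Shape.hide {a}) := by
        intro j
        have hj := hm j
        rw [cap] at hj
        cases hc : C.cap j with
        | none =>
            rw [hc] at hj
            exact ⟨0, rfl, by simp [Free], hj⟩
        | some c =>
            obtain ⟨V, r⟩ := c
            rw [hc] at hj
            obtain ⟨n, hn, hf, e⟩ := hj
            refine ⟨n.map (Shape.hide V), ⟨n, hn, fun o ho b hb => hf o ho b (by simp [hb]), rfl⟩,
              Free.hide fun o ho b hb => ?_, ?_⟩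
            · rw [Finset.mem_singleton.1 hb]
              exact hf o ho a (by simp)
            · simp only [e, Multiset.map_map, Function.comp, Shape.hide_hide, Finset.union_comm,
                Finset.insert_eq]
      choose m' h₁ h₂ h₃ using key
      have := offers_fill_of_contrib C B' m' hB' h₁
      have hs : (B' + ∑ j, m' j).map (Shape.hide {a}) =
          B'.map (Shape.hide {a}) + ∑ j, m j := by
        rw [Multiset.map_add]
        congr 1
        have := map_sum (Multiset.mapAddMonoidHom (Shape.hide {a})) m' Finset.univ
        simp only [Multiset.coe_mapAddMonoidHom] at this
        rw [this]
        exact Finset.sum_congr rfl fun j _ => (h₃ j).symm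
      rw [← hs]
      refine .res this fun o ho => ?_
      rcases Multiset.mem_add.1 ho with ho | ho
      · exact hBa o ho
      · obtain ⟨j, -, ho⟩ := Multiset.mem_sum.1 ho
        exact h₂ j o ho a (by simp)
  | par C D, B, m, hB, hm => by
      obtain ⟨B₁, B₂, h₁, h₂, rfl⟩ := offers_par.1 hB
      have e : ∀ j, ∃ m₁ m₂, m j = m₁ + m₂ ∧ Contrib (C.cap j) (offerSet nm (T j)) m₁ ∧
          Contrib (D.cap j) (offerSet nm (T j)) m₂ := by
        intro j
        have hj := hm j
        rw [cap] at hj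
        have hz := fun c => Contrib.zero (S := offerSet nm (T j)) (.zero _) c
        cases hc : C.cap j with
        | none => exact ⟨0, m j, (zero_add _).symm, rfl, by simpa [hc] using hj⟩
        | some c => exact ⟨m j, 0, (add_zero _).symm, by simpa [hc] using hj, hz _⟩
      choose m₁ m₂ e₁ e₂ e₃ using e
      have : B₁ + B₂ + ∑ j, m j = (B₁ + ∑ j, m₁ j) + (B₂ + ∑ j, m₂ j) := by
        simp only [e₁, Finset.sum_add_distrib]
        exact add_add_add_comm _ _ _ _
      rw [this]
      exact .par (offers_fill_of_contrib C _ _ h₁ e₂) (offers_fill_of_contrib D _ _ h₂ e₃)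
  | cond s t C D, B, m, hB, hm => by
      refine offers_cond.2 ?_
      have hB := offers_cond.1 hB
      unfold cap at hm
      split_ifs at hB hm ⊢
      exacts [offers_fill_of_contrib C _ _ hB hm, offers_fill_of_contrib D _ _ hB hm]
  | rep C, B, m, hB, hm => by
      -- Under a replication every summand gets copies of its own: the messages of the context,
      -- those of each hole, and every generator of the closure.
      refine Offers.rep_add ?_ ?_
      · refine offersLe_fill (n := B.card) (fun j M _ hM => ?_) (rep C) B le_rfl hB
        rw [offers_nil.1 hM]
        exact .zero _
      · refine Finset.sum_induction m (fun M => Offers nm (.rep (C.fill T)) M)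
          (fun _ _ h h' => h.rep_add h') (.zero _) fun j _ => ?_
        have hj := hm j
        rw [cap] at hj
        cases hc : C.cap j with
        | none =>
            rw [hc] at hj
            rw [show m j = 0 from hj]
            exact .zero _
        | some c =>
            obtain ⟨V, r⟩ := c
            rw [hc] at hj
            obtain ⟨n, hn, hf, e⟩ := hj
            rw [e]
            have hn' : n ∈ AddSubmonoid.closure (offerSet nm (T j)) := hn
            clear e hn
            induction hn' using AddSubmonoid.closure_induction with
            | zero => exact .zero _
            | add x y _ _ ihx ihy =>
                rw [Multiset.map_add]
                exact (ihx (hf.mono fun o ho => by simp [ho])).rep_add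
                  (ihy (hf.mono fun o ho => by simp [ho]))
            | mem x hx =>
                refine Offers.rep_of ?_
                have := offers_fill_of_contrib (T := T) C 0 (Pi.single j (x.map (Shape.hide V)))
                  (.zero _) fun i => by
                    by_cases hij : i = j
                    · subst hij
                      rw [hc, Pi.single_eq_same]
                      exact ⟨x, subset_sums _ _ hx, hf, rfl⟩
                    · rw [Pi.single_eq_of_ne hij]
                      exact .zero (.zero _) _
                simpa [Finset.sum_pi_single'] using this

/-- That each hole occurs at most once is needed at parallel compositions: `cap` keeps the data of
one side only, and this loses nothing because the hole is absent from the other. -/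
theorem contrib_of_offers_fill {T : Fin k → Raw} : ∀ (C : Ctx k) (M : Multiset Shape),
    (∀ j, C.holes.count j ≤ 1) → Offers nm (C.fill T) M →
    ∃ (B : Multiset Shape) (m : Fin k → Multiset Shape), M = B + ∑ j, m j ∧
      Offers nm (C.fill fun _ => .nil) B ∧ ∀ j, Contrib (C.cap j) (offerSet nm (T j)) (m j)
  | hole i, M, _, h => by
      refine ⟨0, Pi.single i M, by simp, .zero _, fun j => ?_⟩
      by_cases hij : i = j
      · subst hij
        rw [Pi.single_eq_same, cap, if_pos rfl]
        exact ⟨M, h, by simp [Free], by simp⟩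
      · rw [Pi.single_eq_of_ne (Ne.symm hij), cap, if_neg hij]
        rfl
  | nil, M, _, h => ⟨M, 0, by simp, h, fun _ => rfl⟩
  | ok, M, _, h => ⟨M, 0, by simp, h, fun _ => rfl⟩
  | outA _, M, _, h => ⟨M, 0, by simp, h, fun _ => rfl⟩
  | outS _ _, M, _, h => ⟨M, 0, by simp, offers_outS.2 (offers_outS.1 h), fun _ => rfl⟩
  | inp _ _, M, _, h => ⟨M, 0, by simp, offers_inp.2 (offers_inp.1 h), fun _ => rfl⟩
  | res a C, M, hl, h => by
      obtain ⟨N, hN, hc, rfl⟩ := offers_res.1 h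
      obtain ⟨B, m, rfl, hB, hm⟩ := contrib_of_offers_fill C N hl hN
      refine ⟨B.map (Shape.hide {a}), fun j => (m j).map (Shape.hide {a}), ?_,
        .res hB fun o ho => hc o (by simp [ho]), fun j => ?_⟩
      · rw [Multiset.map_add]
        congr 1
        exact map_sum (Multiset.mapAddMonoidHom (Shape.hide {a})) m Finset.univ
      · have hj := hm j
        rw [cap]
        have hmem : ∀ o ∈ m j, o.chan ≠ some a := fun o ho => hc o
          (Multiset.mem_add.2 (Or.inr (Multiset.mem_sum.2 ⟨j, Finset.mem_univ _, ho⟩)))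
        cases hcap : C.cap j with
        | none =>
            rw [hcap] at hj
            simp [show m j = 0 from hj, Contrib]
        | some c =>
            obtain ⟨V, r⟩ := c
            rw [hcap] at hj
            obtain ⟨n, hn, hf, e⟩ := hj
            refine ⟨n, hn, fun o ho b hb => ?_, ?_⟩
            · rcases Finset.mem_insert.1 hb with rfl | hb
              · exact hmem (o.hide V) (e ▸ Multiset.mem_map_of_mem _ ho)
              · exact hf o ho b hb
            · simp only [e, Multiset.map_map, Function.comp, Shape.hide_hide, Finset.union_comm,
                Finset.insert_eq]
  | par C D, M, hl, h => by
      obtain ⟨M₁, M₂, h₁, h₂, rfl⟩ := offers_par.1 h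
      have hl : ∀ j, C.holes.count j + D.holes.count j ≤ 1 := by simpa [holes] using hl
      obtain ⟨B₁, m₁, rfl, hB₁, hm₁⟩ := contrib_of_offers_fill C M₁
        (fun j => by have := hl j; omega) h₁
      obtain ⟨B₂, m₂, rfl, hB₂, hm₂⟩ := contrib_of_offers_fill D M₂
        (fun j => by have := hl j; omega) h₂
      refine ⟨B₁ + B₂, fun j => m₁ j + m₂ j, ?_, .par hB₁ hB₂, fun j => ?_⟩
      · simp only [Finset.sum_add_distrib]
        exact add_add_add_comm _ _ _ _
      · have h₁ := hm₁ j
        have h₂ := hm₂ j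
        rw [cap]
        cases hC : C.cap j with
        | none =>
            rw [hC] at h₁
            simpa [show m₁ j = 0 from h₁] using h₂
        | some c =>
            have hC' : 0 < C.holes.count j :=
              List.count_pos_iff.2 (mem_holes_of_cap (by simp [hC]))
            have hD : D.cap j = none := by
              by_contra hD
              have : 0 < D.holes.count j := List.count_pos_iff.2 (mem_holes_of_cap hD)
              have := hl j
              omega
            rw [hD] at h₂
            rw [hC] at h₁
            simpa [show m₂ j = 0 from h₂] using h₁
  | cond s t C D, M, hl, h => by
      have h := offers_cond.1 h
      have hl : ∀ j, C.holes.count j + D.holes.count j ≤ 1 := by simpa [holes] using hl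
      split_ifs at h with e
      · obtain ⟨B, m, e', hB, hm⟩ := contrib_of_offers_fill C M
          (fun j => by have := hl j; omega) h
        exact ⟨B, m, e', .cond_eq _ e hB, fun j => by simpa [cap, e] using hm j⟩
      · obtain ⟨B, m, e', hB, hm⟩ := contrib_of_offers_fill D M
          (fun j => by have := hl j; omega) h
        exact ⟨B, m, e', .cond_ne _ e hB, fun j => by simpa [cap, e] using hm j⟩
  | rep C, M, hl, h => by
      have ih := fun M => contrib_of_offers_fill (T := T) C M hl
      generalize hR : (rep C).fill T = R at h
      induction h with
      | zero => exact ⟨0, 0, by simp, .zero _, fun j => .zero (.zero _) _⟩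
      | rep h₁ _ _ ih' =>
          cases hR
          obtain ⟨B₁, m₁, rfl, hB₁, hm₁⟩ := ih _ h₁
          obtain ⟨B₂, m₂, rfl, hB₂, hm₂⟩ := ih' rfl
          refine ⟨B₁ + B₂, fun j => m₁ j + m₂ j, ?_, .rep hB₁ hB₂, fun j => ?_⟩
          · simp only [Finset.sum_add_distrib]
            exact add_add_add_comm _ _ _ _
          · have h₁ := hm₁ j
            have h₂ := hm₂ j
            rw [cap] at h₂ ⊢
            cases hC : C.cap j with
            | none =>
                rw [hC] at h₁ h₂
                simp [show m₁ j = 0 from h₁, show m₂ j = 0 from h₂, Contrib]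
            | some c =>
                obtain ⟨V, r⟩ := c
                rw [hC] at h₁ h₂
                obtain ⟨n₁, hn₁, hf₁, e₁⟩ := h₁
                obtain ⟨n₂, hn₂, hf₂, e₂⟩ := h₂
                exact ⟨n₁ + n₂, AddSubmonoid.add_mem _ (sums_subset_closure _ _ hn₁) hn₂,
                  hf₁.add hf₂, by simp [e₁, e₂]⟩
      | _ => cases hR

end Ctx
-- Nesting a binary context in its second hole
variable {nm : Bool}

theorem Contrib.of_singleton {V : Finset Name} {r : Bool} {S : Set (Multiset Shape)} {o : Shape}
    (ho : {o} ∈ S) (hV : Free V {o}) : Contrib (some (V, r)) S {o.hide V} :=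
  ⟨{o}, subset_sums r S ho, hV, rfl⟩

theorem Contrib.exists_of_mem {P : Raw} {V : Finset Name} {r : Bool} {m : Multiset Shape}
    (h : Contrib (some (V, r)) (offerSet nm P) m) {p : Shape} (hp : p ∈ m) :
    ∃ o, Offers nm P {o} ∧ Free V {o} ∧ p = o.hide V := by
  obtain ⟨n, hn, hf, rfl⟩ := h
  obtain ⟨o, ho, rfl⟩ := Multiset.mem_map.1 hp
  refine ⟨o, ?_, hf.mono (by simpa using ho), rfl⟩
  have hn' := sums_subset_closure r _ hn
  clear hn hf hp
  induction hn' using AddSubmonoid.closure_induction with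
  | mem x hx => exact Offers.singleton hx o ho
  | zero => simp at ho
  | add x y _ _ ihx ihy =>
      rcases Multiset.mem_add.1 ho with ho | ho
      exacts [ihx ho, ihy ho]

namespace Ctx

theorem offers_fill_of_contrib₂ (C : Ctx 2) {P Q : Raw} {B m₀ m₁ : Multiset Shape}
    (hB : Offers nm (C.fill fun _ => .nil) B) (h₀ : Contrib (C.cap 0) (offerSet nm P) m₀)
    (h₁ : Contrib (C.cap 1) (offerSet nm Q) m₁) :
    Offers nm (C.fill ![P, Q]) (B + m₀ + m₁) := by
  have := offers_fill_of_contrib (T := ![P, Q]) C B ![m₀, m₁] hB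
    (by simpa [Fin.forall_fin_two] using ⟨h₀, h₁⟩)
  simpa [Fin.sum_univ_two, add_assoc] using this

theorem contrib_of_offers_fill₂ (C : Ctx 2) {P Q : Raw} {M : Multiset Shape}
    (hC : ∀ j, C.holes.count j ≤ 1) (h : Offers nm (C.fill ![P, Q]) M) :
    ∃ B m₀ m₁, M = B + m₀ + m₁ ∧ Offers nm (C.fill fun _ => .nil) B ∧
      Contrib (C.cap 0) (offerSet nm P) m₀ ∧ Contrib (C.cap 1) (offerSet nm Q) m₁ := by
  obtain ⟨B, m, rfl, hB, hm⟩ := contrib_of_offers_fill C M hC h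
  exact ⟨B, m 0, m 1, by simp [Fin.sum_univ_two, add_assoc], hB, hm 0, hm 1⟩

/-- `Q` offers `M` up to the names of `V`. -/
def OffersUpTo (nm : Bool) (V : Finset Name) (M : Multiset Shape) (Q : Raw) : Prop :=
  Free V M → ∃ N, Offers nm Q N ∧ Free V N ∧ N.map (Shape.hide V) = M.map (Shape.hide V)

variable {C : Ctx 2} {V : Finset Name} {r : Bool} {M : Multiset Shape} {P Q : Raw}

theorem map_hide_map_hide (V : Finset Name) (M : Multiset Shape) :
    (M.map (Shape.hide V)).map (Shape.hide V) = M.map (Shape.hide V) := by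
  simp [Multiset.map_map, Shape.hide_hide]

/-- Every level of nesting hides the names `V` captured at hole `1` once more. Hiding is idempotent,
so agreement up to `V` survives any number of levels. -/
theorem OffersUpTo.fill (hc : C.cap 1 = some (V, r)) (h : OffersUpTo nm V M Q)
    {m : Multiset Shape} (hm : Contrib (C.cap 0) (offerSet nm P) m) :
    OffersUpTo nm V (m + M) (C.fill ![P, Q]) := by
  intro hM
  obtain ⟨N, hN, hf, e⟩ := h (hM.mono fun o ho => Multiset.mem_add.2 (Or.inr ho))
  refine ⟨_, offers_fill_of_contrib₂ C (.zero _) hm (m₁ := N.map (Shape.hide V)) ?_, ?_, ?_⟩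
  · rw [hc]
    exact ⟨N, subset_sums _ _ hN, hf, rfl⟩
  · rw [zero_add]
    exact (hM.mono fun o ho => Multiset.mem_add.2 (Or.inl ho)).add hf.hide
  · rw [zero_add, Multiset.map_add, Multiset.map_add, map_hide_map_hide, e]

theorem OffersUpTo.foldr_fill (hc : C.cap 1 = some (V, r)) (h : OffersUpTo nm V M Q) :
    ∀ Ps : List Raw, OffersUpTo nm V M (Ps.foldr (fun P Y => C.fill ![P, Y]) Q)
  | [] => h
  | _ :: Ps => by
      simpa using (foldr_fill hc h Ps).fill hc (Contrib.zero (.zero _) _)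

/-- Of all the `Ps`, only one that offers `p` is made to contribute; the zero offer of each of the
others adds nothing. -/
theorem OffersUpTo.cons_foldr_fill (hc : C.cap 1 = some (V, r)) (h : OffersUpTo nm V M Q)
    {p : Shape} : ∀ Ps : List Raw, (∃ P ∈ Ps, Contrib (C.cap 0) (offerSet nm P) {p}) →
      OffersUpTo nm V (p ::ₘ M) (Ps.foldr (fun P Y => C.fill ![P, Y]) Q)
  | [], h' => by simp at h'
  | P :: Ps, h' => by
      by_cases hP : Contrib (C.cap 0) (offerSet nm P) {p}
      · exact (h.foldr_fill hc Ps).fill hc hP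
      · have := cons_foldr_fill hc h Ps (p := p) (by simpa [hP] using h')
        simpa using this.fill hc (P := P) (Contrib.zero (.zero _) _)

/-- One block of `Ps` is spent per message of `m`, since the same copy of a process need not be able
to offer two messages at once. Spare blocks contribute nothing. -/
theorem offersUpTo_blocks (hc : C.cap 1 = some (V, r)) {Ps : List Raw} (h : OffersUpTo nm V M Q) :
    ∀ (t : ℕ) (m : Multiset Shape), m.card ≤ t →
      (∀ p ∈ m, ∃ P ∈ Ps, Contrib (C.cap 0) (offerSet nm P) {p}) →
      OffersUpTo nm V (m + M)
        ((List.replicate t Ps).flatten.foldr (fun P Y => C.fill ![P, Y]) Q)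
  | 0, m, hm, _ => by
      rw [Multiset.card_eq_zero.1 (Nat.le_zero.1 hm)]
      simpa using h
  | t + 1, m, hm, hp => by
      rw [List.replicate_succ, List.flatten_cons, List.foldr_append]
      rcases Multiset.empty_or_exists_mem m with rfl | ⟨p, hpm⟩
      · exact (offersUpTo_blocks hc h t 0 (by simp) (by simp)).foldr_fill hc Ps
      · obtain ⟨m, rfl⟩ := Multiset.exists_cons_of_mem hpm
        rw [Multiset.cons_add]
        rw [Multiset.card_cons] at hm
        exact (offersUpTo_blocks hc h t m (by omega) fun q hq =>
          hp q (Multiset.mem_cons_of_mem hq)).cons_foldr_fill hc Ps (hp p hpm)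

/-- Sharing offers: if every message of `X` is also offered by one of the `Ps`, then nesting the
`Ps` often enough offers at least what nesting `X` does. -/
theorem offersLe_nested (C : Ctx 2) (hC : ∀ j, C.holes.count j ≤ 1) (Z X : Raw) (Ps : List Raw)
    (h : ∀ o, Offers nm X {o} → ∃ P ∈ Ps, Offers nm P {o}) (t : ℕ) :
    OffersLe nm t (C.fill ![Z, C.fill ![X, Z]])
      (C.fill ![Z, (List.replicate t Ps).flatten.foldr (fun P Y => C.fill ![P, Y])
        (C.fill ![Z, Z])]) := by
  intro M hM hO
  obtain ⟨B, m₀, m₁, rfl, hB, h₀, h₁⟩ := contrib_of_offers_fill₂ C hC hO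
  -- Only the content of hole `1` differs, and whatever passes this hole has the names of `V`
  -- hidden. The outer layer `C.fill ![Z, ·]` is there to make agreement up to `V` sufficient.
  refine offers_fill_of_contrib₂ C hB h₀ ?_
  cases hc : C.cap 1 with
  | none => rw [hc] at h₁; exact h₁
  | some c =>
      obtain ⟨V, r⟩ := c
      set Y := (List.replicate t Ps).flatten.foldr (fun P Y => C.fill ![P, Y]) (C.fill ![Z, Z])
        with hY
      rw [hc] at h₁
      obtain ⟨n, hn, hf, rfl⟩ := h₁
      have key : ∀ n, n.card ≤ t → Offers nm (C.fill ![X, Z]) n → OffersUpTo nm V n Y := by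
        intro n hn hO
        obtain ⟨B, m₀, m₁, rfl, hB, h₀, h₁⟩ := contrib_of_offers_fill₂ C hC hO
        -- Everything except the contribution of `X` is already offered by the innermost `C.fill
        -- ![Z, Z]`; the contribution `m₀` of `X` is what the blocks must supply.
        have hZ : OffersUpTo nm V (B + m₁) (C.fill ![Z, Z]) := by
          intro hf
          have := offers_fill_of_contrib₂ C hB
            (Contrib.zero (S := offerSet nm Z) (.zero _) _) h₁
          exact ⟨_, by simpa using this, hf, rfl⟩
        rw [show B + m₀ + m₁ = m₀ + (B + m₁) by rw [add_comm B, add_assoc]] at hn ⊢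
        rw [Multiset.card_add] at hn
        refine offersUpTo_blocks hc hZ t m₀ (by omega) fun p hp => ?_
        cases hc₀ : C.cap 0 with
        | none =>
            rw [hc₀] at h₀
            rw [show m₀ = 0 from h₀] at hp
            simp at hp
        | some c =>
            obtain ⟨V₀, r₀⟩ := c
            rw [hc₀] at h₀
            obtain ⟨o, ho, hV, rfl⟩ := h₀.exists_of_mem hp
            obtain ⟨P, hP, hPo⟩ := h o ho
            exact ⟨P, hP, .of_singleton hPo hV⟩
      have hcard : n.card ≤ t := by
        simp only [Multiset.card_add, Multiset.card_map] at hM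
        omega
      suffices ∃ n' ∈ sums r (offerSet nm Y), Free V n' ∧
          n'.map (Shape.hide V) = n.map (Shape.hide V) by
        obtain ⟨n', h₁, h₂, h₃⟩ := this
        exact ⟨n', h₁, h₂, h₃.symm⟩
      clear hM hO
      cases r with
      | false =>
          obtain ⟨n', h₁, h₂, h₃⟩ := key n hcard hn hf
          exact ⟨n', h₁, h₂, h₃⟩
      -- If hole `1` is replicated, its contribution is a sum of offers. The summands are replaced
      -- separately, and each of them has at most `t` messages.
      | true =>
          have hn' : n ∈ AddSubmonoid.closure (offerSet nm (C.fill ![X, Z])) := hn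
          clear hn
          change ∃ n' ∈ AddSubmonoid.closure (offerSet nm Y), _
          induction hn' using AddSubmonoid.closure_induction with
          | zero => exact ⟨0, AddSubmonoid.zero_mem _, by simp [Free], rfl⟩
          | mem x hx =>
              obtain ⟨n', h₁, h₂, h₃⟩ := key x hcard hx hf
              exact ⟨n', AddSubmonoid.subset_closure h₁, h₂, h₃⟩
          | add x y _ _ ihx ihy =>
              rw [Multiset.card_add] at hcard
              obtain ⟨x', hx₁, hx₂, hx₃⟩ := ihx
                (hf.mono fun o ho => Multiset.mem_add.2 (Or.inl ho)) (by omega)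
              obtain ⟨y', hy₁, hy₂, hy₃⟩ := ihy
                (hf.mono fun o ho => Multiset.mem_add.2 (Or.inr ho)) (by omega)
              exact ⟨x' + y', AddSubmonoid.add_mem _ hx₁ hy₁, hx₂.add hy₂, by simp [hx₃, hy₃]⟩

end Ctx
variable {nm : Bool}

/-! ### Renaming by transpositions -/

theorem Offers.subst_ren {P : Raw} {M : Multiset Shape} {f : Name → Name} (h : Offers nm P M)
    (hf : Set.InjOn f P.fn) :
    Offers nm (P.subst fun a => .name (f a)) (M.map (Shape.ren f)) := by
  obtain ⟨π, hπ⟩ := exists_perm_eq_on P.fn f hf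
  rw [Raw.subst_congr fun c hc => congrArg Term.name (hπ c hc).symm,
    ← offers_iff_of_alpha (P.alpha_perm_subst π)]
  have : M.map (Shape.ren f) = M.map (Shape.ren π) :=
    Multiset.map_congr rfl fun o ho => Shape.ren_congr fun a ha => (hπ a (h.mem_fn o ho a ha)).symm
  exact this ▸ h.perm π

/-- This is where monadicity enters: a shape consists of one optional channel name and one optional
datum, so only finitely many shapes can be formed over a finite set of names. -/
theorem Offers.args_eq {L : Lang} (hL : L.arity = .monadic) {P : Raw} {M : Multiset Shape}
    (h : Offers nm P M) (hP : L.Wf P) : ∀ o ∈ M,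
      (L.medium = .dataspace → o.chan = none) ∧ ∃ t, o.args = [t] ∧ (nm = false → t = none) := by
  have key : ∀ m, L.MsgOk m → ∀ o ∈ ({m.shape nm} : Multiset Shape),
      (L.medium = .dataspace → o.chan = none) ∧
        ∃ t, o.args = [t] ∧ (nm = false → t = none) := by
    intro m hm o ho
    rw [Multiset.mem_singleton.1 ho]
    refine ⟨fun hd => ?_, ?_⟩
    · have := hm.1
      simp only [Lang.ChanOk, hd] at this
      simp [Msg.shape, this]
    · obtain ⟨t, ht⟩ := List.length_eq_one_iff.1 (hm.2.1 hL)
      exact ⟨argShape nm t, by simp [Msg.shape, ht], fun h => by simp [argShape, h]⟩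
  induction h with
  | zero => simp
  | outA m => exact key m hP.2
  | outS m P => exact key m hP.2.1
  | par _ _ ih ih' =>
      intro o ho
      rcases Multiset.mem_add.1 ho with ho | ho
      exacts [ih hP.1 o ho, ih' hP.2 o ho]
  | @res a _ _ _ _ ih =>
      intro o ho
      obtain ⟨o, ho', rfl⟩ := Multiset.mem_map.1 ho
      obtain ⟨h₁, t, h₂, h₃⟩ := ih hP o ho'
      exact ⟨h₁, Shape.hideArg {a} t, by simp [Shape.hide, h₂], fun h => by rw [h₃ h]; rfl⟩
  | cond_eq _ _ _ ih => exact ih hP.1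
  | cond_ne _ _ _ ih => exact ih hP.2
  | rep _ _ ih ih' =>
      intro o ho
      rcases Multiset.mem_add.1 ho with ho | ho
      exacts [ih hP o ho, ih' hP o ho]

/-- The substitution that swaps two names. -/
def swapSubst (L : Lang) (u v : Name) : L.Subst where
  toFun a := .name (Equiv.swap u v a)
  finite_domain := by
    refine (Set.toFinite {u, v}).subset fun a ha => ?_
    by_contra h
    simp only [Set.mem_insert_iff, Set.mem_singleton_iff, not_or] at h
    exact ha (by rw [Equiv.swap_apply_of_ne_of_ne h.1 h.2])
  termOk _ _ := ⟨_, rfl⟩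

theorem swapSubst_injective (L : Lang) (u v : Name) :
    Function.Injective (swapSubst L u v).toFun := fun _ _ h =>
  (Equiv.swap u v).injective (Term.name.inj h)

theorem alpha_swap_swap {L : Lang} (u v : Name) (S : L.Proc) :
    Alpha S.1 ((swapSubst L u v).app ((swapSubst L u v).app S)).1 := by
  change Alpha S.1 ((S.1.subst _).subst _)
  rw [Raw.subst_subst]
  have : (fun a => ((swapSubst L u v).toFun a).subst (swapSubst L u v).toFun) = Term.name := by
    funext a
    simp [swapSubst, Term.subst]
  rw [this]
  exact S.1.alpha_subst_name

namespace Encoding.IsValid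

variable {L₁ L₂ : Lang} {E : Encoding L₁ L₂} {beq : L₂.Proc → L₂.Proc → Prop}

/-- The swap of two names in the source is a renaming in the target. -/
theorem exists_swap (hE : E.IsValid beq) (hL : L₂.matching ≠ .intensional) (u v : Name) :
    ∃ f : Name → Name, {a | f a ≠ a}.Finite ∧ ∀ S : L₁.Proc,
      Alpha (E.enc ((swapSubst L₁ u v).app S)).1 ((E.enc S).1.subst fun a => .name (f a)) := by
  obtain ⟨σ, -, hσ⟩ := hE.name_invariance (swapSubst L₁ u v)
  choose f hf using fun a => σ.termOk a hL
  refine ⟨f, σ.finite_domain.subset fun a ha h => ha ?_, fun S => ?_⟩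
  · exact Term.name.inj ((hf a).symm.trans h)
  · have := (hσ S).1 (swapSubst_injective _ _ _)
    rwa [← funext hf]

variable {u v : Name} {f : Name → Name}

/-- Two swaps cancel, so up to alpha-equivalence the translation of `S` is its own image under `f ∘
f`. The map `f` itself is not known to be an involution, nor to be injective on all names. -/
theorem image_image_fn (hf : ∀ S : L₁.Proc,
      Alpha (E.enc ((swapSubst L₁ u v).app S)).1 ((E.enc S).1.subst fun a => .name (f a)))
    (S : L₁.Proc) : (E.enc S).1.fn = (E.enc S).1.fn.image fun a => f (f a) := by
  have h := (E.alpha _ _ (alpha_swap_swap u v S)).trans (hf _)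
  rw [Raw.fn_eq_of_alpha h]
  have h₂ := Raw.subst_eq_of_alpha (hf S) fun a => .name (f a)
  rw [h₂, Raw.subst_subst]
  have : ((E.enc S).1.subst fun a => (Term.name (f a)).subst fun a => .name (f a)).fn
      = (E.enc S).1.fn.image fun a => f (f a) := by
    ext b
    simp [Raw.mem_fn_subst, Term.subst, Term.names, eq_comm]
  rw [this]
  have h₃ := Raw.fn_eq_of_alpha h
  rw [h₂, Raw.subst_subst, this] at h₃
  rw [← h₃, ← h₃]

/-- A map of a finite set onto itself is injective; here the map is `f ∘ f` on the free names of the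
translation. -/
theorem injOn_fn (hf : ∀ S : L₁.Proc,
      Alpha (E.enc ((swapSubst L₁ u v).app S)).1 ((E.enc S).1.subst fun a => .name (f a)))
    (S : L₁.Proc) : Set.InjOn f (E.enc S).1.fn := by
  have h : Set.InjOn (fun a => f (f a)) (E.enc S).1.fn := by
    refine Finset.card_image_iff.1 ?_
    rw [← image_image_fn hf S]
  exact fun a ha b hb e => h ha hb (congrArg f e)

/-- `f ∘ f` permutes the finite set of free names, so it has finite order there. The exponent is
written `2 * (k + 1)` to make it even and positive. -/
theorem exists_period (hf : ∀ S : L₁.Proc,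
      Alpha (E.enc ((swapSubst L₁ u v).app S)).1 ((E.enc S).1.subst fun a => .name (f a)))
    (S : L₁.Proc) : ∃ k, ∀ a ∈ (E.enc S).1.fn, f^[2 * (k + 1)] a = a := by
  set X := (E.enc S).1.fn
  have him := image_image_fn hf S
  have hm : ∀ a : X, f (f a) ∈ X := fun a => by
    have := Finset.mem_image_of_mem (fun a => f (f a)) a.2
    rwa [← him] at this
  let g : X → X := fun a => ⟨f (f a), hm a⟩
  have hg : Function.Surjective g := by
    rintro ⟨b, hb⟩
    have hb' := hb
    rw [show X = _ from him] at hb'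
    obtain ⟨a, ha, rfl⟩ := Finset.mem_image.1 hb'
    exact ⟨⟨a, ha⟩, rfl⟩
  let p : Equiv.Perm X := Equiv.ofBijective g (Finite.injective_iff_bijective.1
    (Finite.injective_iff_surjective.2 hg))
  have hp : ∀ (k : ℕ) (a : X), ((p ^ k) a : Name) = f^[2 * k] a := by
    intro k
    induction k with
    | zero => simp
    | succ k ih =>
        intro a
        rw [pow_succ', Equiv.Perm.mul_apply, Nat.mul_succ, Function.iterate_succ_apply',
          Function.iterate_succ_apply', ← ih]
        rfl
  obtain ⟨k, hk⟩ := Nat.exists_eq_succ_of_ne_zero (orderOf_pos p).ne'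
  refine ⟨k, fun a ha => ?_⟩
  have := hp (k + 1) ⟨a, ha⟩
  rw [← Nat.succ_eq_add_one, ← hk, pow_orderOf_eq_one] at this
  rw [← Nat.succ_eq_add_one, ← hk, ← this]
  rfl

theorem offers_swap (hf : ∀ S : L₁.Proc,
      Alpha (E.enc ((swapSubst L₁ u v).app S)).1 ((E.enc S).1.subst fun a => .name (f a)))
    {S : L₁.Proc} {o : Shape} (h : Offers nm (E.enc S).1 {o}) :
    Offers nm (E.enc ((swapSubst L₁ u v).app S)).1 {o.ren f} :=
  (offers_iff_of_alpha (hf S)).2 (by simpa using h.subst_ren (injOn_fn hf S))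

/-- If `R` offers the renaming of a message of `S`, then the swap of `R` offers that message. -/
theorem offers_swap_of_ren (hf : ∀ S : L₁.Proc,
      Alpha (E.enc ((swapSubst L₁ u v).app S)).1 ((E.enc S).1.subst fun a => .name (f a)))
    {S R : L₁.Proc} {o : Shape} (h : Offers nm (E.enc S).1 {o})
    (hR : Offers nm (E.enc R).1 {o.ren f}) :
    Offers nm (E.enc ((swapSubst L₁ u v).app R)).1 {o} := by
  obtain ⟨k, hk⟩ := exists_period hf S
  -- Further pairs of swaps change the swap of `R` only up to alpha-equivalence, so its translation
  -- offers `o` renamed by every positive even power of `f`. One of these powers fixes the names of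
  -- `o`.
  have key : ∀ j, Offers nm (E.enc ((swapSubst L₁ u v).app R)).1 {o.ren f^[2 * (j + 1)]} := by
    intro j
    induction j with
    | zero =>
        have := offers_swap hf hR
        rw [Shape.ren_ren] at this
        exact this
    | succ j ih =>
        have := (offers_iff_of_alpha (E.alpha _ _ (alpha_swap_swap u v _))).2
          (offers_swap hf (offers_swap hf ih))
        rw [Shape.ren_ren, Shape.ren_ren] at this
        rw [Nat.mul_succ, Nat.add_comm, Function.iterate_add]
        exact this
  have := key k
  rwa [Shape.ren_congr (g := fun a => a) fun a ha => hk a (h.mem_fn o (by simp) a ha),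
    Shape.ren_id] at this

/-- Families of processes that are permuted by the swaps of names share their messages with
members of the families at other indices. -/
theorem exists_sharing (hE : E.IsValid beq) (hL : L₂.matching ≠ .intensional)
    (hA : L₂.arity = .monadic) {ι : Type*} [Finite ι] (X : ι → Name → Name → ℕ → L₁.Proc)
    (hX : ∀ x u v a b n, (swapSubst L₁ u v).app (X x a b n) =
      X x (Equiv.swap u v a) (Equiv.swap u v b) n) :
    ∃ n n' m : ℕ, n ≠ n' ∧ ∀ x o, Offers nm (E.enc (X x 1 3 n)).1 {o} →
      Offers nm (E.enc (X x 1 3 n')).1 {o} ∨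
      (L₂.medium = .channel ∨ nm = true) ∧ Offers nm (E.enc (X x 2 3 n)).1 {o} ∨
      nm = true ∧ ∃ i < m, Offers nm (E.enc (X x 1 (4 + i) n)).1 {o} := by
  obtain ⟨f, hF, hf⟩ := hE.exists_swap hL 1 2
  choose g hG hg using fun i => hE.exists_swap hL 3 (4 + i)
  set F := hF.toFinset with hFdef
  have hfF : ∀ a, a ∉ F → f a = a := fun a ha => by simpa [hFdef] using ha
  -- `G` contains all names moved by `f` or by one of the first `F.card` maps `g i`, as many as the
  -- pigeonhole argument below needs.
  set G := F ∪ (Finset.range F.card).biUnion fun i => (hG i).toFinset with hGdef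
  have hgG : ∀ i < F.card, ∀ a, a ∉ G → g i a = a := by
    intro i hi a ha
    by_contra h
    exact ha (Finset.mem_union_right _ (Finset.mem_biUnion.2
      ⟨i, Finset.mem_range.2 hi, by simpa using h⟩))
  -- The table of the messages over `G` that are offered at index `n`. There are finitely many
  -- tables, so two indices share one; this settles all messages with names in `G`.
  let φ : ℕ → ι × Option G × Option G → Prop := fun n p =>
    Offers nm (E.enc (X p.1 1 3 n)).1 {⟨p.2.1.map Subtype.val, [p.2.2.map Subtype.val]⟩}
  obtain ⟨n, n', hn, hφ⟩ := Finite.exists_ne_map_eq_of_infinite φ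
  refine ⟨n, n', F.card, hn, fun x o ho => ?_⟩
  obtain ⟨hD, t, ht, hnm⟩ := ho.args_eq hA (E.enc (X x 1 3 n)).2 o (by simp)
  by_cases h₁ : ∀ a, o.Mem a → a ∈ G
  · left
    obtain ⟨c, ts⟩ := o
    obtain rfl : ts = [t] := ht
    have lift : ∀ c : Option Name, (∀ a, c = some a → a ∈ G) →
        ∃ c' : Option G, c'.map Subtype.val = c := by
      rintro (_ | a) h
      exacts [⟨none, rfl⟩, ⟨some ⟨a, h a rfl⟩, rfl⟩]
    obtain ⟨c, rfl⟩ := lift c fun a ha => h₁ a (Or.inl ha)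
    obtain ⟨t, rfl⟩ := lift t fun a ha => h₁ a (Or.inr (by simp [ha]))
    exact (congrFun hφ (x, c, t)).mp ho
  right
  push Not at h₁
  obtain ⟨d, hd, hdG⟩ := h₁
  have hdF : d ∉ F := fun h => hdG (Finset.mem_union_left _ h)
  -- A message that avoids `F` is fixed by `f`, so it is also offered after `1` and `2` have been
  -- swapped. That it has a name at all, namely `d`, shows that the language has channels or that
  -- `nm` holds.
  by_cases h₂ : ∀ a, o.Mem a → a ∉ F
  · left
    refine ⟨?_, ?_⟩
    · by_contra h
      push Not at h
      have hm : L₂.medium = .dataspace := by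
        cases hm : L₂.medium
        · rfl
        · exact absurd hm h.1
      rcases hd with hd | hd
      · simp [hD hm] at hd
      · simp [ht, hnm (by simpa using h.2)] at hd
    · have := offers_swap hf ho
      rwa [Shape.ren_congr (g := fun a => a) fun a ha => hfF a (h₂ a ha), Shape.ren_id, hX] at this
  push Not at h₂
  obtain ⟨e, he, heF⟩ := h₂
  have hed : e ≠ d := by rintro rfl; exact hdF heF
  -- A message has room for two names only, and `d` and `e` are different. Both positions are
  -- therefore taken, which also forces `nm`.
  have hde : ∀ a, o.Mem a → a = d ∨ a = e := by
    intro a ha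
    simp only [Shape.Mem, ht, List.mem_singleton] at hd he ha
    grind
  have hnm : nm = true := by
    by_contra h
    simp only [Shape.Mem, ht, List.mem_singleton, hnm (by simpa using h)] at hd he
    grind
  have hren : ∀ h h' : Name → Name, h d = d → h' d = d → h e = h' e → o.ren h = o.ren h' :=
    fun h h' h₁ h₂ h₃ => Shape.ren_congr fun a ha => by
      rcases hde a ha with rfl | rfl
      exacts [h₁.trans h₂.symm, h₃]
  have s₁ : ∀ i : ℕ, Equiv.swap (3 : ℕ) (4 + i) 1 = 1 := fun i =>
    Equiv.swap_apply_of_ne_of_ne (by omega) (by omega)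
  have s₂ : ∀ i : ℕ, Equiv.swap (3 : ℕ) (4 + i) 2 = 2 := fun i =>
    Equiv.swap_apply_of_ne_of_ne (by omega) (by omega)
  have s₃ : ∀ i : ℕ, Equiv.swap (1 : ℕ) 2 (4 + i) = 4 + i := fun i =>
    Equiv.swap_apply_of_ne_of_ne (by omega) (by omega)
  have s₄ : ∀ i j : ℕ, i ≠ j → Equiv.swap (3 : ℕ) (4 + j) (4 + i) = 4 + i := fun i j h =>
    Equiv.swap_apply_of_ne_of_ne (by omega) (by omega)
  have hgo : ∀ i, Offers nm (E.enc (X x 1 (4 + i) n)).1 {o.ren (g i)} := by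
    intro i
    have := offers_swap (hg i) ho
    rwa [hX, s₁, Equiv.swap_apply_left] at this
  -- Each of these `g i` fixes `d`, so only the image of `e` matters. If all `F.card` images lie in
  -- `F`, then together with `e` itself they are `F.card + 1` entries from `F`, and two of them
  -- coincide.
  by_cases h₃ : ∀ i < F.card, g i e ∈ F
  · right
    refine ⟨hnm, ?_⟩
    let c : Fin (F.card + 1) → F := Fin.cons ⟨e, heF⟩ fun i => ⟨g i e, h₃ i i.2⟩
    obtain ⟨i, j, hij, hc⟩ : ∃ i j, i ≠ j ∧ c i = c j := by
      refine Fintype.exists_ne_map_eq_of_card_lt c ?_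
      simp
    wlog hlt : i < j generalizing i j
    · exact this j i hij.symm hc.symm (lt_of_le_of_ne (not_lt.1 hlt) hij.symm)
    obtain ⟨j, rfl⟩ := Fin.exists_succ_eq.2 (Fin.ne_zero_of_lt hlt)
    rcases Fin.eq_zero_or_eq_succ i with rfl | ⟨i, rfl⟩
    · refine ⟨j, j.2, ?_⟩
      have hc : e = g j e := congrArg Subtype.val hc
      have := hgo j
      rwa [hren (g j) (fun a => a) (hgG j j.2 d hdG) rfl hc.symm, Shape.ren_id] at this
    -- Here `g i` and `g j` rename `o` in the same way. The renaming by `g j` is undone by swapping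
    -- `3` and `4 + j`, which leaves the name `4 + i` of the probe in place.
    · refine ⟨i, i.2, ?_⟩
      have hc : g i e = g j e := congrArg Subtype.val hc
      have := hgo i
      rw [hren (g i) (g j) (hgG i i.2 d hdG) (hgG j j.2 d hdG) hc] at this
      have := offers_swap_of_ren (hg j) ho this
      have hij : (i : ℕ) ≠ j := fun h => hij (by rw [Fin.ext h])
      rwa [hX, s₁, s₄ i j hij] at this
  · left
    refine ⟨Or.inr hnm, ?_⟩
    push Not at h₃
    obtain ⟨i, hi, hgi⟩ := h₃
    -- The message renamed by `g i` avoids `F`, so it survives the swap of `1` and `2`. Undoing `g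
    -- i` afterwards takes `4 + i` back to `3`.
    have := offers_swap hf (hgo i)
    rw [Shape.ren_ren, hren (fun a => f (g i a)) (g i) (by rw [hgG i hi d hdG, hfF d hdF])
      (hgG i hi d hdG) (hfF _ hgi), hX, Equiv.swap_apply_left, s₃] at this
    have := offers_swap_of_ren (hg i) ho this
    rwa [hX, s₂, Equiv.swap_apply_right] at this

end Encoding.IsValid
variable {nm : Bool}

/-! ### Encodings preserve the absence of reactions -/

theorem OffersLe.trans {n : ℕ} {P Q R : Raw} (h : OffersLe nm n P Q) (h' : OffersLe nm n Q R) :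
    OffersLe nm n P R := fun M hM hP => h' M hM (h M hM hP)

theorem OffersLe.of_alpha {n : ℕ} {P Q : Raw} (h : Alpha P Q) : OffersLe nm n P Q :=
  fun _ _ => (offers_iff_of_alpha h).1

namespace Encoding.IsValid

variable {L₁ L₂ : Lang} {E : Encoding L₁ L₂} {beq : L₂.Proc → L₂.Proc → Prop}

/-- Suppose that the translation of an inert `S` reduces. By soundness each of its derivatives
reduces in zero or more steps to a process equivalent to the translation of `S`, and by reduction
sensitivity that process can reduce again. No derivative is stuck, so the translation diverges while
`S` does not. An immediate success instead contradicts success sensitiveness. -/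
theorem not_needs_enc (hE : E.IsValid beq) (hb : L₂.IsReferenceEquivalence beq)
    (hI : L₂.matching ≠ .intensional) (hnm : L₂.matching = .nameMatching → nm = true)
    {S : L₁.Proc} (hS : ¬ Needs nm S.1 0) : ¬ Needs nm (E.enc S).1 0 := by
  intro h
  have hirr : ∀ S', ¬ S.Step S' := fun S' h => hS (needs_of_red h)
  rcases reacts_of_needs hI hnm h (E.enc S).2 with ⟨Q, hQ⟩ | ⟨Q, hQ⟩
  · have hstep : ∀ T : {T : L₂.Proc // (E.enc S).Steps T},
        ∃ T' : {T : L₂.Proc // (E.enc S).Steps T}, T.1.Step T'.1 := by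
      rintro ⟨T, hT⟩
      obtain ⟨S', hS', T', hT', hb'⟩ := hE.soundness S T hT
      have hS'' : S = S' := by
        rcases Relation.ReflTransGen.cases_head hS' with e | ⟨S₁, h₁, -⟩
        exacts [e, absurd h₁ (hirr S₁)]
      subst hS''
      obtain ⟨T'', hT''⟩ := hb.reduction_sensitive _ _ hb' ⟨⟨Q, Lang.wf_of_red hQ (E.enc S).2⟩, hQ⟩
      rcases Relation.ReflTransGen.cases_head (hT'.tail hT'') with e | ⟨T₁, h₁, -⟩
      · subst e
        rcases Relation.ReflTransGen.cases_head hT' with e | ⟨T₁, h₁, -⟩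
        · exact ⟨⟨T', hT.trans hT'⟩, e ▸ hT''⟩
        · exact ⟨⟨T₁, hT.tail h₁⟩, h₁⟩
      · exact ⟨⟨T₁, hT.tail h₁⟩, h₁⟩
    choose next hnext using hstep
    let T₀ : {T : L₂.Proc // (E.enc S).Steps T} := ⟨E.enc S, .refl⟩
    obtain ⟨f, hf₀, hf⟩ := hE.divergence_reflection S
      ⟨fun n => (next^[n] T₀).1, rfl, fun n => by
        have := hnext (next^[n] T₀)
        rwa [← Function.iterate_succ_apply' next n T₀] at this⟩
    exact hirr (f 1) (hf₀ ▸ hf 0)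
  · have hw : L₂.Wf Q := ((Lang.wf_of_struct hQ).1 (E.enc S).2).1
    exact hS (needs_of_succeeds ((hE.success_sensitiveness S).2 ⟨E.enc S, ⟨Q, hw⟩, .refl, hQ⟩))

end Encoding.IsValid

/-! ### A family of outputs and inputs -/

namespace Raw

def probeChan (γ : Medium) (a : Name) : Option Term :=
  match γ with
  | .dataspace => none
  | .channel => some (.name a)

/-- The leading `a` and `b` are what name-matches can test; the remaining `n` data only count
towards the arity `n + 2`. -/
def probeMsg (γ : Medium) (a b : Name) (n : ℕ) : Msg :=
  ⟨probeChan γ a, .name a :: .name b :: List.replicate n (.name a)⟩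

def outProbe (α : Synchronism) (γ : Medium) (a b : Name) (n : ℕ) : Raw :=
  match α with
  | .asynch => outA (probeMsg γ a b n)
  | .synch => outS (probeMsg γ a b n) nil

/-- The binding names start at `1`, which is `fresh ∅`. These are the names that `Raw.subst` itself
picks for a scope without free names, so `inProbe_subst` is an equality. -/
def bindList (n : ℕ) : List Pat := (List.range n).map fun i => .bind (1 + i)

def probePart (γ : Medium) (nm : Bool) (a b : Name) (n : ℕ) : InPart :=
  ⟨probeChan γ a, if nm then .mtch a :: .mtch b :: bindList n else bindList (n + 2)⟩

def inProbe (γ : Medium) (nm : Bool) (a b : Name) (n : ℕ) : Raw :=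
  inp [probePart γ nm a b n] ok

/-- An inert process with the given free names. -/
def pad : List Name → Raw
  | [] => nil
  | a :: l => cond (.name a) (.name a) (pad l) nil

theorem probeChan_subst (γ : Medium) (a : Name) (f : Name → Name) :
    (probeChan γ a).map (Term.subst fun c => .name (f c)) = probeChan γ (f a) := by
  cases γ <;> rfl

theorem outProbe_subst (α : Synchronism) (γ : Medium) (a b : Name) (n : ℕ) (f : Name → Name) :
    (outProbe α γ a b n).subst (fun c => .name (f c)) = outProbe α γ (f a) (f b) n := by
  have : (probeMsg γ a b n).subst (fun c => .name (f c)) = probeMsg γ (f a) (f b) n := by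
    simp [probeMsg, Msg.subst, probeChan_subst, Term.subst]
  cases α <;> simp [outProbe, Raw.subst, this]

theorem inBinders_probePart (γ : Medium) (nm : Bool) (a b : Name) (n : ℕ) :
    inBinders [probePart γ nm a b n] =
      (List.range (if nm then n else n + 2)).map fun i => 1 + i := by
  have (n : ℕ) : (bindList n).flatMap Pat.binders = (List.range n).map fun i => 1 + i := by
    simp [bindList, List.flatMap_map, Pat.binders, ← List.map_eq_flatMap]
  cases nm <;> simp [inBinders, InPart.binders, probePart, this, Pat.binders]

theorem inProbe_subst (γ : Medium) (nm : Bool) (a b : Name) (n : ℕ) (f : Name → Name) :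
    (inProbe γ nm a b n).subst (fun c => .name (f c)) = inProbe γ nm (f a) (f b) n := by
  have hidx : ∀ (k i : ℕ), i < k → ((List.range k).map fun i => 1 + i).idxOf (1 + i) = i := by
    intro k i hi
    have h := List.Nodup.idxOf_getElem (xs := (List.range k).map fun i => 1 + i)
      (List.nodup_range.map fun _ _ h => by simpa using h) i (by simpa)
    simpa using h
  have hb : ∀ k, (bindList k).map (Pat.subst (fun x => fresh ∅ +
      ((List.range k).map fun i => 1 + i).idxOf x) fun c => .name (f c)) = bindList k := by
    intro k
    simp only [bindList, List.map_map]
    refine List.map_congr_left fun i hi => ?_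
    simp only [Function.comp, Pat.subst]
    rw [hidx k i (List.mem_range.1 hi)]
    rfl
  simp only [inProbe, Raw.subst, inBinders_probePart, fn, Finset.empty_sdiff,
    Finset.biUnion_empty, List.map_cons, List.map_nil]
  cases nm
  · simp [probePart, InPart.subst, hb, probeChan_subst]
  · simp [probePart, InPart.subst, hb, probeChan_subst, Pat.subst, Term.quote]

theorem pad_fn : ∀ l : List Name, (pad l).fn = l.toFinset
  | [] => rfl
  | a :: l => by ext; simp [pad, fn, Term.names, pad_fn l]

theorem probeChan_names (γ : Medium) (a : Name) : chanNames (probeChan γ a) ⊆ {a} := by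
  cases γ <;> simp [probeChan, chanNames, Term.names]

theorem outProbe_fn (α : Synchronism) (γ : Medium) (a b : Name) (n : ℕ) :
    (outProbe α γ a b n).fn ⊆ {a, b} := by
  have : (probeMsg γ a b n).names ⊆ {a, b} := by
    intro c hc
    rw [mem_names_msg] at hc
    rcases hc with hc | ⟨t, ht, hc⟩
    · simp [Finset.mem_singleton.1 (probeChan_names γ a hc)]
    · simp only [probeMsg, List.mem_cons, List.mem_replicate] at ht
      rcases ht with rfl | rfl | ⟨-, rfl⟩ <;> simp_all [Term.names]
  cases α <;> simpa [outProbe, fn] using this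

theorem inProbe_fn (γ : Medium) (nm : Bool) (a b : Name) (n : ℕ) :
    (inProbe γ nm a b n).fn ⊆ {a, b} := by
  intro c hc
  simp only [inProbe, fn, Finset.empty_sdiff, Finset.union_empty, inFn, List.foldr_cons,
    List.foldr_nil, InPart.mem_fn] at hc
  rcases hc with hc | ⟨p, hp, hc⟩
  · simp [Finset.mem_singleton.1 (probeChan_names γ a hc)]
  · cases nm <;> simp only [probePart, bindList, if_true, Bool.false_eq_true, if_false,
      List.mem_cons, List.mem_map] at hp
    · obtain ⟨i, -, rfl⟩ := hp
      simp [Pat.fn] at hc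
    · rcases hp with rfl | rfl | ⟨i, -, rfl⟩ <;> simp_all [Pat.fn]

end Raw
-- Probes that do not match remain inert
variable {nm : Bool}

/-- `P` only offers messages from `A`, and all its inputs have a single demand, from `B`. -/
def Confined (nm : Bool) (A B : Set Shape) (P : Raw) : Prop :=
  (∀ M, Offers nm P M → ∀ o ∈ M, o ∈ A) ∧ ∀ D, Needs nm P D → ∃ d ∈ B, D = {d}

section Confined

variable {A B : Set Shape} {P Q : Raw}

/-- No demand from `B` fits a message from `A`, so parallel composition discharges nothing and every
input keeps its one open demand. -/
theorem Confined.par (h : ∀ d ∈ B, ∀ o ∈ A, ¬ Shape.Fits d o) (hP : Confined nm A B P)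
    (hQ : Confined nm A B Q) : Confined nm A B (.par P Q) := by
  have key : ∀ {P Q : Raw} {D D' M}, Confined nm A B P → Confined nm A B Q →
      Needs nm P (D + D') → Offers nm Q M → Multiset.Rel Shape.Fits D' M → ∃ d ∈ B, D = {d} := by
    intro P Q D D' M hP hQ h₁ h₂ h₃
    obtain ⟨d, hd, e⟩ := hP.2 _ h₁
    rcases Multiset.empty_or_exists_mem D' with rfl | ⟨d', hd'⟩
    · exact ⟨d, hd, by simpa using e⟩
    · have : d' ∈ ({d} : Multiset Shape) := e ▸ Multiset.mem_add.2 (Or.inr hd')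
      rw [Multiset.mem_singleton.1 this] at hd'
      obtain ⟨o, ho, hf⟩ := Multiset.exists_mem_of_rel_of_mem h₃ hd'
      exact absurd hf (h d hd o (hQ.1 _ h₂ o ho))
  constructor
  · intro M hM o ho
    obtain ⟨M₁, M₂, h₁, h₂, rfl⟩ := offers_par.1 hM
    rcases Multiset.mem_add.1 ho with ho | ho
    exacts [hP.1 _ h₁ o ho, hQ.1 _ h₂ o ho]
  · intro D hD
    rcases needs_par.1 hD with ⟨D', M, h₁, h₂, h₃⟩ | ⟨D', M, h₁, h₂, h₃⟩
    exacts [key hP hQ h₁ h₂ h₃, key hQ hP h₂ h₁ h₃]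

theorem Confined.not_needs (h : Confined nm A B P) : ¬ Needs nm P 0 := by
  intro h'
  obtain ⟨d, -, e⟩ := h.2 _ h'
  simpa using congrArg Multiset.card e

theorem confined_pad : ∀ l : List Name, Confined nm A B (Raw.pad l)
  | [] => ⟨fun M hM => by simp [offers_nil.1 hM], fun D hD => absurd hD not_needs_nil⟩
  | a :: l => ⟨fun M hM => (confined_pad l).1 M (by simpa using offers_cond.1 hM),
      fun D hD => (confined_pad l).2 D (by simpa using needs_cond.1 hD)⟩

theorem confined_outProbe {α : Synchronism} {γ : Medium} {a b : Name} {n : ℕ}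
    (h : (Raw.probeMsg γ a b n).shape nm ∈ A) : Confined nm A B (Raw.outProbe α γ a b n) := by
  cases α
  · refine ⟨fun M hM => ?_, fun D hD => absurd hD not_needs_outA⟩
    rcases offers_outA.1 hM with rfl | rfl
    exacts [by simp, by simpa using h]
  · refine ⟨fun M hM => ?_, fun D hD => absurd hD not_needs_outS⟩
    rcases offers_outS.1 hM with rfl | rfl
    exacts [by simp, by simpa using h]

theorem confined_inProbe {γ : Medium} {a b : Name} {n : ℕ}
    (h : (Raw.probePart γ nm a b n).shape nm ∈ B) : Confined nm A B (Raw.inProbe γ nm a b n) := by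
  refine ⟨fun M hM => by simp [offers_inp.1 hM], fun D hD => ?_⟩
  cases hD
  exact ⟨_, h, rfl⟩

end Confined

theorem probe_fits {γ : Medium} {a b a' b' : Name} {n n' : ℕ}
    (h : ((Raw.probePart γ nm a b n).shape nm).Fits ((Raw.probeMsg γ a' b' n').shape nm)) :
    n = n' ∧ (γ = .channel ∨ nm = true → a = a') ∧ (nm = true → b = b') := by
  obtain ⟨hc, h⟩ := h
  have hl := h.length_eq
  have hc' : γ = .channel → a = a' := by
    rintro rfl
    simpa [InPart.shape, Msg.shape, Raw.probePart, Raw.probeMsg, Raw.probeChan, Term.asName]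
      using hc
  cases nm
  · simp [InPart.shape, Msg.shape, Raw.probePart, Raw.probeMsg, Raw.bindList] at hl
    exact ⟨hl, by simpa using hc', by simp⟩
  · simp [InPart.shape, Msg.shape, Raw.probePart, Raw.probeMsg, Raw.bindList] at hl
    simp [InPart.shape, Msg.shape, Raw.probePart, Raw.probeMsg, patShape, argShape,
      Term.asName] at h
    exact ⟨hl, fun _ => h.1, fun _ => h.2.1⟩

theorem wf_outProbe {α : Synchronism} {γ : Medium} {δ : Matching} {ε : Coordination}
    (a b : Name) (n : ℕ) : Lang.Wf ⟨α, .polyadic, γ, δ, ε⟩ (Raw.outProbe α γ a b n) := by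
  have : Lang.MsgOk ⟨α, .polyadic, γ, δ, ε⟩ (Raw.probeMsg γ a b n) := by
    refine ⟨?_, by simp [Lang.ArityOk], ?_⟩
    · cases γ
      exacts [rfl, ⟨_, rfl, fun _ => ⟨_, rfl⟩⟩]
    · intro t ht _
      simp only [Raw.probeMsg, List.mem_cons, List.mem_replicate] at ht
      rcases ht with rfl | rfl | ⟨-, rfl⟩ <;> exact ⟨_, rfl⟩
  cases α
  exacts [⟨rfl, this⟩, ⟨rfl, this, trivial⟩]

theorem wf_inProbe {α : Synchronism} {γ : Medium} {δ : Matching} {ε : Coordination}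
    (hI : δ ≠ .intensional) (hnm : nm = true ↔ δ = .nameMatching)
    (a b : Name) (n : ℕ) : Lang.Wf ⟨α, .polyadic, γ, δ, ε⟩ (Raw.inProbe γ nm a b n) := by
  refine ⟨⟨by simp, by simp, ?_, ?_⟩, trivial⟩
  · simp only [List.mem_singleton, forall_eq]
    refine ⟨?_, by simp [Lang.ArityOk], ?_⟩
    · cases γ
      exacts [rfl, ⟨_, rfl, fun _ => ⟨_, rfl⟩⟩]
    · have hb : ∀ k, ∀ p ∈ Raw.bindList k, ∃ x, p = .bind x := by
        intro k p hp
        obtain ⟨i, -, rfl⟩ := List.mem_map.1 hp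
        exact ⟨_, rfl⟩
      intro p hp
      cases δ
      · have : nm = false := by simpa using hnm
        subst this
        exact hb _ p hp
      · obtain rfl : nm = true := hnm.2 rfl
        simp only [Raw.probePart, if_true, List.mem_cons] at hp
        rcases hp with rfl | rfl | hp
        exacts [Or.inr ⟨_, rfl⟩, Or.inr ⟨_, rfl⟩, Or.inl (hb _ p hp)]
      · exact absurd rfl hI
  · rw [Raw.inBinders_probePart]
    exact List.nodup_range.map fun _ _ h => by simpa using h

theorem wf_pad (L : Lang) : ∀ l : List Name, L.Wf (Raw.pad l)
  | [] => trivial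
  | _ :: l => ⟨wf_pad L l, trivial⟩

theorem polyMatch_binders : ∀ (ts : List Term) (k : ℕ), 
    ∃ σ, polyMatch ts ((List.range' k ts.length).map Pat.bind) = some σ
  | [], _ => ⟨_, rfl⟩
  | t :: ts, k => by
      obtain ⟨σ, hσ⟩ := polyMatch_binders ts (k + 1)
      exact ⟨(k, t) :: σ, by simp [List.range'_succ, polyMatch, matchTerm, hσ]⟩

theorem joinMatch_probe (γ : Medium) (nm : Bool) (a b : Name) (n : ℕ) :
    ∃ σ, joinMatch [Raw.probeMsg γ a b n] [Raw.probePart γ nm a b n] = some σ := by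
  have hb : ∀ k, Raw.bindList k = (List.range' 1 k).map Pat.bind := by
    intro k
    simp [Raw.bindList, List.range'_eq_map_range]
  have : ∃ σ, polyMatch (Raw.probeMsg γ a b n).args (Raw.probePart γ nm a b n).pats = some σ := by
    cases nm
    · have := polyMatch_binders (Raw.probeMsg γ a b n).args 1
      simpa [Raw.probePart, hb, Raw.probeMsg] using this
    · obtain ⟨σ, hσ⟩ := polyMatch_binders (List.replicate n (.name a)) 1
      rw [List.length_replicate, ← hb] at hσ
      exact ⟨σ, by simp [Raw.probeMsg, Raw.probePart, polyMatch, matchTerm, hσ]⟩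
  obtain ⟨σ, hσ⟩ := this
  exact ⟨σ, by simp [joinMatch, hσ, show (Raw.probeMsg γ a b n).chan =
    (Raw.probePart γ nm a b n).chan from rfl]⟩

theorem red_probe (L : Lang) (α : Synchronism) (γ : Medium) (nm : Bool) (a b : Name) (n : ℕ) :
    Red L (.par (Raw.outProbe α γ a b n) (Raw.inProbe γ nm a b n)) .ok := by
  obtain ⟨σ, hσ⟩ := joinMatch_probe γ nm a b n
  cases α
  · exact .commA [_] _ _ σ hσ
  · refine .struct (.refl _) (.commS [(_, .nil)] _ .ok σ hσ) ?_
    exact (Struct.par_comm _ _).trans (.par_nil _)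

/-! ### Translations of nested parallel compositions -/

variable {nm : Bool}

/-- `P | Q` as processes. -/
def Lang.Proc.par {L : Lang} (P Q : L.Proc) : L.Proc := ⟨.par P.1 Q.1, P.2, Q.2⟩

theorem Struct.par_shuffle {L : Lang} (Z P Q : Raw) :
    Struct L (.par (.par Z (.par P Z)) (.par Z (.par Q Z)))
      (.par (.par Q P) (.par (.par Z Z) (.par Z Z))) := by
  have h : ∀ P, Struct L (.par Z (.par P Z)) (.par P (.par Z Z)) := fun P => .par_left_comm ..
  refine (Struct.par (h P) (h Q)).trans ?_
  refine (Struct.par_left_comm _ _ _).trans ?_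
  refine .trans ?_ (Struct.par_assoc _ _ _)
  exact .par (.refl _) (Struct.par_assoc _ _ _).symm

theorem Ctx.offersLe_fill₂ (C : Ctx 2) {n : ℕ} {P P' Q Q' : Raw} (h : OffersLe nm n P P')
    (h' : OffersLe nm n Q Q') : OffersLe nm n (C.fill ![P, Q]) (C.fill ![P', Q']) :=
  offersLe_fill (T := ![P, Q]) (T' := ![P', Q']) (Fin.forall_fin_two.2 ⟨h, h'⟩) C

namespace Encoding.IsValid

variable {L₁ L₂ : Lang} {E : Encoding L₁ L₂} {beq : L₂.Proc → L₂.Proc → Prop}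

/-- A context that translates all parallel compositions with the free names `N`. -/
theorem exists_par_ctx (hE : E.IsValid beq) (N : Finset Name) :
    ∃ C : Ctx 2, (∀ j, C.holes.count j ≤ 1) ∧ ∀ P Q : L₁.Proc, P.1.fn ∪ Q.1.fn = N →
      Alpha (E.enc (P.par Q)).1 (C.fill ![(E.enc P).1, (E.enc Q).1]) := by
  obtain ⟨C, hC, h⟩ := hE.compositionality .par N
  refine ⟨C, fun j => (hC.1 j).le, fun P Q hN => ?_⟩
  have := h ![P, Q] ⟨P.2, Q.2⟩ (by
    rw [← hN, Finset.coe_union]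
    ext a
    simp only [Set.mem_iUnion, Set.mem_union]
    exact Fin.exists_fin_two)
  have e : (fun i : Fin 2 => (E.enc (![P, Q] i)).1) = ![(E.enc P).1, (E.enc Q).1] := by
    funext i
    fin_cases i <;> rfl
  exact e ▸ this

variable {C : Ctx 2} {N : Finset Name} {Z : L₁.Proc}

/-- The context provided by compositionality depends on the set of free names. Padding with `Z`
keeps this set equal to `N` at every level, so a single context serves for the whole nest. -/
theorem fn_foldr_par (hZ : Z.1.fn = N) : ∀ Ps : List L₁.Proc, (∀ P ∈ Ps, P.1.fn ⊆ N) →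
    (Ps.foldr Lang.Proc.par (Z.par Z)).1.fn = N
  | [], _ => by
      change Z.1.fn ∪ Z.1.fn = N
      rw [hZ, Finset.union_self]
  | P :: Ps, h => by
      have ih := fn_foldr_par hZ Ps fun Q hQ => h Q (List.mem_cons_of_mem _ hQ)
      change P.1.fn ∪ _ = N
      rw [ih, Finset.union_eq_right]
      exact h P List.mem_cons_self

theorem foldr_fill_offersLe (hC : ∀ P Q : L₁.Proc, P.1.fn ∪ Q.1.fn = N →
      Alpha (E.enc (P.par Q)).1 (C.fill ![(E.enc P).1, (E.enc Q).1])) (hZ : Z.1.fn = N) (t : ℕ) :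
    ∀ Ps : List L₁.Proc, (∀ P ∈ Ps, P.1.fn ⊆ N) →
      OffersLe nm t ((Ps.map fun P => (E.enc P).1).foldr (fun P Y => C.fill ![P, Y])
        (C.fill ![(E.enc Z).1, (E.enc Z).1]))
        (E.enc (Ps.foldr Lang.Proc.par (Z.par Z))).1
  | [], _ => .of_alpha (hC Z Z (by simp [hZ])).symm
  | P :: Ps, h => by
      have h' := fun Q hQ => h Q (List.mem_cons_of_mem P hQ)
      have ih := foldr_fill_offersLe hC hZ t Ps h'
      refine OffersLe.trans ?_ (.of_alpha (hC P _ ?_).symm)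
      · exact C.offersLe_fill₂ (.refl _ _) ih
      · rw [fn_foldr_par hZ Ps h', Finset.union_eq_right]
        exact h P List.mem_cons_self

/-- Both translations unfold, level by level, to nestings of the same context, where
`Ctx.offersLe_nested` applies. -/
theorem offersLe_enc_nested (hC : ∀ P Q : L₁.Proc, P.1.fn ∪ Q.1.fn = N →
      Alpha (E.enc (P.par Q)).1 (C.fill ![(E.enc P).1, (E.enc Q).1])) (hZ : Z.1.fn = N)
    (hl : ∀ j, C.holes.count j ≤ 1) {X : L₁.Proc} {Ps : List L₁.Proc} (hX : X.1.fn ⊆ N)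
    (hPs : ∀ P ∈ Ps, P.1.fn ⊆ N)
    (h : ∀ o, Offers nm (E.enc X).1 {o} → ∃ P ∈ Ps, Offers nm (E.enc P).1 {o}) (t : ℕ) :
    OffersLe nm t (E.enc (Z.par (X.par Z))).1
      (E.enc (Z.par ((List.replicate t Ps).flatten.foldr Lang.Proc.par (Z.par Z)))).1 := by
  have hPs' : ∀ P ∈ (List.replicate t Ps).flatten, P.1.fn ⊆ N := by
    intro P hP
    obtain ⟨l, hl, hP⟩ := List.mem_flatten.1 hP
    exact hPs P (List.eq_of_mem_replicate hl ▸ hP)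
  have hXZ : (X.par Z).1.fn = N := by
    change X.1.fn ∪ Z.1.fn = N
    rw [hZ, Finset.union_eq_right]
    exact hX
  refine (OffersLe.of_alpha (hC Z _ (by rw [hXZ, hZ, Finset.union_self]))).trans ?_
  refine OffersLe.trans ?_ (.of_alpha (hC Z _
    (by rw [fn_foldr_par hZ _ hPs', hZ, Finset.union_self])).symm)
  refine (C.offersLe_fill₂ (.refl _ _) (.of_alpha (hC X Z hXZ))).trans ?_
  refine (Ctx.offersLe_nested C hl _ _ (Ps.map fun P => (E.enc P).1) ?_ t).trans ?_
  · intro o ho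
    obtain ⟨P, hP, hPo⟩ := h o ho
    exact ⟨_, List.mem_map_of_mem hP, hPo⟩
  · refine C.offersLe_fill₂ (.refl _ _) ?_
    have := foldr_fill_offersLe (nm := nm) hC hZ t _ hPs'
    simpa [List.map_flatten, List.map_replicate] using this

end Encoding.IsValid

theorem confined_nested {L : Lang} {A B : Set Shape} (h : ∀ d ∈ B, ∀ o ∈ A, ¬ Shape.Fits d o)
    {Z : L.Proc} (hZ : Confined nm A B Z.1) {Ps : List L.Proc}
    (hPs : ∀ P ∈ Ps, Confined nm A B P.1) (t : ℕ) :
    Confined nm A B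
      (Z.par ((List.replicate t Ps).flatten.foldr Lang.Proc.par (Z.par Z))).1 := by
  refine hZ.par h ?_
  have : ∀ Ps : List L.Proc, (∀ P ∈ Ps, Confined nm A B P.1) →
      Confined nm A B (Ps.foldr Lang.Proc.par (Z.par Z)).1 := by
    intro Ps hPs
    induction Ps with
    | nil => exact hZ.par h hZ
    | cons P Ps ih =>
        exact (hPs P List.mem_cons_self).par h
          (ih fun Q hQ => hPs Q (List.mem_cons_of_mem _ hQ))
  refine this _ fun P hP => ?_
  obtain ⟨l, hl, hP⟩ := List.mem_flatten.1 hP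
  exact hPs P (List.eq_of_mem_replicate hl ▸ hP)

/-- Without intensionality, joining does not help to encode polyadic data. -/
theorem not_validlyEncodable_of_ne_intensional {α : Synchronism} {γ : Medium} {δ : Matching}
    {ε : Coordination} (hI : δ ≠ .intensional)
    {beq : Lang.Proc ⟨α, .monadic, γ, δ, .joining⟩ → Lang.Proc ⟨α, .monadic, γ, δ, .joining⟩ → Prop}
    (hb : Lang.IsReferenceEquivalence ⟨α, .monadic, γ, δ, .joining⟩ beq) :
    ¬ ValidlyEncodable ⟨α, .polyadic, γ, δ, ε⟩ ⟨α, .monadic, γ, δ, .joining⟩ beq := by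
  rintro ⟨E, hE⟩
  obtain ⟨nm, hnm⟩ : ∃ nm : Bool, nm = true ↔ δ = .nameMatching := by
    cases δ
    exacts [⟨false, by simp⟩, ⟨true, by simp⟩, absurd rfl hI]
  let X : Bool → Name → Name → ℕ → Lang.Proc ⟨α, .polyadic, γ, δ, ε⟩ := fun x a b n =>
    if x then ⟨_, wf_inProbe hI hnm a b n⟩ else ⟨_, wf_outProbe a b n⟩
  have hX : ∀ x u v a b n, (swapSubst _ u v).app (X x a b n) =
      X x (Equiv.swap u v a) (Equiv.swap u v b) n := by
    intro x u v a b n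
    cases x
    exacts [Subtype.ext (Raw.outProbe_subst ..), Subtype.ext (Raw.inProbe_subst ..)]
  -- `ys` lists the parameters of the probes that take over the messages of the probe `(1, 3, n)`.
  -- Each entry differs from it in the arity or in a name that the language can compare, and `m`
  -- bounds all their names.
  obtain ⟨n, ys, m, hys, hN, hshare⟩ : ∃ (n : ℕ) (ys : List (ℕ × ℕ × ℕ)) (m : ℕ),
      (∀ y ∈ ys, n ≠ y.2.2 ∨ (γ = .channel ∨ nm = true) ∧ 1 ≠ y.1 ∨ nm = true ∧ 3 ≠ y.2.1) ∧
      (∀ y ∈ ys, y.1 < m ∧ y.2.1 < m) ∧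
      ∀ x o, Offers nm (E.enc (X x 1 3 n)).1 {o} →
        ∃ y ∈ ys, Offers nm (E.enc (X x y.1 y.2.1 y.2.2)).1 {o} := by
    classical
    obtain ⟨n, n', m, hn, h⟩ := hE.exists_sharing (nm := nm) hI rfl X hX
    refine ⟨n, (1, 3, n') :: ((if γ = .channel ∨ nm = true then [(2, 3, n)] else []) ++
      (if nm = true then (List.range m).map fun i => (1, 4 + i, n) else [])), m + 4, ?_, ?_, ?_⟩
    · intro y hy
      simp only [List.mem_cons, List.mem_append] at hy
      rcases hy with rfl | hy | hy
      · exact Or.inl hn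
      · split_ifs at hy with hc
        · rw [List.mem_singleton.1 hy]
          exact Or.inr (Or.inl ⟨hc, by simp⟩)
        · simp at hy
      · split_ifs at hy with hc
        · obtain ⟨i, -, rfl⟩ := List.mem_map.1 hy
          exact Or.inr (Or.inr ⟨hc, by change 3 ≠ 4 + i; omega⟩)
        · simp at hy
    · intro y hy
      simp only [List.mem_cons, List.mem_append] at hy
      rcases hy with rfl | hy | hy
      · simp only; omega
      · split_ifs at hy with hc
        · rw [List.mem_singleton.1 hy]
          simp only; omega
        · simp at hy
      · split_ifs at hy with hc
        · obtain ⟨i, hi, rfl⟩ := List.mem_map.1 hy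
          have := List.mem_range.1 hi
          simp only; omega
        · simp at hy
    · intro x o ho
      rcases h x o ho with h | ⟨hc, h⟩ | ⟨hc, i, hi, h⟩
      · exact ⟨(1, 3, n'), by simp, h⟩
      · exact ⟨(2, 3, n), by simp [hc], h⟩
      · exact ⟨(1, 4 + i, n), by simp [hc, hi], h⟩
  -- The padding mentions every name of every probe in play, including `1` and `3`.
  set l := List.range (max m 4)
  let Z : Lang.Proc ⟨α, .polyadic, γ, δ, ε⟩ := ⟨_, wf_pad _ l⟩
  have hZ : Z.1.fn = l.toFinset := Raw.pad_fn l
  have hXN : ∀ x (a b n : ℕ), a < max m 4 → b < max m 4 → (X x a b n).1.fn ⊆ l.toFinset := by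
    intro x a b n ha hb
    have : ({a, b} : Finset Name) ⊆ l.toFinset := by
      intro c hc
      rcases Finset.mem_insert.1 hc with rfl | hc
      · simpa [l] using ha
      · rw [Finset.mem_singleton.1 hc]
        simpa [l] using hb
    cases x
    exacts [(Raw.outProbe_fn ..).trans this, (Raw.inProbe_fn ..).trans this]
  obtain ⟨C, hl, hC⟩ := hE.exists_par_ctx l.toFinset
  let Ps : Bool → List (Lang.Proc ⟨α, .polyadic, γ, δ, ε⟩) := fun x =>
    ys.map fun y => X x y.1 y.2.1 y.2.2
  have hPs : ∀ x, ∀ P ∈ Ps x, P.1.fn ⊆ l.toFinset := by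
    intro x P hP
    obtain ⟨y, hy, rfl⟩ := List.mem_map.1 hP
    exact hXN x _ _ _ (by have := hN y hy; omega) (by have := hN y hy; omega)
  have hX₀ : ∀ x, (X x 1 3 n).1.fn ⊆ l.toFinset := fun x =>
    hXN x _ _ _ (by omega) (by omega)
  -- `R x` contains the probe `(1, 3, n)`, an input or an output according to `x`. `R' t x` contains
  -- `t` copies of all the substitutes from `ys` in its place.
  let R : Bool → Lang.Proc ⟨α, .polyadic, γ, δ, ε⟩ := fun x => Z.par ((X x 1 3 n).par Z)
  let R' : ℕ → Bool → Lang.Proc ⟨α, .polyadic, γ, δ, ε⟩ := fun t x =>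
    Z.par ((List.replicate t (Ps x)).flatten.foldr Lang.Proc.par (Z.par Z))
  have hle : ∀ t x, OffersLe nm t (E.enc (R x)).1 (E.enc (R' t x)).1 := fun t x =>
    Encoding.IsValid.offersLe_enc_nested hC hZ hl (hX₀ x) (hPs x) (fun o ho => by
      obtain ⟨y, hy, h⟩ := hshare x o ho
      exact ⟨_, List.mem_map_of_mem hy, h⟩) t
  have hZX : ∀ x, ((X x 1 3 n).par Z).1.fn = l.toFinset := by
    intro x
    change (X x 1 3 n).1.fn ∪ Z.1.fn = _
    rw [hZ, Finset.union_eq_right]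
    exact hX₀ x
  have hR : ∀ x, (R x).1.fn = l.toFinset := by
    intro x
    change Z.1.fn ∪ ((X x 1 3 n).par Z).1.fn = _
    rw [hZX, hZ, Finset.union_self]
  have hR' : ∀ t x, (R' t x).1.fn = l.toFinset := by
    intro t x
    change Z.1.fn ∪ Raw.fn (Subtype.val _) = _
    rw [Encoding.IsValid.fn_foldr_par hZ, hZ, Finset.union_self]
    intro P hP
    obtain ⟨l, hl, hP⟩ := List.mem_flatten.1 hP
    exact hPs x P (List.eq_of_mem_replicate hl ▸ hP)
  have hmis : ∀ y ∈ ys, ¬ ((Raw.probePart γ nm 1 3 n).shape nm).Fits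
        ((Raw.probeMsg γ y.1 y.2.1 y.2.2).shape nm) ∧
      ¬ ((Raw.probePart γ nm y.1 y.2.1 y.2.2).shape nm).Fits
        ((Raw.probeMsg γ 1 3 n).shape nm) := by
    intro y hy
    refine ⟨fun h => ?_, fun h => ?_⟩ <;> obtain ⟨h₁, h₂, h₃⟩ := probe_fits h <;>
      rcases hys y hy with h | ⟨hc, h⟩ | ⟨hc, h⟩
    exacts [h h₁, h (h₂ hc), h (h₃ hc), h h₁.symm, h (h₂ hc).symm, h (h₃ hc).symm]
  have hin : ∀ {A B : Set Shape} (a b : Name) (n : ℕ),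
      (Raw.probePart γ nm a b n).shape nm ∈ B → Confined nm A B (X true a b n).1 :=
    fun _ _ _ => confined_inProbe
  have hout : ∀ {A B : Set Shape} (a b : Name) (n : ℕ),
      (Raw.probeMsg γ a b n).shape nm ∈ A → Confined nm A B (X false a b n).1 :=
    fun _ _ _ => confined_outProbe
  have h₁ : ∀ t, ¬ Needs nm (E.enc ((R true).par (R' t false))).1 0 := by
    intro t
    refine hE.not_needs_enc hb hI hnm.2 ?_
    let B : Set Shape := {(Raw.probePart γ nm 1 3 n).shape nm}
    let A : Set Shape := {o | ∃ y ∈ ys, o = (Raw.probeMsg γ y.1 y.2.1 y.2.2).shape nm}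
    have h : ∀ d ∈ B, ∀ o ∈ A, ¬ Shape.Fits d o := by
      rintro _ rfl _ ⟨y, hy, rfl⟩
      exact (hmis y hy).1
    refine Confined.not_needs (A := A) (B := B) (.par h ?_ ?_)
    · exact .par h (confined_pad l) (.par h (hin _ _ _ rfl) (confined_pad l))
    · refine confined_nested h (confined_pad l) (fun P hP => ?_) t
      obtain ⟨y, hy, rfl⟩ := List.mem_map.1 hP
      exact hout _ _ _ ⟨y, hy, rfl⟩
  have h₂ : ∀ t, ¬ Needs nm (E.enc ((R' t true).par (R false))).1 0 := by
    intro t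
    refine hE.not_needs_enc hb hI hnm.2 ?_
    let B : Set Shape := {o | ∃ y ∈ ys, o = (Raw.probePart γ nm y.1 y.2.1 y.2.2).shape nm}
    let A : Set Shape := {(Raw.probeMsg γ 1 3 n).shape nm}
    have h : ∀ d ∈ B, ∀ o ∈ A, ¬ Shape.Fits d o := by
      rintro _ ⟨y, hy, rfl⟩ _ rfl
      exact (hmis y hy).2
    refine Confined.not_needs (A := A) (B := B) (.par h ?_ ?_)
    · refine confined_nested h (confined_pad l) (fun P hP => ?_) t
      obtain ⟨y, hy, rfl⟩ := List.mem_map.1 hP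
      exact hin _ _ _ ⟨y, hy, rfl⟩
    · exact .par h (confined_pad l) (.par h (hout _ _ _ rfl) (confined_pad l))
  -- The two original probes match and reduce to a success, so the translation succeeds as well.
  have hneeds : Needs nm (E.enc ((R true).par (R false))).1 0 := by
    refine needs_of_succeeds ((hE.success_sensitiveness _).1 ?_)
    have hred : Red ⟨α, .polyadic, γ, δ, ε⟩ ((R true).par (R false)).1
        (.par .ok (.par (.par Z.1 Z.1) (.par Z.1 Z.1))) :=
      .struct (Struct.par_shuffle Z.1 (X true 1 3 n).1 (X false 1 3 n).1)
        (.par _ (red_probe _ _ _ _ _ _ _)) (.refl _)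
    exact ⟨⟨_, Lang.wf_of_red hred ((R true).par (R false)).2⟩, (Z.par Z).par (Z.par Z),
      .single hred, .par_comm _ _⟩
  rw [needs_iff_of_alpha (hC _ _ (by rw [hR, hR, Finset.union_self]))] at hneeds
  -- Hole `i` holds the input that reacts, if any hole does, and at most `t` messages are drawn at a
  -- time. The other hole may thus be refilled with its `R' t`, which makes an inert source react.
  obtain ⟨t, i, h⟩ := Ctx.needs_fill C hneeds
  rcases Fin.exists_fin_two.1 ⟨i, rfl⟩ with rfl | rfl
  · refine h₁ t ((needs_iff_of_alpha (hC _ _ (by rw [hR, hR', Finset.union_self]))).2 ?_)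
    exact h _ rfl (Fin.forall_fin_two.2 ⟨.refl _ _, hle t false⟩)
  · refine h₂ t ((needs_iff_of_alpha (hC _ _ (by rw [hR, hR', Finset.union_self]))).2 ?_)
    exact h _ rfl (Fin.forall_fin_two.2 ⟨hle t true, .refl _ _⟩)

/-! ### Substitution up to alpha-equivalence -/

namespace Raw

/-- `σ`, except that the names `xs` are renamed by `ρ`. -/
def bindAs (ρ : Name → Name) (xs : List Name) (σ : Name → Term) (c : Name) : Term :=
  if c ∈ xs then .name (ρ c) else σ c

section bindAs

variable {ρ : Name → Name} {σ : Name → Term} {P : Raw} {xs : List Name}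

/-- Since the new binding names avoid the images of the other free names, they remove nothing from
the set on which the picked name depends. -/
theorem pick_bindAs (h : ∀ c ∈ P.fn, c ∉ xs → ∀ x ∈ xs, ρ x ∉ (σ c).names) :
    pick .name (P.subst (bindAs ρ xs σ)) (xs.map ρ) = pick σ P xs := by
  unfold pick
  congr 1
  ext b
  simp only [Finset.mem_biUnion, Finset.mem_sdiff, List.mem_toFinset, mem_fn_subst, Term.names,
    Finset.mem_singleton, exists_eq_right']
  constructor
  · rintro ⟨⟨c, hc, hb⟩, hx⟩
    by_cases hcx : c ∈ xs
    · simp only [bindAs, hcx, if_true, Term.names, Finset.mem_singleton] at hb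
      exact absurd (List.mem_map.2 ⟨c, hcx, hb.symm⟩) hx
    · exact ⟨c, ⟨hc, hcx⟩, by simpa [bindAs, hcx] using hb⟩
  · rintro ⟨c, ⟨hc, hcx⟩, hb⟩
    refine ⟨⟨c, hc, by simpa [bindAs, hcx] using hb⟩, fun hx => ?_⟩
    obtain ⟨x, hx', rfl⟩ := List.mem_map.1 hx
    exact h c hc hcx x hx' hb

theorem under_bindAs (hρ : Set.InjOn ρ {x | x ∈ xs})
    (h : ∀ c ∈ P.fn, c ∉ xs → ∀ x ∈ xs, ρ x ∉ (σ c).names) : ∀ c ∈ P.fn,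
    (bindAs ρ xs σ c).subst (under .name (P.subst (bindAs ρ xs σ)) (xs.map ρ)) =
      under σ P xs c := by
  intro c hc
  by_cases hx : c ∈ xs
  · have : ρ c ∈ xs.map ρ := List.mem_map.2 ⟨c, hx, rfl⟩
    simp only [under, bindAs, hx, if_true, Term.subst, this]
    rw [List.idxOf_map_of_injOn fun y hy e => hρ hx hy e]
    exact congrArg (fun n => Term.name (n + xs.idxOf c)) (pick_bindAs h)
  · simp only [under, bindAs, hx, if_false]
    refine (Term.subst_congr fun d hd => ?_).trans (Term.subst_name _)
    refine if_neg fun hd' => ?_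
    obtain ⟨x, hx', rfl⟩ := List.mem_map.1 hd'
    exact h c hc hx x hx' hd

/-- The binding names may be renamed in any way that avoids captures. -/
theorem alpha_subst_inp {I : List InPart} (hρ : Set.InjOn ρ {x | x ∈ inBinders I})
    (h : ∀ c ∈ P.fn, c ∉ inBinders I → ∀ x ∈ inBinders I, ρ x ∉ (σ c).names) :
    Alpha ((inp I P).subst σ)
      (inp (I.map (InPart.subst ρ σ)) (P.subst (bindAs ρ (inBinders I) σ))) := by
  rw [alpha_iff, subst_subst, subst_inp, subst_inp, Lang.inBinders_subst, pick_bindAs h,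
    subst_subst, subst_congr (under_bindAs hρ h), inPart_subst_subst]
  simp only [Term.subst_name]
  congr 1
  refine inPart_subst_congr (fun x hx => ?_) fun _ _ => rfl
  rw [List.idxOf_map_of_injOn fun y hy e => hρ hx hy e]

theorem alpha_subst_res {a b : Name}
    (h : ∀ c ∈ P.fn, c ≠ a → b ∉ (σ c).names) :
    Alpha ((res a P).subst σ) (res b (P.subst (bindAs (fun _ => b) [a] σ))) := by
  have h' : ∀ c ∈ P.fn, c ∉ [a] → ∀ x ∈ [a], (fun _ => b) x ∉ (σ c).names :=
    fun c hc hca _ _ => h c hc (by simpa using hca)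
  have hρ : Set.InjOn (fun _ : Name => b) {x | x ∈ [a]} := by
    intro x hx y hy _
    rw [Set.mem_ofPred_eq, List.mem_singleton] at hx hy
    rw [hx, hy]
  have h₁ := pick_bindAs h'
  have h₂ := under_bindAs hρ h'
  simp only [List.map_cons, List.map_nil] at h₁ h₂
  rw [alpha_iff, subst_subst, subst_res, subst_res, h₁, subst_subst, subst_congr h₂]
  simp only [Term.subst_name]

end bindAs

theorem alpha_perm {P Q : Raw} (h : Alpha P Q) (π : Equiv.Perm Name) :
    Alpha (P.perm π) (Q.perm π) := by
  rw [alpha_iff, perm_subst, perm_subst, subst_eq_of_alpha h]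

end Raw

/-! ### Reduction is equivariant -/

theorem Struct.perm {L : Lang} {P Q : Raw} (h : Struct L P Q) (π : Equiv.Perm Name) :
    Struct L (P.perm π) (Q.perm π) := by
  induction h with
  | refl => exact .refl _
  | symm _ ih => exact ih.symm
  | trans _ _ ih ih' => exact ih.trans ih'
  | alpha h => exact .alpha (Raw.alpha_perm h π)
  | par_nil => exact .par_nil _
  | par_comm => exact .par_comm _ _
  | par_assoc => exact .par_assoc _ _ _
  | cond_eq s t P Q h hQ => exact .cond_eq _ _ _ _ (h ▸ rfl) (Lang.wf_perm.2 hQ)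
  | cond_ne s t P Q h hP =>
      exact .cond_ne _ _ _ _ (fun e => h (Term.rename_injective π.injective e)) (Lang.wf_perm.2 hP)
  | res_nil => exact .res_nil _
  | res_comm => exact .res_comm _ _ _
  | extrude a P Q h =>
      refine .extrude _ _ _ fun h' => ?_
      obtain ⟨c, hc, e⟩ := Raw.mem_fn_perm.1 h'
      exact h (π.injective e ▸ hc)
  | rep_unfold => exact .rep_unfold _
  | par _ _ ih ih' => exact .par ih ih'
  | res a _ ih => exact .res _ ih

/-! ### Matching commutes with injective renamings -/

section Match

variable {f g : Name → Name}

/-- Rename the binding names by `f` and the names of the terms by `g`. -/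
def renamePairs (f g : Name → Name) (σ : List (Name × Term)) : List (Name × Term) :=
  σ.map fun x => (f x.1, x.2.rename g)

theorem matchTerm_rename (hg : Function.Injective g) : ∀ (t : Term) (p : Pat),
    matchTerm (t.rename g) (p.map f g) = (matchTerm t p).map (renamePairs f g)
  | t, .bind x => by cases t <;> rfl
  | .name a, .mtch b => by
      by_cases h : a = b
      · simp [matchTerm, Term.rename, Term.subst, Pat.map, h, renamePairs]
      · simp [matchTerm, Term.rename, Term.subst, Pat.map, h, hg.ne h]
  | .comp s t, .comp p q => by
      have h₁ := matchTerm_rename hg s p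
      have h₂ := matchTerm_rename hg t q
      simp only [Term.rename] at h₁ h₂
      simp only [matchTerm, Term.rename, Term.subst, Pat.map, h₁, h₂]
      cases matchTerm s p <;> cases matchTerm t q <;> simp [renamePairs]
  | .name _, .comp _ _ => rfl
  | .comp _ _, .mtch _ => rfl

theorem polyMatch_rename (hg : Function.Injective g) : ∀ (ts : List Term) (ps : List Pat),
    polyMatch (ts.map (Term.rename g)) (ps.map (Pat.map f g)) =
      (polyMatch ts ps).map (renamePairs f g)
  | [], [] => rfl
  | t :: ts, p :: ps => by
      simp only [List.map_cons, polyMatch, matchTerm_rename hg, polyMatch_rename hg ts ps]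
      cases matchTerm t p <;> cases polyMatch ts ps <;> simp [renamePairs]
  | [], _ :: _ => rfl
  | _ :: _, [] => rfl

theorem chan_rename_eq_iff (hg : Function.Injective g) {c d : Option Term} :
    c.map (Term.rename g) = d.map (Term.rename g) ↔ c = d :=
  (Option.map_injective (Term.rename_injective hg)).eq_iff

theorem joinMatch_rename (hg : Function.Injective g) : ∀ (ms : List Msg) (I : List InPart),
    joinMatch (ms.map (Msg.subst fun a => .name (g a))) (I.map (InPart.map f g)) =
      (joinMatch ms I).map (renamePairs f g)
  | [], [] => rfl
  | m :: ms, i :: I => by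
      have h := polyMatch_rename (f := f) hg m.args i.pats
      simp only [List.map_cons, joinMatch, joinMatch_rename hg ms I]
      change (if m.chan.map (Term.rename g) = i.chan.map (Term.rename g) then
        (polyMatch (m.args.map (Term.rename g)) (i.pats.map (Pat.map f g))).bind _ else _) = _
      rw [h]
      simp only [chan_rename_eq_iff hg]
      split_ifs
      · cases polyMatch m.args i.pats <;> cases joinMatch ms I <;> simp [renamePairs]
      · rfl
  | [], _ :: _ => rfl
  | _ :: _, [] => rfl

theorem listSubst_renamePairs (hf : Function.Injective f) (x : Name) :
    ∀ σ : List (Name × Term), listSubst (renamePairs f f σ) (f x) = (listSubst σ x).rename f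
  | [] => rfl
  | (y, t) :: σ => by
      have ih := listSubst_renamePairs hf x σ
      simp only [listSubst, renamePairs, List.map_cons, List.lookup_cons] at ih ⊢
      by_cases h : x = y
      · simp [h]
      · simpa [beq_eq_false_iff_ne.2 h, beq_eq_false_iff_ne.2 (hf.ne h)] using ih

end Match

theorem Raw.perm_foldr {β : Type} (π : Equiv.Perm Name) (F F' : β → Raw)
    (h : ∀ b, (F b).perm π = F' b) (bs : List β) (R : Raw) :
    (bs.foldr (fun b R => .par (F b) R) R).perm π =
      bs.foldr (fun b R => .par (F' b) R) (R.perm π) := by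
  induction bs with
  | nil => rfl
  | cons b bs ih => simp only [List.foldr_cons, Raw.perm, ih, h]

theorem Struct.foldr {L : Lang} {β : Type} {F F' : β → Raw} (bs : List β)
    (h : ∀ b ∈ bs, Struct L (F b) (F' b)) {R R' : Raw} (hR : Struct L R R') :
    Struct L (bs.foldr (fun b R => .par (F b) R) R) (bs.foldr (fun b R => .par (F' b) R) R') := by
  induction bs with
  | nil => exact hR
  | cons b bs ih =>
      exact .par (h b List.mem_cons_self) (ih fun b' hb => h b' (List.mem_cons_of_mem _ hb))

theorem Red.perm {L : Lang} {P Q : Raw} (h : Red L P Q) (π : Equiv.Perm Name) :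
    Red L (P.perm π) (Q.perm π) := by
  -- The two contracta agree only up to alpha-equivalence, because the permutation moves the binders
  -- that the substitution has picked.
  have key : ∀ (Q : Raw) (σ : List (Name × Term)), Alpha
      ((Q.perm π).subst (listSubst (renamePairs π π σ))) ((Q.subst (listSubst σ)).perm π) := by
    intro Q σ
    refine .trans ?_ (Raw.alpha_perm_subst _ π).symm
    rw [Raw.perm_subst, Raw.subst_subst]
    simp only [listSubst_renamePairs π.injective]
    exact .refl _
  induction h with
  | commA ms I Q σ h =>
      have h' := joinMatch_rename (f := π) π.injective ms I
      rw [h] at h'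
      rw [Raw.perm_foldr π _ (fun m => .outA (m.subst fun a => .name (π a))) fun _ => rfl]
      have := Red.commA (L := L) _ _ (Q.perm π) _ h'
      rw [List.foldr_map] at this
      exact .struct (.refl _) this (.alpha (key Q σ))
  | commS ms I Q σ h =>
      have h' := joinMatch_rename (f := π) π.injective (ms.map Prod.fst) I
      rw [h] at h'
      rw [Raw.perm_foldr π _ (fun m => .outS (m.1.subst fun a => .name (π a)) (m.2.perm π))
        fun _ => rfl, Raw.perm_foldr π _ (fun m => m.2.perm π) fun _ => rfl]
      have := Red.commS (L := L) (ms.map fun m => (m.1.subst fun a => .name (π a), m.2.perm π))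
        _ (Q.perm π) _ (by rw [List.map_map] at h' ⊢; exact h')
      rw [List.foldr_map, List.foldr_map] at this
      exact .struct (.refl _) this (Struct.foldr ms (fun _ _ => .refl _) (.alpha (key Q σ)))
  | par Q _ ih => exact .par _ ih
  | res a _ ih => exact .res _ ih
  | struct h₁ _ h₂ ih => exact .struct (h₁.perm π) ih (h₂.perm π)

/-! ### Encoding polyadic data as terms

The name `0` terminates the encoding of a list; all other names are shifted by one. -/

def Term.pack : List Term → Term
  | [] => .name 0
  | t :: ts => .comp (t.rename Nat.succ) (pack ts)

def Pat.pack : List Pat → Pat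
  | [] => .mtch 0
  | p :: ps => .comp (p.map Nat.succ Nat.succ) (pack ps)

def Msg.enc (m : Msg) : Msg := ⟨m.chan.map (Term.rename Nat.succ), [Term.pack m.args]⟩

def InPart.enc (i : InPart) : InPart := ⟨i.chan.map (Term.rename Nat.succ), [Pat.pack i.pats]⟩

def Raw.enc : Raw → Raw
  | nil => nil
  | ok => ok
  | outA m => outA m.enc
  | outS m P => outS m.enc P.enc
  | inp I P => inp (I.map InPart.enc) P.enc
  | res a P => res (a + 1) P.enc
  | par P Q => par P.enc Q.enc
  | cond s t P Q => cond (s.rename Nat.succ) (t.rename Nat.succ) P.enc Q.enc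
  | rep P => rep P.enc

/-- The substitution on shifted names. -/
def shiftSubst (σ : Name → Term) : Name → Term
  | 0 => .name 0
  | a + 1 => (σ a).rename Nat.succ

def shiftName (ρ : Name → Name) : Name → Name
  | 0 => 0
  | a + 1 => ρ a + 1

theorem Term.rename_subst (σ : Name → Term) (t : Term) :
    (t.subst σ).rename Nat.succ = (t.rename Nat.succ).subst (shiftSubst σ) := by
  rw [rename, rename, subst_subst, subst_subst]
  rfl

theorem Pat.map_subst (ρ : Name → Name) (σ : Name → Term) (p : Pat) :
    (p.subst ρ σ).map Nat.succ Nat.succ =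
      (p.map Nat.succ Nat.succ).subst (shiftName ρ) (shiftSubst σ) := by
  rw [map_eq_subst, map_eq_subst, subst_subst, subst_subst]
  rfl

theorem Term.pack_subst (σ : Name → Term) : ∀ ts : List Term,
    pack (ts.map (Term.subst σ)) = (pack ts).subst (shiftSubst σ)
  | [] => rfl
  | t :: ts => by
      rw [List.map_cons, pack, pack, Term.subst, pack_subst σ ts, rename_subst]

theorem Pat.pack_subst (ρ : Name → Name) (σ : Name → Term) : ∀ ps : List Pat,
    pack (ps.map (Pat.subst ρ σ)) = (pack ps).subst (shiftName ρ) (shiftSubst σ)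
  | [] => rfl
  | p :: ps => by rw [List.map_cons, pack, pack, Pat.subst, pack_subst ρ σ ps, map_subst]

theorem chan_rename_subst (σ : Name → Term) (c : Option Term) :
    (c.map (Term.subst σ)).map (Term.rename Nat.succ) =
      (c.map (Term.rename Nat.succ)).map (Term.subst (shiftSubst σ)) := by
  cases c with
  | none => rfl
  | some t => exact congrArg some (Term.rename_subst σ t)

theorem Msg.enc_subst (σ : Name → Term) (m : Msg) :
    (m.subst σ).enc = m.enc.subst (shiftSubst σ) := by
  simp only [enc, subst, chan_rename_subst, Term.pack_subst, List.map_cons, List.map_nil]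

theorem InPart.enc_subst (ρ : Name → Name) (σ : Name → Term) (i : InPart) :
    (i.subst ρ σ).enc = i.enc.subst (shiftName ρ) (shiftSubst σ) := by
  simp only [enc, subst, chan_rename_subst, Pat.pack_subst, List.map_cons, List.map_nil]

theorem Pat.binders_map (f g : Name → Name) (p : Pat) : (p.map f g).binders = p.binders.map f := by
  rw [map_eq_subst, Lang.pat_binders_subst]

theorem Pat.binders_pack : ∀ ps : List Pat,
    (pack ps).binders = (ps.flatMap Pat.binders).map Nat.succ
  | [] => rfl
  | p :: ps => by
      rw [pack, binders, binders_map, binders_pack ps, List.flatMap_cons, List.map_append]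

theorem inBinders_enc (I : List InPart) :
    inBinders (I.map InPart.enc) = (inBinders I).map Nat.succ := by
  simp [inBinders, InPart.binders, InPart.enc, List.flatMap_map, List.map_flatMap,
    Pat.binders_pack]

theorem Term.mem_pack {b : Name} : ∀ {ts : List Term},
    b ∈ (pack ts).names ↔ b = 0 ∨ ∃ t ∈ ts, ∃ a ∈ t.names, b = a + 1
  | [] => by simp [pack, names]
  | t :: ts => by
      simp only [pack, names, Finset.mem_union, mem_pack (ts := ts), rename, mem_names_subst,
        Finset.mem_singleton, List.mem_cons, exists_eq_or_imp, Nat.succ_eq_add_one]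
      exact or_left_comm

theorem Pat.mem_pack {b : Name} : ∀ {ps : List Pat},
    b ∈ (pack ps).fn ↔ b = 0 ∨ ∃ p ∈ ps, ∃ a ∈ p.fn, b = a + 1
  | [] => by simp [pack, fn]
  | p :: ps => by
      simp only [pack, fn, Finset.mem_union, mem_pack (ps := ps), map_eq_subst, mem_fn_subst,
        Term.names, Finset.mem_singleton, List.mem_cons, exists_eq_or_imp, Nat.succ_eq_add_one]
      exact or_left_comm

theorem mem_chanNames_rename {c : Option Term} {b : Name} :
    b ∈ chanNames (c.map (Term.rename Nat.succ)) ↔ ∃ a ∈ chanNames c, b = a + 1 := by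
  have := mem_chanNames_subst (σ := fun a => .name (Nat.succ a)) (c := c) (b := b)
  simp only [Term.names, Finset.mem_singleton] at this
  exact this

theorem Msg.mem_names_enc {m : Msg} {b : Name} :
    b ∈ m.enc.names ↔ b = 0 ∨ ∃ a ∈ m.names, b = a + 1 := by
  simp only [mem_names_msg, enc, mem_chanNames_rename, List.mem_singleton, exists_eq_left,
    Term.mem_pack]
  grind

theorem InPart.mem_fn_enc {i : InPart} {b : Name} :
    b ∈ i.enc.fn ↔ b = 0 ∨ ∃ a ∈ i.fn, b = a + 1 := by
  simp only [mem_fn, enc, mem_chanNames_rename, List.mem_singleton, exists_eq_left,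
    Pat.mem_pack]
  grind

namespace Raw

theorem mem_fn_enc {b : Name} : ∀ {P : Raw}, b ∈ P.enc.fn → b = 0 ∨ ∃ a ∈ P.fn, b = a + 1
  | nil, h => by simp [enc, fn] at h
  | ok, h => by simp [enc, fn] at h
  | outA m, h => Msg.mem_names_enc.1 h
  | outS m P, h => by
      rcases Finset.mem_union.1 h with h | h
      · rcases Msg.mem_names_enc.1 h with h | ⟨a, ha, h⟩
        exacts [Or.inl h, Or.inr ⟨a, Finset.mem_union_left _ ha, h⟩]
      · rcases mem_fn_enc h with h | ⟨a, ha, h⟩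
        exacts [Or.inl h, Or.inr ⟨a, Finset.mem_union_right _ ha, h⟩]
  | inp I P, h => by
      rcases Finset.mem_union.1 h with h | h
      · obtain ⟨_, hi', h⟩ := mem_inFn.1 h
        obtain ⟨i, hi, rfl⟩ := List.mem_map.1 hi'
        rcases InPart.mem_fn_enc.1 h with h | ⟨a, ha, h⟩
        exacts [Or.inl h, Or.inr ⟨a, Finset.mem_union_left _ (mem_inFn.2 ⟨i, hi, ha⟩), h⟩]
      · rw [inBinders_enc, Finset.mem_sdiff, List.mem_toFinset] at h
        rcases mem_fn_enc h.1 with h' | ⟨a, ha, rfl⟩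
        · exact Or.inl h'
        · refine Or.inr ⟨a, Finset.mem_union_right _ (Finset.mem_sdiff.2 ⟨ha, fun h' => h.2 ?_⟩),
            rfl⟩
          exact List.mem_map.2 ⟨a, List.mem_toFinset.1 h', rfl⟩
  | res c P, h => by
      obtain ⟨h, hc⟩ := Finset.mem_sdiff.1 h
      rcases mem_fn_enc h with h | ⟨a, ha, rfl⟩
      · exact Or.inl h
      · refine Or.inr ⟨a, Finset.mem_sdiff.2 ⟨ha, fun h => hc ?_⟩, rfl⟩
        rw [Finset.mem_singleton] at h ⊢
        rw [h]
  | par P Q, h => by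
      rcases Finset.mem_union.1 h with h | h <;> rcases mem_fn_enc h with h | ⟨a, ha, h⟩
      exacts [Or.inl h, Or.inr ⟨a, Finset.mem_union_left _ ha, h⟩, Or.inl h,
        Or.inr ⟨a, Finset.mem_union_right _ ha, h⟩]
  | cond s t P Q, h => by
      simp only [enc, fn, Finset.mem_union, Term.rename, Term.mem_names_subst, Term.names,
        Finset.mem_singleton] at h ⊢
      rcases h with ((⟨a, ha, h⟩ | ⟨a, ha, h⟩) | h) | h
      · exact Or.inr ⟨a, by simp [ha], h⟩
      · exact Or.inr ⟨a, by simp [ha], h⟩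
      · rcases mem_fn_enc h with h | ⟨a, ha, h⟩
        exacts [Or.inl h, Or.inr ⟨a, by simp [ha], h⟩]
      · rcases mem_fn_enc h with h | ⟨a, ha, h⟩
        exacts [Or.inl h, Or.inr ⟨a, by simp [ha], h⟩]
  | rep P, h => mem_fn_enc (P := P) h

/-- The binders of an encoded scope are shifted. -/
theorem subst_bindAs_shift {ρ : Name → Name} {xs : List Name} {σ : Name → Term} (Q : Raw) :
    Q.subst (shiftSubst (bindAs ρ xs σ)) =
      Q.subst (bindAs (shiftName ρ) (xs.map Nat.succ) (shiftSubst σ)) := by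
  congr 1
  funext c
  cases c with
  | zero => simp [shiftSubst, bindAs]
  | succ c =>
      by_cases hc : c ∈ xs
      · simp [shiftSubst, bindAs, hc, shiftName, Term.rename, Term.subst]
      · simp [shiftSubst, bindAs, hc]

/-- Shifted binding names are positive and `0` is mapped to itself, so a terminator is never
captured. -/
theorem not_mem_shiftSubst {ρ : Name → Name} {xs : List Name} {σ : Name → Term} {P : Raw}
    (h : ∀ c ∈ P.fn, c ∉ xs → ∀ x ∈ xs, ρ x ∉ (σ c).names) :
    ∀ c ∈ P.enc.fn, c ∉ xs.map Nat.succ → ∀ x ∈ xs.map Nat.succ,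
      shiftName ρ x ∉ (shiftSubst σ c).names := by
  intro c hc hx x hxs h'
  obtain ⟨x, hxs', rfl⟩ := List.mem_map.1 hxs
  rcases mem_fn_enc hc with rfl | ⟨c, hc', rfl⟩
  · simp [shiftSubst, Term.names, shiftName] at h'
  · simp only [shiftSubst, shiftName, Term.rename, Term.mem_names_subst, Term.names,
      Finset.mem_singleton] at h'
    obtain ⟨a, ha, e⟩ := h'
    refine h c hc' (fun h => hx (List.mem_map.2 ⟨c, h, rfl⟩)) x hxs' ?_
    rwa [Nat.succ.inj e]

theorem under_eq_bindAs (σ : Name → Term) (P : Raw) (xs : List Name) :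
    under σ P xs = bindAs (fun x => pick σ P xs + xs.idxOf x) xs σ := rfl

/-- Equality would be too much to ask: the encoded scope has shifted names and possibly the free
name `0`, so the binders picked on the two sides need not coincide. -/
theorem alpha_enc_subst : ∀ (P : Raw) (σ : Name → Term),
    Alpha (P.subst σ).enc (P.enc.subst (shiftSubst σ))
  | nil, _ => by simp only [subst, enc]; exact .refl _
  | ok, _ => by simp only [subst, enc]; exact .refl _
  | outA m, _ => by simp only [subst, enc, Msg.enc_subst]; exact .refl _
  | outS m P, σ => by
      simp only [subst, enc, Msg.enc_subst]
      exact .outS _ (alpha_enc_subst P σ)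
  | inp I P, σ => by
      set xs := inBinders I with hxs
      set ρ := fun x => pick σ P xs + xs.idxOf x with hρ
      have hfresh : ∀ c ∈ P.fn, c ∉ xs → ∀ x ∈ xs, ρ x ∉ (σ c).names := fun c hc hx x _ h =>
        absurd (lt_pick hc hx h) (Nat.not_lt.2 (Nat.le_add_right _ _))
      have hI : (I.map (InPart.subst ρ σ)).map InPart.enc =
          (I.map InPart.enc).map (InPart.subst (shiftName ρ) (shiftSubst σ)) := by
        simp only [List.map_map]
        exact List.map_congr_left fun i _ => InPart.enc_subst ρ σ i
      rw [subst_inp, enc, enc, hI, under_eq_bindAs, ← hρ]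
      refine (Alpha.inp _ (alpha_enc_subst P _)).trans ?_
      rw [subst_bindAs_shift, ← inBinders_enc]
      refine (alpha_subst_inp ?_ ?_).symm
      · intro x hx y hy e
        rw [Set.mem_ofPred_eq, inBinders_enc] at hx hy
        obtain ⟨x, hx', rfl⟩ := List.mem_map.1 hx
        obtain ⟨y, hy', rfl⟩ := List.mem_map.1 hy
        have e : ρ x = ρ y := Nat.succ.inj e
        exact congrArg _ ((List.idxOf_inj hx').1 (Nat.add_left_cancel e))
      · rw [inBinders_enc]
        exact not_mem_shiftSubst hfresh
  | res a P, σ => by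
      have hfresh : ∀ c ∈ P.fn, c ∉ [a] → ∀ x ∈ [a], (fun _ => pick σ P [a]) x ∉ (σ c).names :=
        fun c hc hx x _ h => absurd (lt_pick hc hx h) (Nat.lt_irrefl _)
      rw [subst_res, enc, enc]
      refine (Alpha.res _ (alpha_enc_subst P _)).trans ?_
      have : under σ P [a] = bindAs (fun _ => pick σ P [a]) [a] σ := by
        funext c
        by_cases hc : c = a <;> simp [under, bindAs, hc]
      rw [this, subst_bindAs_shift]
      have h := not_mem_shiftSubst hfresh
      refine .trans ?_ (alpha_subst_res (b := pick σ P [a] + 1) fun c hc hca => ?_).symm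
      · refine .res _ ?_
        have : P.enc.subst (bindAs (shiftName fun _ => pick σ P [a]) (List.map Nat.succ [a])
            (shiftSubst σ)) =
            P.enc.subst (bindAs (fun _ => pick σ P [a] + 1) [a + 1] (shiftSubst σ)) := by
          congr 1
          funext c
          by_cases hc : c = a + 1
          · simp [bindAs, hc, shiftName]
          · simp [bindAs, hc]
        rw [this]
        exact .refl _
      · exact h c hc (by simpa using hca) (a + 1) (by simp)
  | par P Q, σ => by
      simp only [subst, enc]
      exact .par (alpha_enc_subst P σ) (alpha_enc_subst Q σ)
  | cond s t P Q, σ => by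
      simp only [subst, enc, Term.rename_subst]
      exact .cond _ _ (alpha_enc_subst P σ) (alpha_enc_subst Q σ)
  | rep P, σ => by
      simp only [subst, enc]
      exact .rep (alpha_enc_subst P σ)

end Raw

/-- Alpha-equivalence is equality after the identity substitution, and encoding commutes with that
substitution up to alpha-equivalence. -/
theorem enc_alpha {P Q : Raw} (h : Alpha P Q) : Alpha P.enc Q.enc := by
  have h₁ : ∀ P : Raw, Alpha (P.subst Term.name).enc P.enc := fun P => by
    refine (P.alpha_enc_subst _).trans ?_
    have : shiftSubst Term.name = Term.name := by
      funext a
      cases a <;> rfl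
    rw [this]
    exact (Raw.alpha_subst_name _).symm
  refine (h₁ P).symm.trans ?_
  rw [Raw.alpha_iff.1 h]
  exact h₁ Q

/-! ### The encoding preserves the operational semantics -/

section

variable {α : Synchronism} {γ : Medium} {ε : Coordination}

theorem msgOk_enc {m : Msg} (h : Lang.MsgOk ⟨α, .polyadic, γ, .intensional, ε⟩ m) :
    Lang.MsgOk ⟨α, .monadic, γ, .intensional, ε⟩ m.enc :=
  ⟨Lang.chanOk_rename (L := ⟨α, .monadic, γ, .intensional, ε⟩).2 h.1, fun _ => rfl,
    fun _ _ h => absurd rfl h⟩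

theorem partOk_enc {i : InPart} (h : Lang.PartOk ⟨α, .polyadic, γ, .intensional, ε⟩ i) :
    Lang.PartOk ⟨α, .monadic, γ, .intensional, ε⟩ i.enc :=
  ⟨Lang.chanOk_rename (L := ⟨α, .monadic, γ, .intensional, ε⟩).2 h.1, fun _ => rfl,
    fun _ _ => trivial⟩

theorem inputOk_enc {I : List InPart}
    (h : Lang.InputOk ⟨α, .polyadic, γ, .intensional, ε⟩ I) :
    Lang.InputOk ⟨α, .monadic, γ, .intensional, ε⟩ (I.map InPart.enc) := by
  refine ⟨by simpa using h.1, by simpa using h.2.1, ?_, ?_⟩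
  · intro i hi
    obtain ⟨i, hi', rfl⟩ := List.mem_map.1 hi
    exact partOk_enc (h.2.2.1 i hi')
  · rw [inBinders_enc]
    exact h.2.2.2.map Nat.succ_injective

theorem wf_enc : ∀ {P : Raw}, Lang.Wf ⟨α, .polyadic, γ, .intensional, ε⟩ P →
    Lang.Wf ⟨α, .monadic, γ, .intensional, ε⟩ P.enc
  | .nil, _ => trivial
  | .ok, _ => trivial
  | .outA _, h => ⟨h.1, msgOk_enc h.2⟩
  | .outS _ _, h => ⟨h.1, msgOk_enc h.2.1, wf_enc h.2.2⟩
  | .inp _ _, h => ⟨inputOk_enc h.1, wf_enc h.2⟩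
  | .res _ P, h => wf_enc (P := P) h
  | .par _ _, h => ⟨wf_enc h.1, wf_enc h.2⟩
  | .cond _ _ _ _, h => ⟨wf_enc h.1, wf_enc h.2⟩
  | .rep P, h => wf_enc (P := P) h

/-- Lists of different lengths are rejected at the first terminator, where a name meets a compound
pattern or a compound term meets a name-match. At equal lengths the reserved name `0` matches
itself. -/
theorem matchTerm_pack : ∀ (ts : List Term) (ps : List Pat),
    matchTerm (Term.pack ts) (Pat.pack ps) =
      (polyMatch ts ps).map (renamePairs Nat.succ Nat.succ)
  | [], [] => by simp [Term.pack, Pat.pack, matchTerm, polyMatch, renamePairs]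
  | t :: ts, p :: ps => by
      simp only [Term.pack, Pat.pack, matchTerm, matchTerm_rename Nat.succ_injective,
        matchTerm_pack ts ps, polyMatch]
      cases matchTerm t p <;> cases polyMatch ts ps <;> simp [renamePairs]
  | [], _ :: _ => rfl
  | _ :: _, [] => rfl

theorem joinMatch_enc : ∀ (ms : List Msg) (I : List InPart),
    joinMatch (ms.map Msg.enc) (I.map InPart.enc) =
      (joinMatch ms I).map (renamePairs Nat.succ Nat.succ)
  | [], [] => rfl
  | m :: ms, i :: I => by
      simp only [List.map_cons, joinMatch, joinMatch_enc ms I, Msg.enc, InPart.enc,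
        chan_rename_eq_iff Nat.succ_injective, polyMatch, matchTerm_pack]
      split_ifs
      · cases polyMatch m.args i.pats <;> cases joinMatch ms I <;> simp [renamePairs]
      · rfl
  | [], _ :: _ => rfl
  | _ :: _, [] => rfl

theorem shiftSubst_listSubst (σ : List (Name × Term)) :
    shiftSubst (listSubst σ) = listSubst (renamePairs Nat.succ Nat.succ σ) := by
  funext a
  cases a with
  | zero =>
      have : (renamePairs Nat.succ Nat.succ σ).lookup 0 = none := by
        rw [List.lookup_eq_none_iff]
        intro p hp
        obtain ⟨x, -, rfl⟩ := List.mem_map.1 hp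
        simp
      rw [listSubst, this]
      rfl
  | succ a => exact (listSubst_renamePairs Nat.succ_injective a σ).symm

theorem alpha_enc_listSubst (Q : Raw) (σ : List (Name × Term)) :
    Alpha (Q.enc.subst (listSubst (renamePairs Nat.succ Nat.succ σ)))
      (Q.subst (listSubst σ)).enc := by
  rw [← shiftSubst_listSubst]
  exact (Q.alpha_enc_subst _).symm

theorem Raw.enc_foldr {β : Type} (F : β → Raw) (bs : List β) (R : Raw) :
    (bs.foldr (fun b R => .par (F b) R) R).enc =
      bs.foldr (fun b R => .par (F b).enc R) R.enc := by
  induction bs with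
  | nil => rfl
  | cons b bs ih => simp only [List.foldr_cons, Raw.enc, ih]

theorem struct_enc {P Q : Raw} (h : Struct ⟨α, .polyadic, γ, .intensional, ε⟩ P Q) :
    Struct ⟨α, .monadic, γ, .intensional, ε⟩ P.enc Q.enc := by
  induction h with
  | refl => exact .refl _
  | symm _ ih => exact ih.symm
  | trans _ _ ih ih' => exact ih.trans ih'
  | alpha h => exact .alpha (enc_alpha h)
  | par_nil => exact .par_nil _
  | par_comm => exact .par_comm _ _
  | par_assoc => exact .par_assoc _ _ _
  | cond_eq s t P Q h hQ => exact .cond_eq _ _ _ _ (h ▸ rfl) (wf_enc hQ)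
  | cond_ne s t P Q h hP =>
      exact .cond_ne _ _ _ _ (fun e => h (Term.rename_injective Nat.succ_injective e)) (wf_enc hP)
  | res_nil => exact .res_nil _
  | res_comm => exact .res_comm _ _ _
  | extrude a P Q h =>
      refine .extrude _ _ _ fun h' => ?_
      rcases Raw.mem_fn_enc h' with e | ⟨c, hc, e⟩
      · exact absurd e (Nat.succ_ne_zero _)
      · exact h (Nat.succ.inj e ▸ hc)
  | rep_unfold => exact .rep_unfold _
  | par _ _ ih ih' => exact .par ih ih'
  | res a _ ih => exact .res _ ih

theorem red_enc {P Q : Raw} (h : Red ⟨α, .polyadic, γ, .intensional, ε⟩ P Q) :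
    Red ⟨α, .monadic, γ, .intensional, ε⟩ P.enc Q.enc := by
  induction h with
  | commA ms I Q σ h =>
      have h' := joinMatch_enc ms I
      rw [h] at h'
      rw [Raw.enc_foldr]
      have := Red.commA (L := ⟨α, .monadic, γ, .intensional, ε⟩) _ _ Q.enc _ h'
      rw [List.foldr_map] at this
      exact .struct (.refl _) this (.alpha (alpha_enc_listSubst Q σ))
  | commS ms I Q σ h =>
      have h' := joinMatch_enc (ms.map Prod.fst) I
      rw [h] at h'
      rw [Raw.enc_foldr, Raw.enc_foldr]
      have := Red.commS (L := ⟨α, .monadic, γ, .intensional, ε⟩)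
        (ms.map fun m => (m.1.enc, m.2.enc)) _ Q.enc _
        (by rw [List.map_map] at h' ⊢; exact h')
      rw [List.foldr_map, List.foldr_map] at this
      exact .struct (.refl _) this
        (Struct.foldr ms (fun _ _ => .refl _) (.alpha (alpha_enc_listSubst Q σ)))
  | par Q _ ih => exact .par _ ih
  | res a _ ih => exact .res _ ih
  | struct h₁ _ h₂ ih => exact .struct (struct_enc h₁) ih (struct_enc h₂)

end
/-! ### Decoding -/

namespace Term

/-- The items of an encoded list. -/
def items : Term → List Term
  | name _ => []
  | comp s t => s :: t.items

/-- The terminator of an encoded list. -/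
def tail : Term → Name
  | name a => a
  | comp _ t => t.tail

theorem mem_names_items {t : Term} {b : Name} :
    b ∈ t.names ↔ b = t.tail ∨ ∃ s ∈ t.items, b ∈ s.names := by
  induction t with
  | name a => simp [names, tail, items]
  | comp s t _ ih =>
      simp only [names, tail, items, Finset.mem_union, ih, List.mem_cons, exists_eq_or_imp]
      exact or_left_comm

/-- A terminator replaced by a compound term would lengthen the list, hence the hypothesis that its
image is a name. -/
theorem items_subst {σ : Name → Term} : ∀ {t : Term} {b : Name}, σ t.tail = name b →
    (t.subst σ).items = t.items.map (Term.subst σ) ∧ (t.subst σ).tail = b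
  | name a, b, h => by
      have h : σ a = name b := h
      simp [subst, h, items, tail]
  | comp s t, b, h => by
      have := items_subst (t := t) h
      simp [subst, items, tail, this]

end Term

namespace Pat

def items : Pat → List Pat
  | comp p q => p :: q.items
  | _ => []

/-- The value `none` marks a pattern that ends in a binding name. It would accept lists of varying
lengths, so it corresponds to no polyadic pattern. -/
def tail : Pat → Option Name
  | bind _ => none
  | mtch a => some a
  | comp _ q => q.tail

theorem mem_fn_items {p : Pat} {z : Name} (h : p.tail = some z) {b : Name} :
    b ∈ p.fn ↔ b = z ∨ ∃ q ∈ p.items, b ∈ q.fn := by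
  induction p with
  | bind x => cases h
  | mtch a => cases h; simp [fn, items]
  | comp p q _ ih =>
      simp only [fn, items, Finset.mem_union, ih h, List.mem_cons, exists_eq_or_imp]
      exact or_left_comm

theorem binders_items {p : Pat} {z : Name} (h : p.tail = some z) :
    p.items.flatMap binders = p.binders := by
  induction p with
  | bind x => cases h
  | mtch a => rfl
  | comp p q _ ih => simp [items, binders, ih h]

theorem items_subst {ρ : Name → Name} {σ : Name → Term} : ∀ {p : Pat} {z b : Name},
    p.tail = some z → σ z = .name b →
    (p.subst ρ σ).items = p.items.map (Pat.subst ρ σ) ∧ (p.subst ρ σ).tail = some b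
  | bind _, _, _, h, _ => by cases h
  | mtch a, z, b, h, h' => by
      cases h
      simp [subst, h', Term.quote, items, tail]
  | comp p q, z, b, h, h' => by
      have := items_subst (p := q) (ρ := ρ) h h'
      simp [subst, items, tail, this]

end Pat

def Msg.dec (m : Msg) : Msg := ⟨m.chan, m.args.flatMap Term.items⟩

def InPart.dec (i : InPart) : InPart := ⟨i.chan, i.pats.flatMap Pat.items⟩

/-- The data of the message is an encoded list whose terminator is in `W`. -/
def Msg.Tagged (W : Set Name) (m : Msg) : Prop := ∃ t, m.args = [t] ∧ t.tail ∈ W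

def InPart.Tagged (W : Set Name) (i : InPart) : Prop :=
  ∃ p, i.pats = [p] ∧ ∃ z ∈ W, p.tail = some z

section Tagged

variable {W W' : Set Name}

theorem Msg.Tagged.mono {m : Msg} (h : m.Tagged W) (hW : ∀ a ∈ W, a ∈ m.names → a ∈ W') :
    m.Tagged W' := by
  obtain ⟨t, ht, h⟩ := h
  exact ⟨t, ht, hW _ h (mem_names_msg.2 (Or.inr ⟨t, by simp [ht],
    Term.mem_names_items.2 (Or.inl rfl)⟩))⟩

theorem InPart.Tagged.mono {i : InPart} (h : i.Tagged W) (hW : ∀ a ∈ W, a ∈ i.fn → a ∈ W') :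
    i.Tagged W' := by
  obtain ⟨p, hp, z, hz, h⟩ := h
  exact ⟨p, hp, z, hW z hz (InPart.mem_fn.2 (Or.inr ⟨p, by simp [hp],
    (Pat.mem_fn_items h).2 (Or.inl rfl)⟩)), h⟩

theorem Msg.dec_names_subset (m : Msg) : m.dec.names ⊆ m.names := by
  intro b hb
  rw [mem_names_msg] at hb ⊢
  refine hb.imp_right ?_
  rintro ⟨s, hs, hb⟩
  obtain ⟨t, ht, hs⟩ := List.mem_flatMap.1 hs
  exact ⟨t, ht, Term.mem_names_items.2 (Or.inr ⟨s, hs, hb⟩)⟩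

theorem Msg.Tagged.mem_names {m : Msg} (h : m.Tagged W) {b : Name} (hb : b ∈ m.names) :
    b ∈ m.dec.names ∨ b ∈ W := by
  obtain ⟨t, ht, h⟩ := h
  rw [mem_names_msg] at hb ⊢
  simp only [dec, ht, List.mem_singleton, exists_eq_left, List.flatMap_cons, List.flatMap_nil,
    List.append_nil] at hb ⊢
  rcases hb with hb | hb
  · exact Or.inl (Or.inl hb)
  · rcases Term.mem_names_items.1 hb with rfl | hb
    exacts [Or.inr h, Or.inl (Or.inr hb)]

theorem InPart.Tagged.mem_fn {i : InPart} (h : i.Tagged W) {b : Name} :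
    (b ∈ i.dec.fn → b ∈ i.fn) ∧ (b ∈ i.fn → b ∈ i.dec.fn ∨ b ∈ W) := by
  obtain ⟨p, hp, z, hz, h⟩ := h
  simp only [InPart.mem_fn, dec, hp, List.mem_singleton, exists_eq_left, Pat.mem_fn_items h,
    List.flatMap_cons, List.flatMap_nil, List.append_nil]
  refine ⟨fun hb => hb.imp_right Or.inr, ?_⟩
  rintro (hb | rfl | hb)
  exacts [Or.inl (Or.inl hb), Or.inr hz, Or.inl (Or.inr hb)]

theorem InPart.Tagged.binders_dec {i : InPart} (h : i.Tagged W) : i.dec.binders = i.binders := by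
  obtain ⟨p, hp, z, -, h⟩ := h
  simp [InPart.binders, dec, hp, Pat.binders_items h]

theorem inBinders_dec {I : List InPart} (h : ∀ i ∈ I, i.Tagged W) :
    inBinders (I.map InPart.dec) = inBinders I := by
  induction I with
  | nil => rfl
  | cons i I ih =>
      have ih := ih fun j hj => h j (List.mem_cons_of_mem _ hj)
      simp only [inBinders, List.map_cons, List.flatMap_cons] at ih ⊢
      rw [ih, (h i List.mem_cons_self).binders_dec]

theorem Msg.Tagged.subst {m : Msg} (h : m.Tagged W) {σ : Name → Term}
    (hσ : ∀ a ∈ W, a ∈ m.names → ∃ b ∈ W', σ a = .name b) :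
    (m.subst σ).Tagged W' ∧ (m.subst σ).dec = m.dec.subst σ := by
  obtain ⟨t, ht, h⟩ := h
  obtain ⟨b, hb, e⟩ := hσ _ h (mem_names_msg.2 (Or.inr ⟨t, by simp [ht],
    Term.mem_names_items.2 (Or.inl rfl)⟩))
  have := Term.items_subst e
  exact ⟨⟨t.subst σ, by simp [Msg.subst, ht], this.2 ▸ hb⟩,
    by simp [Msg.subst, dec, ht, this.1]⟩

theorem InPart.Tagged.subst {i : InPart} (h : i.Tagged W) {ρ : Name → Name} {σ : Name → Term}
    (hσ : ∀ a ∈ W, a ∈ i.fn → ∃ b ∈ W', σ a = .name b) :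
    (i.subst ρ σ).Tagged W' ∧ (i.subst ρ σ).dec = i.dec.subst ρ σ := by
  obtain ⟨p, hp, z, hz, h⟩ := h
  obtain ⟨b, hb, e⟩ := hσ _ hz (InPart.mem_fn.2 (Or.inr ⟨p, by simp [hp],
    (Pat.mem_fn_items h).2 (Or.inl rfl)⟩))
  have := Pat.items_subst (ρ := ρ) h e
  exact ⟨⟨p.subst ρ σ, by simp [InPart.subst, hp], b, hb, this.2⟩,
    by simp [InPart.subst, dec, hp, this.1]⟩

end Tagged

theorem Pat.map_id (p : Pat) : p.map id id = p := by
  induction p with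
  | bind => rfl
  | mtch => rfl
  | comp p q hp hq => rw [map, hp, hq]

theorem inPart_map_id (I : List InPart) : I.map (InPart.map id id) = I := by
  refine (List.map_congr_left fun i _ => ?_).trans (List.map_id I)
  have h : Term.rename id = id := funext Term.subst_name
  have h' : Pat.map id id = id := funext Pat.map_id
  simp [InPart.map, h, h']

namespace Raw

/-- Names stay shifted here. Alpha-conversion may have turned a bound name into `0`, so shifting
back is left to a capture-avoiding substitution of the free names afterwards. -/
def dec : Raw → Raw
  | nil => nil
  | ok => ok
  | outA m => outA m.dec
  | outS m P => outS m.dec P.dec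
  | inp I P => inp (I.map InPart.dec) P.dec
  | res a P => res a P.dec
  | par P Q => par P.dec Q.dec
  | cond s t P Q => cond s t P.dec Q.dec
  | rep P => rep P.dec

/-- All data are encoded lists, terminated by names in `W` that are not bound. -/
def Tagged : Set Name → Raw → Prop
  | _, nil => True
  | _, ok => True
  | W, outA m => m.Tagged W
  | W, outS m P => m.Tagged W ∧ P.Tagged W
  | W, inp I P => (∀ i ∈ I, i.Tagged W) ∧ P.Tagged (W \ {x | x ∈ inBinders I})
  | W, res a P => P.Tagged (W \ {a})
  | W, par P Q => P.Tagged W ∧ Q.Tagged W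
  | W, cond _ _ P Q => P.Tagged W ∧ Q.Tagged W
  | W, rep P => P.Tagged W

theorem Tagged.mono : ∀ {P : Raw} {W W' : Set Name}, P.Tagged W →
    (∀ a ∈ W, a ∈ P.fn → a ∈ W') → P.Tagged W'
  | nil, _, _, _, _ => trivial
  | ok, _, _, _, _ => trivial
  | outA _, _, _, h, hW => Msg.Tagged.mono h hW
  | outS _ _, _, _, h, hW =>
      ⟨h.1.mono fun a ha h => hW a ha (Finset.mem_union_left _ h),
        h.2.mono fun a ha h => hW a ha (Finset.mem_union_right _ h)⟩
  | inp I P, _, _, h, hW =>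
      ⟨fun i hi => (h.1 i hi).mono fun a ha h =>
        hW a ha (Finset.mem_union_left _ (mem_inFn.2 ⟨i, hi, h⟩)),
        h.2.mono fun a ha h => ⟨hW a ha.1 (Finset.mem_union_right _
          (Finset.mem_sdiff.2 ⟨h, fun h' => ha.2 (List.mem_toFinset.1 h')⟩)), ha.2⟩⟩
  | res b P, _, _, h, hW => Tagged.mono (P := P) h fun a ha h =>
      ⟨hW a ha.1 (Finset.mem_sdiff.2 ⟨h, fun h' => ha.2 (Finset.mem_singleton.1 h')⟩), ha.2⟩
  | par _ _, _, _, h, hW =>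
      ⟨h.1.mono fun a ha h => hW a ha (Finset.mem_union_left _ h),
        h.2.mono fun a ha h => hW a ha (Finset.mem_union_right _ h)⟩
  | cond _ _ _ _, _, _, h, hW =>
      ⟨h.1.mono fun a ha h => hW a ha (by simp [fn, h]),
        h.2.mono fun a ha h => hW a ha (by simp [fn, h])⟩
  | rep P, _, _, h, hW => Tagged.mono (P := P) h hW

theorem Tagged.mem_fn : ∀ {P : Raw} {W : Set Name}, P.Tagged W → ∀ {b : Name},
    (b ∈ P.dec.fn → b ∈ P.fn) ∧ (b ∈ P.fn → b ∈ P.dec.fn ∨ b ∈ W)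
  | nil, _, _, _ => by simp [dec, fn]
  | ok, _, _, _ => by simp [dec, fn]
  | outA m, _, h, _ => ⟨fun h => m.dec_names_subset h, h.mem_names⟩
  | outS m P, _, h, b => by
      have h₁ := h.1.mem_names (b := b)
      have h₂ : b ∈ m.dec.names → b ∈ m.names := fun h => m.dec_names_subset h
      have h₃ := h.2.mem_fn (b := b)
      simp only [dec, fn, Finset.mem_union]
      tauto
  | inp I P, W, h, b => by
      have h₁ := h.2.mem_fn (b := b)
      have h₂ : b ∈ inFn (I.map InPart.dec) → b ∈ inFn I := by
        intro hb
        obtain ⟨_, hi', hb⟩ := mem_inFn.1 hb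
        obtain ⟨i, hi, rfl⟩ := List.mem_map.1 hi'
        exact mem_inFn.2 ⟨i, hi, (h.1 i hi).mem_fn.1 hb⟩
      have h₃ : b ∈ inFn I → b ∈ inFn (I.map InPart.dec) ∨ b ∈ W := by
        intro hb
        obtain ⟨i, hi, hb⟩ := mem_inFn.1 hb
        exact ((h.1 i hi).mem_fn.2 hb).imp_left fun hb =>
          mem_inFn.2 ⟨_, List.mem_map_of_mem hi, hb⟩
      simp only [dec, fn, inBinders_dec h.1, Finset.mem_union, Finset.mem_sdiff,
        List.mem_toFinset]
      simp only [Set.mem_sdiff, Set.mem_ofPred_eq] at h₁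
      tauto
  | res a P, _, h, b => by
      have h₁ := Tagged.mem_fn (P := P) h (b := b)
      simp only [dec, fn, Finset.mem_sdiff, Finset.mem_singleton]
      simp only [Set.mem_sdiff, Set.mem_singleton_iff] at h₁
      tauto
  | par P Q, _, h, b => by
      have h₁ := h.1.mem_fn (b := b)
      have h₂ := h.2.mem_fn (b := b)
      simp only [dec, fn, Finset.mem_union]
      tauto
  | cond s t P Q, _, h, b => by
      have h₁ := h.1.mem_fn (b := b)
      have h₂ := h.2.mem_fn (b := b)
      simp only [dec, fn, Finset.mem_union]
      tauto
  | rep P, _, h, b => Tagged.mem_fn (P := P) h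

theorem Tagged.perm {π : Equiv.Perm Name} : ∀ {P : Raw} {W : Set Name}, P.Tagged W →
    (P.perm π).Tagged (π '' W) ∧ (P.perm π).dec = P.dec.perm π
  | nil, _, _ => ⟨trivial, rfl⟩
  | ok, _, _ => ⟨trivial, rfl⟩
  | outA m, _, h => by
      have := h.subst (W' := π '' _) (σ := fun a => .name (π a)) fun a ha _ => ⟨π a, ⟨a, ha, rfl⟩, rfl⟩
      exact ⟨this.1, congrArg outA this.2⟩
  | outS m P, _, h => by
      have := h.1.subst (W' := π '' _) (σ := fun a => .name (π a))
        fun a ha _ => ⟨π a, ⟨a, ha, rfl⟩, rfl⟩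
      have ih := h.2.perm (π := π)
      exact ⟨⟨this.1, ih.1⟩, by simp only [Raw.perm, dec, this.2, ih.2]⟩
  | inp I P, W, h => by
      have h₁ : ∀ i ∈ I, (i.map π π).Tagged (π '' W) ∧ (i.map π π).dec = i.dec.map π π := by
        intro i hi
        have := (h.1 i hi).subst (W' := π '' _) (ρ := π) (σ := fun a => .name (π a))
          fun a ha _ => ⟨π a, ⟨a, ha, rfl⟩, rfl⟩
        have e : ∀ i : InPart, i.map π π = i.subst π fun a => .name (π a) := fun i => by
          simpa using inPart_map_eq_subst π π [i]
        rwa [e, e]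
      have ih := h.2.perm (π := π)
      refine ⟨⟨?_, ?_⟩, ?_⟩
      · intro i hi
        obtain ⟨i, hi', rfl⟩ := List.mem_map.1 hi
        exact (h₁ i hi').1
      · refine ih.1.mono ?_
        rintro _ ⟨a, ha, rfl⟩ -
        refine ⟨⟨a, ha.1, rfl⟩, fun hx => ha.2 ?_⟩
        simpa [inBinders_map] using hx
      · simp only [Raw.perm, dec, ih.2, List.map_map]
        congr 1
        exact List.map_congr_left fun i hi => (h₁ i hi).2
  | res a P, _, h => by
      have ih := Tagged.perm (π := π) (P := P) h
      refine ⟨Tagged.mono (P := P.perm π) ih.1 ?_, by simp only [Raw.perm, dec, ih.2]⟩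
      rintro _ ⟨c, hc, rfl⟩ -
      exact ⟨⟨c, hc.1, rfl⟩, fun e => hc.2 (π.injective e)⟩
  | par P Q, _, h => by
      have ih := h.1.perm (π := π)
      have ih' := h.2.perm (π := π)
      exact ⟨⟨ih.1, ih'.1⟩, by simp only [Raw.perm, dec, ih.2, ih'.2]⟩
  | cond s t P Q, _, h => by
      have ih := h.1.perm (π := π)
      have ih' := h.2.perm (π := π)
      exact ⟨⟨ih.1, ih'.1⟩, by simp only [Raw.perm, dec, ih.2, ih'.2]⟩
  | rep P, _, h => by
      have ih := Tagged.perm (π := π) (P := P) h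
      exact ⟨ih.1, by simp only [Raw.perm, dec, ih.2]⟩

theorem Tagged.res_rename {π : Equiv.Perm Name} {a : Name} {P : Raw} {W : Set Name}
    (h : (res a P).Tagged W) (hπ : ∀ c ∈ P.fn, c ≠ a → π c = c) :
    (res (π a) (P.perm π)).Tagged W := by
  have h : P.Tagged (W \ {a}) := h
  -- `W` is first cut down to the free names of `P`, as `π` is only known to fix those.
  have h' := (h.mono (W' := (W \ {a}) ∩ P.fn) fun a ha h => ⟨ha, h⟩).perm (π := π)
  refine Tagged.mono (P := P.perm π) h'.1 ?_
  rintro _ ⟨c, ⟨⟨hc, hca⟩, hcP⟩, rfl⟩ -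
  have e := hπ c hcP hca
  exact ⟨e.symm ▸ hc, fun h => hca (π.injective h)⟩

theorem Tagged.inp_rename {π : Equiv.Perm Name} {I : List InPart} {P : Raw} {W : Set Name}
    (h : (inp I P).Tagged W) (hπ : ∀ c ∈ P.fn, c ∉ inBinders I → π c = c) :
    (inp (I.map (InPart.map π id)) (P.perm π)).Tagged W ∧
      Alpha (inp I P).dec (inp (I.map (InPart.map π id)) (P.perm π)).dec := by
  have h₁ : ∀ i ∈ I, (i.map π id).Tagged W ∧ (i.map π id).dec = i.dec.map π id := by
    intro i hi
    have := (h.1 i hi).subst (W' := W) (ρ := π) (σ := fun a => .name (id a))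
      fun a ha _ => ⟨a, ha, rfl⟩
    have e : ∀ i : InPart, i.map π id = i.subst π fun a => .name (id a) := fun i => by
      simpa using inPart_map_eq_subst π id [i]
    rwa [e, e]
  have h' := (h.2.mono (W' := (W \ {x | x ∈ inBinders I}) ∩ P.fn) fun a ha h => ⟨ha, h⟩).perm
    (π := π)
  refine ⟨⟨?_, ?_⟩, ?_⟩
  · intro i hi
    obtain ⟨i, hi', rfl⟩ := List.mem_map.1 hi
    exact (h₁ i hi').1
  · refine h'.1.mono ?_
    rintro _ ⟨c, ⟨⟨hc, hcx⟩, hcP⟩, rfl⟩ -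
    have e := hπ c hcP hcx
    refine ⟨e.symm ▸ hc, fun hx => hcx ?_⟩
    simpa [inBinders_map] using hx
  · have e : (I.map (InPart.map π id)).map InPart.dec =
        (I.map InPart.dec).map (InPart.map π id) := by
      simp only [List.map_map]
      exact List.map_congr_left fun i hi => (h₁ i hi).2
    rw [dec, dec, e, h'.2]
    refine .inp_rename _ _ _ ?_
    rw [inBinders_dec h.1]
    exact fun c hc => hπ c (h.2.mem_fn.1 hc)

theorem tagged_iff_of_alpha {P Q : Raw} (h : Alpha P Q) : ∀ {W : Set Name},
    (P.Tagged W ↔ Q.Tagged W) ∧ (P.Tagged W → Alpha P.dec Q.dec) := by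
  induction h with
  | refl P => exact fun {W} => ⟨Iff.rfl, fun _ => .refl _⟩
  | symm _ ih => exact fun {W} => ⟨ih.1.symm, fun h => (ih.2 (ih.1.2 h)).symm⟩
  | trans _ _ ih ih' =>
      exact fun {W} => ⟨ih.1.trans ih'.1, fun h => (ih.2 h).trans (ih'.2 (ih.1.1 h))⟩
  | res_rename π a P hπ =>
      intro W
      refine ⟨⟨fun h => h.res_rename hπ, fun h => ?_⟩, fun h => ?_⟩
      · simpa [perm_inv_perm] using h.res_rename (res_rename_symm hπ)
      · rw [dec, dec, (Tagged.perm (P := P) h).2]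
        exact .res_rename _ _ _ fun c hc => hπ c ((Tagged.mem_fn (P := P) h).1 hc)
  | inp_rename π I P hπ =>
      intro W
      refine ⟨⟨fun h => (h.inp_rename hπ).1, fun h => ?_⟩, fun h => (h.inp_rename hπ).2⟩
      have := (h.inp_rename (π := π⁻¹) fun c hc hca => by
        obtain ⟨d, hd, rfl⟩ := mem_fn_perm.1 hc
        have hd' : d ∉ inBinders I := fun h => hca (by simpa [inBinders_map] using h)
        rw [Equiv.Perm.inv_eq_iff_eq, hπ d hd hd']
        exact (hπ d hd hd').symm).1
      rw [perm_inv_perm, inPart_map_map] at this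
      have e : (⇑π⁻¹ ∘ ⇑π) = id := by funext; simp
      rwa [e, Function.comp_id, inPart_map_id] at this
  | outS m _ ih =>
      exact fun {W} => ⟨and_congr_right fun _ => ih.1, fun h => .outS _ (ih.2 h.2)⟩
  | inp I _ ih => exact fun {W} => ⟨and_congr_right fun _ => ih.1, fun h => .inp _ (ih.2 h.2)⟩
  | res a _ ih => exact fun {W} => ⟨ih.1, fun h => .res _ (ih.2 h)⟩
  | par _ _ ih ih' =>
      exact fun {W} => ⟨and_congr ih.1 ih'.1, fun h => .par (ih.2 h.1) (ih'.2 h.2)⟩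
  | cond s t _ _ ih ih' =>
      exact fun {W} => ⟨and_congr ih.1 ih'.1, fun h => .cond _ _ (ih.2 h.1) (ih'.2 h.2)⟩
  | rep _ ih => exact fun {W} => ⟨ih.1, fun h => .rep (ih.2 h)⟩

end Raw
/-! ### Decoding and substitutions -/

namespace Raw

theorem pick_add_idxOf_injOn (n : ℕ) (xs : List Name) :
    Set.InjOn (fun x : Name => n + xs.idxOf x) {x | x ∈ xs} := fun _ hx _ _ e =>
  (List.idxOf_inj hx).1 (Nat.add_left_cancel e)

theorem pick_add_idxOf_not_mem {σ : Name → Term} {P : Raw} {xs : List Name} {c x : Name}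
    (hc : c ∈ P.fn) (hx : c ∉ xs) : pick σ P xs + xs.idxOf x ∉ (σ c).names := fun h =>
  absurd (lt_pick hc hx h) (Nat.not_lt.2 (Nat.le_add_right _ _))

theorem under_singleton (σ : Name → Term) (P : Raw) (a : Name) :
    under σ P [a] = bindAs (fun _ => pick σ P [a]) [a] σ := by
  funext c
  by_cases hc : c = a <;> simp [under, bindAs, hc]

/-- The substitution has to fix the terminators. In a reduction it does, because it acts only on the
binding names of the input, and `Tagged` excludes these from the terminators of the continuation. -/
theorem Tagged.subst : ∀ {P : Raw} {W : Set Name} {σ : Name → Term}, P.Tagged W →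
    (∀ w ∈ W, w ∈ P.fn → σ w = .name w) →
      (P.subst σ).Tagged W ∧ Alpha (P.subst σ).dec (P.dec.subst σ)
  | nil, _, _, _, _ => by simp only [Raw.subst, dec]; exact ⟨trivial, .refl _⟩
  | ok, _, _, _, _ => by simp only [Raw.subst, dec]; exact ⟨trivial, .refl _⟩
  | outA m, W, σ, h, hσ => by
      have := Msg.Tagged.subst (W' := W) h fun a ha h' => ⟨a, ha, hσ a ha h'⟩
      simp only [Raw.subst, dec, this.2]
      exact ⟨this.1, .refl _⟩
  | outS m P, W, σ, h, hσ => by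
      have := h.1.subst (W' := W) fun a ha h' => ⟨a, ha, hσ a ha (Finset.mem_union_left _ h')⟩
      have ih := h.2.subst fun a ha h' => hσ a ha (Finset.mem_union_right _ h')
      simp only [Raw.subst, dec, this.2]
      exact ⟨⟨this.1, ih.1⟩, .outS _ ih.2⟩
  | inp I P, W, σ, h, hσ => by
      have hfn : ∀ w ∈ P.fn, w ∉ inBinders I → w ∈ (inp I P).fn := fun w hw hx =>
        Finset.mem_union_right _ (Finset.mem_sdiff.2 ⟨hw, fun h => hx (List.mem_toFinset.1 h)⟩)
      rw [subst_inp]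
      set xs := inBinders I with hxs
      set ρ := fun x => pick σ P xs + xs.idxOf x with hρ
      have h₁ : ∀ i ∈ I, (i.subst ρ σ).Tagged W ∧ (i.subst ρ σ).dec = i.dec.subst ρ σ :=
        fun i hi => (h.1 i hi).subst fun a ha h' =>
          ⟨a, ha, hσ a ha (Finset.mem_union_left _ (mem_inFn.2 ⟨i, hi, h'⟩))⟩
      have ih := (h.2.mono (W' := (W \ {x | x ∈ xs}) ∩ P.fn) fun a ha h => ⟨ha, h⟩).subst
        (σ := under σ P xs) fun w hw _ =>
          (if_neg hw.1.2).trans (hσ w hw.1.1 (hfn w hw.2 hw.1.2))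
      refine ⟨⟨?_, ih.1.mono fun w hw _ => ⟨hw.1.1, fun hx => ?_⟩⟩, ?_⟩
      · intro i hi
        obtain ⟨i, hi', rfl⟩ := List.mem_map.1 hi
        exact (h₁ i hi').1
      · rw [Set.mem_ofPred_eq, Lang.inBinders_subst] at hx
        obtain ⟨x, -, rfl⟩ := List.mem_map.1 hx
        refine pick_add_idxOf_not_mem (σ := σ) (x := x) hw.2 hw.1.2 ?_
        rw [hσ _ hw.1.1 (hfn _ hw.2 hw.1.2)]
        exact Finset.mem_singleton_self _
      · have e : (I.map (InPart.subst ρ σ)).map InPart.dec =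
            (I.map InPart.dec).map (InPart.subst ρ σ) := by
          simp only [List.map_map]
          exact List.map_congr_left fun i hi => (h₁ i hi).2
        rw [dec, dec, e]
        refine (Alpha.inp _ ih.2).trans ?_
        have := alpha_subst_inp (ρ := ρ) (σ := σ) (I := I.map InPart.dec) (P := P.dec)
        rw [inBinders_dec h.1] at this
        exact (this (pick_add_idxOf_injOn _ _) fun c hc hx x _ =>
          pick_add_idxOf_not_mem (h.2.mem_fn.1 hc) hx).symm
  | res a P, W, σ, h, hσ => by
      have h : P.Tagged (W \ {a}) := h
      have hfn : ∀ w ∈ P.fn, w ≠ a → w ∈ (res a P).fn := fun w hw hx =>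
        Finset.mem_sdiff.2 ⟨hw, fun h => hx (Finset.mem_singleton.1 h)⟩
      rw [subst_res]
      have ih := (h.mono (W' := (W \ {a}) ∩ P.fn) fun a ha h => ⟨ha, h⟩).subst
        (σ := under σ P [a]) fun w hw _ =>
          (if_neg (by simpa using hw.1.2)).trans (hσ w hw.1.1 (hfn w hw.2 hw.1.2))
      refine ⟨Tagged.mono (P := P.subst _) ih.1 fun w hw _ => ⟨hw.1.1, fun hx => ?_⟩, ?_⟩
      · have hx : w = pick σ P [a] := hx
        have := lt_pick (σ := σ) (xs := [a]) (d := w) hw.2 (by simpa using hw.1.2) (by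
          rw [hσ _ hw.1.1 (hfn _ hw.2 hw.1.2)]
          exact Finset.mem_singleton_self _)
        rw [← hx] at this
        exact Nat.lt_irrefl _ this
      · rw [dec, dec]
        refine (Alpha.res _ ih.2).trans ?_
        rw [under_singleton]
        exact (alpha_subst_res fun c hc hca h' => Nat.lt_irrefl _
          (lt_pick (h.mem_fn.1 hc) (by simpa using hca) h')).symm
  | par P Q, _, _, h, hσ => by
      have ih := h.1.subst fun a ha h' => hσ a ha (Finset.mem_union_left _ h')
      have ih' := h.2.subst fun a ha h' => hσ a ha (Finset.mem_union_right _ h')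
      simp only [Raw.subst, dec]
      exact ⟨⟨ih.1, ih'.1⟩, .par ih.2 ih'.2⟩
  | cond s t P Q, _, _, h, hσ => by
      have ih := h.1.subst fun a ha h' => hσ a ha (by simp [fn, h'])
      have ih' := h.2.subst fun a ha h' => hσ a ha (by simp [fn, h'])
      simp only [Raw.subst, dec]
      exact ⟨⟨ih.1, ih'.1⟩, .cond _ _ ih.2 ih'.2⟩
  | rep P, _, _, h, hσ => by
      have ih := Tagged.subst (P := P) h hσ
      simp only [Raw.subst, dec]
      exact ⟨ih.1, .rep ih.2⟩

end Raw

/-! ### Encoding a decoded process -/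

theorem Term.pack_items_subst {τ τ' : Name → Term} (h₀ : τ 0 = .name 0) : ∀ {t : Term},
    τ' t.tail = .name 0 → (∀ s ∈ t.items, ∀ a ∈ s.names, τ (a + 1) = τ' a) →
      (pack t.items).subst τ = t.subst τ'
  | name _, h, _ => h₀.trans h.symm
  | comp s t, h, h' => by
      rw [items, pack, subst, subst, pack_items_subst h₀ (t := t) h fun u hu =>
        h' u (List.mem_cons_of_mem _ hu), rename, subst_subst]
      exact congrArg (fun u => comp u _) (subst_congr fun a ha => h' s List.mem_cons_self a ha)

theorem Pat.pack_items_subst {ρ ρ' : Name → Name} {τ τ' : Name → Term} (h₀ : τ 0 = .name 0)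
    {z : Name} (hz : τ' z = .name 0) : ∀ {p : Pat}, p.tail = some z →
    (∀ q ∈ p.items, ∀ a ∈ q.fn, τ (a + 1) = τ' a) → (∀ x, ρ (x + 1) = ρ' x) →
      (pack p.items).subst ρ τ = p.subst ρ' τ'
  | bind _, h, _, _ => by cases h
  | mtch a, h, _, _ => by
      cases h
      simp only [items, pack, subst, h₀, hz]
  | comp p q, h, h', hρ => by
      rw [items, pack, subst, subst, pack_items_subst h₀ hz (p := q) h (fun u hu =>
        h' u (List.mem_cons_of_mem _ hu)) hρ, map_eq_subst, subst_subst]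
      exact congrArg (fun u => comp u _)
        (subst_congr (fun x _ => hρ x) fun a ha => h' p List.mem_cons_self a ha)

theorem chan_rename_subst_congr {τ τ' : Name → Term} {c : Option Term}
    (h : ∀ a ∈ chanNames c, τ (a + 1) = τ' a) :
    (c.map (Term.rename Nat.succ)).map (Term.subst τ) = c.map (Term.subst τ') := by
  cases c with
  | none => rfl
  | some t =>
      refine congrArg some ?_
      rw [Term.rename, Term.subst_subst]
      exact Term.subst_congr h

theorem Msg.Tagged.enc_dec_subst {W : Set Name} {m : Msg} (h : m.Tagged W) (hW : W ⊆ {0})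
    {τ τ' : Name → Term} (h₀ : τ 0 = .name 0) (h₁ : 0 ∈ W → 0 ∈ m.names → τ' 0 = .name 0)
    (h₂ : ∀ a ∈ m.dec.names, τ (a + 1) = τ' a) : m.dec.enc.subst τ = m.subst τ' := by
  obtain ⟨t, ht, hz⟩ := h
  have e : t.tail = 0 := hW hz
  simp only [enc, dec, Msg.subst, ht, List.flatMap_cons, List.flatMap_nil, List.append_nil,
    List.map_cons, List.map_nil]
  rw [chan_rename_subst_congr (c := m.chan) fun a ha => h₂ a (mem_names_msg.2 (Or.inl ha)),
    Term.pack_items_subst h₀]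
  · rw [e]
    refine h₁ (e ▸ hz) (mem_names_msg.2 (Or.inr ⟨t, by simp [ht], ?_⟩))
    exact Term.mem_names_items.2 (Or.inl e.symm)
  · exact fun s hs a ha => h₂ a (mem_names_msg.2 (Or.inr ⟨s, by simp [dec, ht, hs], ha⟩))

theorem InPart.Tagged.enc_dec_subst {W : Set Name} {i : InPart} (h : i.Tagged W) (hW : W ⊆ {0})
    {ρ ρ' : Name → Name} {τ τ' : Name → Term} (h₀ : τ 0 = .name 0)
    (h₁ : 0 ∈ W → 0 ∈ i.fn → τ' 0 = .name 0) (h₂ : ∀ a ∈ i.dec.fn, τ (a + 1) = τ' a)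
    (hρ : ∀ x, ρ (x + 1) = ρ' x) : i.dec.enc.subst ρ τ = i.subst ρ' τ' := by
  obtain ⟨p, hp, z, hz, h⟩ := h
  have e : z = 0 := hW hz
  subst e
  simp only [enc, dec, InPart.subst, hp, List.flatMap_cons, List.flatMap_nil, List.append_nil,
    List.map_cons, List.map_nil]
  rw [chan_rename_subst_congr (c := i.chan) fun a ha => h₂ a (InPart.mem_fn.2 (Or.inl ha)),
    Pat.pack_items_subst h₀ _ h _ hρ]
  · refine h₁ hz (InPart.mem_fn.2 (Or.inr ⟨p, by simp [hp], ?_⟩))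
    exact (Pat.mem_fn_items h).2 (Or.inl rfl)
  · exact fun s hs a ha => h₂ a (InPart.mem_fn.2 (Or.inr ⟨s, by simp [dec, hp, hs], ha⟩))

theorem Term.rename_subst_congr {τ τ' : Name → Term} {t : Term}
    (h : ∀ a ∈ t.names, τ (a + 1) = τ' a) : (t.rename Nat.succ).subst τ = t.subst τ' := by
  rw [rename, subst_subst]
  exact subst_congr h

namespace Raw

/-- Stated for two substitutions that agree up to the shift, because below a binder the re-encoded
process and the original have different names to rename. The case of interest is
`Tagged.alpha_enc_dec`, with the shift back and the identity. -/
theorem Tagged.alpha_enc_dec_subst : ∀ {P : Raw} {W : Set Name} {τ τ' : Name → Term}, P.Tagged W →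
    W ⊆ {0} → τ 0 = .name 0 → (0 ∈ W → 0 ∈ P.fn → τ' 0 = .name 0) →
    (∀ a ∈ P.dec.fn, τ (a + 1) = τ' a) → Alpha (P.dec.enc.subst τ) (P.subst τ')
  | nil, _, _, _, _, _, _, _, _ => by simp only [Raw.subst, dec, enc]; exact .refl _
  | ok, _, _, _, _, _, _, _, _ => by simp only [Raw.subst, dec, enc]; exact .refl _
  | outA m, _, _, _, h, hW, h₀, h₁, h₂ => by
      simp only [Raw.subst, dec, enc, Msg.Tagged.enc_dec_subst h hW h₀ h₁ h₂]
      exact .refl _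
  | outS m P, _, _, _, h, hW, h₀, h₁, h₂ => by
      simp only [Raw.subst, dec, enc, h.1.enc_dec_subst hW h₀
        (fun hw h => h₁ hw (Finset.mem_union_left _ h))
        (fun a h => h₂ a (Finset.mem_union_left _ h))]
      exact .outS _ (h.2.alpha_enc_dec_subst hW h₀
        (fun hw h => h₁ hw (Finset.mem_union_right _ h))
        fun a h => h₂ a (Finset.mem_union_right _ h))
  | inp I P, W, τ, τ', h, hW, h₀, h₁, h₂ => by
      have hfn : ∀ w ∈ P.fn, w ∉ inBinders I → w ∈ (inp I P).fn := fun w hw hx =>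
        Finset.mem_union_right _ (Finset.mem_sdiff.2 ⟨hw, fun h => hx (List.mem_toFinset.1 h)⟩)
      have hfn' : ∀ w ∈ P.dec.fn, w ∉ inBinders I → w ∈ (inp I P).dec.fn := fun w hw hx =>
        Finset.mem_union_right _ (Finset.mem_sdiff.2 ⟨hw, fun h' => hx (by
          rwa [List.mem_toFinset, inBinders_dec h.1] at h')⟩)
      have hb : inBinders ((I.map InPart.dec).map InPart.enc) = (inBinders I).map Nat.succ := by
        rw [inBinders_enc, inBinders_dec h.1]
      rw [subst_inp, dec, enc]
      set xs := inBinders I with hxs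
      set ρ := fun x => pick τ' P xs + xs.idxOf x with hρ
      -- The binders of the re-encoded input are shifted; `x - 1` undoes the shift, so both sides
      -- receive the names picked on the right.
      have e : ((I.map InPart.dec).map InPart.enc).map (InPart.subst (fun x => ρ (x - 1)) τ) =
          I.map (InPart.subst ρ τ') := by
        simp only [List.map_map]
        refine List.map_congr_left fun i hi => (h.1 i hi).enc_dec_subst hW h₀
          (fun hw h => h₁ hw (Finset.mem_union_left _ (mem_inFn.2 ⟨i, hi, h⟩)))
          (fun a h => h₂ a (Finset.mem_union_left _
            (mem_inFn.2 ⟨_, List.mem_map_of_mem hi, h⟩))) fun x => rfl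
      refine (alpha_subst_inp (ρ := fun x => ρ (x - 1)) ?_ ?_).trans ?_
      · intro x hx y hy e
        rw [Set.mem_ofPred_eq, hb] at hx hy
        obtain ⟨x, hx', rfl⟩ := List.mem_map.1 hx
        obtain ⟨y, hy', rfl⟩ := List.mem_map.1 hy
        exact congrArg _ (pick_add_idxOf_injOn _ _ hx' hy' e)
      · intro c hc hcx x hx h'
        rw [hb] at hcx hx
        -- The terminator escapes capture because picked names are positive.
        rcases mem_fn_enc hc with rfl | ⟨a, ha, rfl⟩
        · rw [h₀, Term.names, Finset.mem_singleton] at h'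
          have h' : pick τ' P xs + xs.idxOf (x - 1) = 0 := h'
          have := one_le_pick τ' P xs
          have h₃ := (Nat.add_eq_zero_iff.1 h').1
          rw [h₃] at this
          exact absurd this (by decide)
        · have hax : a ∉ xs := fun h => hcx (List.mem_map.2 ⟨a, h, rfl⟩)
          rw [h₂ a (hfn' a ha hax)] at h'
          exact pick_add_idxOf_not_mem (h.2.mem_fn.1 ha) hax h'
      · rw [e, hb]
        refine .inp _ (h.2.alpha_enc_dec_subst (fun w hw => hW hw.1) ?_ ?_ ?_)
        · simpa [bindAs] using h₀
        · exact fun hw h => (if_neg hw.2).trans (h₁ hw.1 (hfn 0 h hw.2))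
        · intro a ha
          by_cases hax : a ∈ xs
          · simp [bindAs, under, hax, hρ]
          · simp only [bindAs, under, hax, if_false]
            rw [if_neg (by simpa using hax)]
            exact h₂ a (hfn' a ha hax)
  | res b P, W, τ, τ', h, hW, h₀, h₁, h₂ => by
      have h : P.Tagged (W \ {b}) := h
      have hfn : ∀ w ∈ P.fn, w ≠ b → w ∈ (res b P).fn := fun w hw hx =>
        Finset.mem_sdiff.2 ⟨hw, fun h => hx (Finset.mem_singleton.1 h)⟩
      have hfn' : ∀ w ∈ P.dec.fn, w ≠ b → w ∈ (res b P).dec.fn := fun w hw hx =>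
        Finset.mem_sdiff.2 ⟨hw, fun h => hx (Finset.mem_singleton.1 h)⟩
      rw [subst_res, dec, enc]
      refine (alpha_subst_res (b := pick τ' P [b]) ?_).trans (.res _ ?_)
      · intro c hc hcb h'
        rcases mem_fn_enc hc with rfl | ⟨a, ha, rfl⟩
        · rw [h₀, Term.names, Finset.mem_singleton] at h'
          have := one_le_pick τ' P [b]
          rw [h'] at this
          exact absurd this (by decide)
        · have hab : a ≠ b := fun h => hcb (by rw [h])
          rw [h₂ a (hfn' a ha hab)] at h'
          exact Nat.lt_irrefl _ (lt_pick (h.mem_fn.1 ha) (by simpa using hab) h')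
      · refine h.alpha_enc_dec_subst (fun w hw => hW hw.1) ?_ ?_ ?_
        · simpa [bindAs] using h₀
        · exact fun hw h => (if_neg (by simpa using hw.2)).trans (h₁ hw.1 (hfn 0 h hw.2))
        · intro a ha
          by_cases hab : a = b
          · simp [bindAs, under, hab]
          · simp only [bindAs, under, List.mem_singleton, hab, if_false]
            rw [if_neg fun h => hab (Nat.succ.inj h)]
            exact h₂ a (hfn' a ha hab)
  | par P Q, _, _, _, h, hW, h₀, h₁, h₂ => by
      simp only [Raw.subst, dec, enc]
      exact .par (h.1.alpha_enc_dec_subst hW h₀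
        (fun hw h => h₁ hw (Finset.mem_union_left _ h))
        fun a h => h₂ a (Finset.mem_union_left _ h)) (h.2.alpha_enc_dec_subst hW h₀
        (fun hw h => h₁ hw (Finset.mem_union_right _ h))
        fun a h => h₂ a (Finset.mem_union_right _ h))
  | cond s t P Q, _, _, _, h, hW, h₀, h₁, h₂ => by
      simp only [Raw.subst, dec, enc,
        Term.rename_subst_congr (t := s) fun a ha => h₂ a (by simp [dec, fn, ha]),
        Term.rename_subst_congr (t := t) fun a ha => h₂ a (by simp [dec, fn, ha])]
      exact .cond _ _ (h.1.alpha_enc_dec_subst hW h₀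
        (fun hw h => h₁ hw (by simp [fn, h])) fun a h => h₂ a (by simp [dec, fn, h]))
        (h.2.alpha_enc_dec_subst hW h₀
        (fun hw h => h₁ hw (by simp [fn, h])) fun a h => h₂ a (by simp [dec, fn, h]))
  | rep P, _, _, _, h, hW, h₀, h₁, h₂ => by
      simp only [Raw.subst, dec, enc]
      exact .rep (Tagged.alpha_enc_dec_subst (P := P) h hW h₀ h₁ h₂)

/-- A tagged process is the encoding of its decoding, with the names shifted back. -/
theorem Tagged.alpha_enc_dec {P : Raw} (h : P.Tagged {0}) (h₀ : 0 ∉ P.dec.fn) :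
    Alpha ((P.dec.subst fun a => .name (a - 1)).enc) P := by
  refine (alpha_enc_subst _ _).trans ((h.alpha_enc_dec_subst
    (τ := shiftSubst fun a => .name (a - 1)) (τ' := .name) subset_rfl rfl
    (fun _ _ => rfl) fun a ha => ?_).trans (alpha_subst_name P).symm)
  -- Truncated subtraction would confuse `0` with `1`, but `0` is not free in the decoding.
  cases a with
  | zero => exact absurd ha h₀
  | succ a => rfl

end Raw

/-! ### Decoding an encoded process -/

theorem Term.items_pack : ∀ ts : List Term, (pack ts).items = ts.map (Term.rename Nat.succ)
  | [] => rfl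
  | t :: ts => by rw [pack, items, items_pack ts, List.map_cons]

theorem Term.tail_pack : ∀ ts : List Term, (pack ts).tail = 0
  | [] => rfl
  | _ :: ts => tail_pack ts

theorem Pat.items_pack : ∀ ps : List Pat, (pack ps).items = ps.map (Pat.map Nat.succ Nat.succ)
  | [] => rfl
  | p :: ps => by rw [pack, items, items_pack ps, List.map_cons]

theorem Pat.tail_pack : ∀ ps : List Pat, (pack ps).tail = some 0
  | [] => rfl
  | _ :: ps => tail_pack ps

theorem Msg.dec_enc (m : Msg) : m.enc.dec = m.subst fun a => .name (Nat.succ a) := by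
  simp only [enc, dec, List.flatMap_cons, List.flatMap_nil, List.append_nil, Term.items_pack]
  rfl

theorem InPart.dec_enc (i : InPart) : i.enc.dec = i.map Nat.succ Nat.succ := by
  simp only [enc, dec, List.flatMap_cons, List.flatMap_nil, List.append_nil, Pat.items_pack]
  rfl

namespace Raw

theorem tagged_enc : ∀ {P : Raw} {W : Set Name}, 0 ∈ W → P.enc.Tagged W
  | nil, _, _ => trivial
  | ok, _, _ => trivial
  | outA _, _, h => ⟨_, rfl, (Term.tail_pack _).symm ▸ h⟩
  | outS _ _, _, h => ⟨⟨_, rfl, (Term.tail_pack _).symm ▸ h⟩, tagged_enc h⟩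
  | inp I P, _, h => by
      refine ⟨fun i hi => ?_, tagged_enc ⟨h, fun hx => ?_⟩⟩
      · obtain ⟨i, -, rfl⟩ := List.mem_map.1 hi
        exact ⟨_, rfl, 0, h, Pat.tail_pack _⟩
      · rw [Set.mem_ofPred_eq, inBinders_enc] at hx
        obtain ⟨x, -, e⟩ := List.mem_map.1 hx
        exact Nat.succ_ne_zero _ e
  | res a P, _, h => tagged_enc (P := P) ⟨h, fun e => Nat.succ_ne_zero a (Eq.symm e)⟩
  | par _ _, _, h => ⟨tagged_enc h, tagged_enc h⟩
  | cond _ _ _ _, _, h => ⟨tagged_enc h, tagged_enc h⟩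
  | rep P, _, h => tagged_enc (P := P) h

theorem map_dec_enc (I : List InPart) :
    (I.map InPart.enc).map InPart.dec = I.map (InPart.map Nat.succ Nat.succ) := by
  rw [List.map_map]
  exact List.map_congr_left fun i _ => i.dec_enc

theorem mem_fn_dec_enc : ∀ {P : Raw} {b : Name}, b ∈ P.enc.dec.fn ↔ ∃ a ∈ P.fn, b = a + 1
  | nil, _ => by simp [enc, dec, fn]
  | ok, _ => by simp [enc, dec, fn]
  | outA m, b => by
      simp only [enc, dec, fn, Msg.dec_enc, Msg.mem_names_subst, Term.names, Finset.mem_singleton]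
  | outS m P, b => by
      simp only [enc, dec, fn, Msg.dec_enc, Msg.mem_names_subst, Term.names, Finset.mem_singleton,
        Finset.mem_union, mem_fn_dec_enc (P := P)]
      grind
  | inp I P, b => by
      simp only [enc, dec, fn, map_dec_enc, Finset.mem_union, Finset.mem_sdiff, mem_inFn_map,
        inBinders_map, List.mem_toFinset, List.mem_map, mem_fn_dec_enc (P := P)]
      constructor
      · rintro (⟨a, ha, rfl⟩ | ⟨⟨a, ha, rfl⟩, h⟩)
        · exact ⟨a, Or.inl ha, rfl⟩
        · exact ⟨a, Or.inr ⟨ha, fun hx => h ⟨a, hx, rfl⟩⟩, rfl⟩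
      · rintro ⟨a, ha | ⟨ha, hx⟩, rfl⟩
        · exact Or.inl ⟨a, ha, rfl⟩
        · exact Or.inr ⟨⟨a, ha, rfl⟩, by simpa using hx⟩
  | res c P, b => by
      simp only [enc, dec, fn, Finset.mem_sdiff, Finset.mem_singleton, mem_fn_dec_enc (P := P)]
      constructor
      · rintro ⟨⟨a, ha, rfl⟩, h⟩
        exact ⟨a, ⟨ha, fun e => h (by rw [e])⟩, rfl⟩
      · rintro ⟨a, ⟨ha, h⟩, rfl⟩
        exact ⟨⟨a, ha, rfl⟩, fun e => h (Nat.succ.inj e)⟩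
  | par P Q, _ => by
      simp only [enc, dec, fn, Finset.mem_union, mem_fn_dec_enc (P := P), mem_fn_dec_enc (P := Q)]
      grind
  | cond s t P Q, _ => by
      simp only [enc, dec, fn, Finset.mem_union, mem_fn_dec_enc (P := P), mem_fn_dec_enc (P := Q),
        Term.rename, Term.mem_names_subst, Term.names, Finset.mem_singleton]
      grind
  | rep P, _ => mem_fn_dec_enc (P := P)

theorem pick_dec_enc (σ : Name → Term) (P : Raw) (xs : List Name) :
    pick σ P.enc.dec (xs.map Nat.succ) = pick (fun a => σ (a + 1)) P xs := by
  unfold pick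
  congr 1
  ext b
  simp only [Finset.mem_biUnion, Finset.mem_sdiff, List.mem_toFinset, mem_fn_dec_enc, List.mem_map]
  constructor
  · rintro ⟨_, ⟨⟨a, ha, rfl⟩, h⟩, hb⟩
    exact ⟨a, ⟨ha, fun hx => h ⟨a, hx, rfl⟩⟩, hb⟩
  · rintro ⟨a, ⟨ha, h⟩, hb⟩
    exact ⟨a + 1, ⟨⟨a, ha, rfl⟩, by simpa using h⟩, hb⟩

theorem under_dec_enc (σ : Name → Term) (P : Raw) (xs : List Name) (c : Name) :
    under σ P.enc.dec (xs.map Nat.succ) (c + 1) = under (fun a => σ (a + 1)) P xs c := by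
  unfold under
  have h : (xs.map Nat.succ).idxOf (c + 1) = xs.idxOf c :=
    List.idxOf_map_of_injOn (f := Nat.succ) fun y _ h => Nat.succ.inj h
  rw [pick_dec_enc, h]
  simp

/-- Decoding an encoding merely shifts all names. Substitution renames the shifted binders anyway,
so only the shift of the free names is left and equality holds. -/
theorem dec_enc_subst : ∀ (P : Raw) (σ : Name → Term),
    P.enc.dec.subst σ = P.subst fun a => σ (a + 1)
  | nil, _ => by simp only [enc, dec, subst]
  | ok, _ => by simp only [enc, dec, subst]
  | outA m, _ => by simp only [enc, dec, subst, Msg.dec_enc, Msg.subst_subst, Term.subst]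
  | outS m P, _ => by
      simp only [enc, dec, subst, Msg.dec_enc, Msg.subst_subst, Term.subst, dec_enc_subst P]
  | inp I P, σ => by
      rw [enc, dec, map_dec_enc, subst_inp, subst_inp, inBinders_map, dec_enc_subst P,
        pick_dec_enc, inPart_map_eq_subst, inPart_subst_subst]
      simp only [under_dec_enc, Term.subst]
      congr 1
      refine inPart_subst_congr (fun x hx => ?_) fun _ _ => rfl
      rw [List.idxOf_map_of_injOn (f := Nat.succ) fun y _ h => Nat.succ.inj h]
  | res a P, σ => by
      rw [enc, dec, subst_res, subst_res, dec_enc_subst P]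
      have h₁ := pick_dec_enc σ P [a]
      have h₂ := under_dec_enc σ P [a]
      simp only [List.map_cons, List.map_nil] at h₁ h₂
      simp only [h₁, h₂]
  | par P Q, _ => by simp only [enc, dec, subst, dec_enc_subst P, dec_enc_subst Q]
  | cond s t P Q, _ => by
      simp only [enc, dec, subst, dec_enc_subst P, dec_enc_subst Q, Term.rename,
        Term.subst_subst, Term.subst]
  | rep P, _ => by simp only [enc, dec, subst, dec_enc_subst P]

end Raw
/-! ### Decided conditionals

Structural equivalence may add and drop arbitrary processes in the branches of unguarded
conditionals that are not taken; `Raw.trim` resolves these conditionals. -/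

namespace Raw

def trim : Raw → Raw
  | nil => nil
  | ok => ok
  | outA m => outA m
  | outS m P => outS m P
  | inp I P => inp I P
  | res a P => res a P.trim
  | par P Q => par P.trim Q.trim
  | cond s t P Q => if s = t then P.trim else Q.trim
  | rep P => rep P

theorem trim_fn_subset : ∀ P : Raw, P.trim.fn ⊆ P.fn
  | nil | ok | outA _ | outS _ _ | inp _ _ | rep _ => subset_rfl
  | res a P => Finset.sdiff_subset_sdiff (trim_fn_subset P) subset_rfl
  | par P Q => Finset.union_subset_union (trim_fn_subset P) (trim_fn_subset Q)
  | cond s t P Q => by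
      rw [trim]
      split_ifs
      · exact (trim_fn_subset P).trans fun a ha => by simp [fn, ha]
      · exact (trim_fn_subset Q).trans fun a ha => by simp [fn, ha]

theorem trim_enc : ∀ P : Raw, P.enc.trim = P.trim.enc
  | nil | ok | outA _ | outS _ _ | inp _ _ | rep _ => rfl
  | res a P => by simp only [enc, trim, trim_enc P]
  | par P Q => by simp only [enc, trim, trim_enc P, trim_enc Q]
  | cond s t P Q => by
      simp only [enc, trim, (Term.rename_injective Nat.succ_injective).eq_iff, trim_enc P,
        trim_enc Q]
      split_ifs <;> rfl

theorem trim_dec : ∀ P : Raw, P.dec.trim = P.trim.dec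
  | nil | ok | outA _ | outS _ _ | inp _ _ | rep _ => rfl
  | res a P => by simp only [dec, trim, trim_dec P]
  | par P Q => by simp only [dec, trim, trim_dec P, trim_dec Q]
  | cond s t P Q => by
      simp only [dec, trim, trim_dec P, trim_dec Q]
      split_ifs <;> rfl

theorem trim_perm (π : Equiv.Perm Name) : ∀ P : Raw, (P.perm π).trim = P.trim.perm π
  | nil | ok | outA _ | outS _ _ | inp _ _ | rep _ => rfl
  | res a P => by simp only [perm, trim, trim_perm π P]
  | par P Q => by simp only [perm, trim, trim_perm π P, trim_perm π Q]
  | cond s t P Q => by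
      simp only [perm, trim, (Term.rename_injective π.injective).eq_iff, trim_perm π P,
        trim_perm π Q]
      split_ifs <;> rfl

theorem Tagged.trim : ∀ {P : Raw} {W : Set Name}, P.Tagged W → P.trim.Tagged W
  | nil, _, h | ok, _, h | outA _, _, h | outS _ _, _, h | inp _ _, _, h | rep _, _, h => h
  | res a P, _, h => Tagged.trim (P := P) h
  | par P Q, _, h => ⟨h.1.trim, h.2.trim⟩
  | cond s t P Q, _, h => by
      rw [Raw.trim]
      split_ifs
      exacts [h.1.trim, h.2.trim]

theorem alpha_trim {P Q : Raw} (h : Alpha P Q) : Alpha P.trim Q.trim := by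
  induction h with
  | refl => exact .refl _
  | symm _ ih => exact ih.symm
  | trans _ _ ih ih' => exact ih.trans ih'
  | res_rename π a P h =>
      rw [trim, trim, trim_perm]
      exact .res_rename _ _ _ fun c hc => h c (trim_fn_subset P hc)
  | inp_rename π I P h => exact .inp_rename _ _ _ h
  | outS m h _ => exact .outS m h
  | inp I h _ => exact .inp I h
  | res a _ ih => exact .res a ih
  | par _ _ ih ih' => exact .par ih ih'
  | cond s t _ _ ih ih' =>
      rw [trim, trim]
      split_ifs
      exacts [ih, ih']
  | rep h _ => exact .rep h

end Raw

namespace Lang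

variable {L : Lang}

theorem wf_trim : ∀ {P : Raw}, L.Wf P → L.Wf P.trim
  | .nil, h | .ok, h | .outA _, h | .outS _ _, h | .inp _ _, h | .rep _, h => h
  | .res a P, h => wf_trim (P := P) h
  | .par P Q, h => ⟨wf_trim h.1, wf_trim h.2⟩
  | .cond s t P Q, h => by
      rw [Raw.trim]
      split_ifs
      exacts [wf_trim h.1, wf_trim h.2]

theorem struct_trim : ∀ {P : Raw}, L.Wf P → Struct L P P.trim
  | .nil, _ | .ok, _ | .outA _, _ | .outS _ _, _ | .inp _ _, _ | .rep _, _ => .refl _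
  | .res a P, h => .res a (struct_trim (P := P) h)
  | .par P Q, h => .par (struct_trim h.1) (struct_trim h.2)
  | .cond s t P Q, h => by
      rw [Raw.trim]
      split_ifs with e
      · exact (Struct.cond_eq s t P Q e h.2).trans (struct_trim h.1)
      · exact (Struct.cond_ne s t P Q e h.1).trans (struct_trim h.2)

end Lang

/-! ### Matching against decoded patterns -/

/-- There is no converse, because decoding forgets the terminators: two lists whose decodings match
may end in different names. -/
theorem matchTerm_items : ∀ {t : Term} {p : Pat} {z : Name} {σ : List (Name × Term)},
    p.tail = some z → matchTerm t p = some σ → polyMatch t.items p.items = some σ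
  | _, .bind _, _, _, h, _ => by cases h
  | .name a, .mtch b, _, _, _, h => by
      simp only [matchTerm] at h
      split_ifs at h
      exact h
  | .comp s t, .comp p q, _, σ, hz, h => by
      simp only [matchTerm, Option.bind_eq_bind, Option.bind_eq_some_iff, Option.pure_def,
        Option.some.injEq] at h
      obtain ⟨σ₁, h₁, σ₂, h₂, rfl⟩ := h
      simp [Term.items, Pat.items, polyMatch, h₁, matchTerm_items (p := q) hz h₂]
  | .name _, .comp _ _, _, _, _, h => by simp [matchTerm] at h
  | .comp _ _, .mtch _, _, _, _, h => by simp [matchTerm] at h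

theorem joinMatch_dec {W W' : Set Name} : ∀ {ms : List Msg} {I : List InPart}
    {σ : List (Name × Term)}, (∀ m ∈ ms, m.Tagged W) → (∀ i ∈ I, i.Tagged W') →
    joinMatch ms I = some σ → joinMatch (ms.map Msg.dec) (I.map InPart.dec) = some σ
  | [], [], _, _, _, h => h
  | m :: ms, i :: I, σ, hm, hi, h => by
      obtain ⟨t, ht, -⟩ := hm m List.mem_cons_self
      obtain ⟨p, hp, z, -, hz⟩ := hi i List.mem_cons_self
      simp only [joinMatch] at h
      split_ifs at h with hc
      simp only [Option.bind_eq_bind, Option.bind_eq_some_iff, Option.pure_def,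
        Option.some.injEq, ht, hp, polyMatch] at h
      obtain ⟨σ₁, ⟨σ₃, h₁, σ₄, h₃, rfl⟩, σ₂, h₂, rfl⟩ := h
      cases h₃
      have ih := joinMatch_dec (fun m h => hm m (List.mem_cons_of_mem _ h))
        (fun i h => hi i (List.mem_cons_of_mem _ h)) h₂
      have hc' : m.dec.chan = i.dec.chan := hc
      have hp' : polyMatch m.dec.args i.dec.pats = some σ₃ := by
        simp [Msg.dec, InPart.dec, ht, hp, matchTerm_items hz h₁]
      simp [joinMatch, hc', hp', ih]
  | [], _ :: _, _, _, _, h => by simp [joinMatch] at h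
  | _ :: _, [], _, _, _, h => by simp [joinMatch] at h

theorem matchTerm_dom : ∀ {t : Term} {p : Pat} {σ : List (Name × Term)},
    matchTerm t p = some σ →
      σ.map Prod.fst = p.binders ∧ ∀ x ∈ σ, ∀ b ∈ x.2.names, b ∈ t.names
  | t, .bind x, σ, h => by
      have : matchTerm t (.bind x) = some [(x, t)] := by cases t <;> rfl
      rw [this] at h
      cases h
      simp [Pat.binders]
  | .name a, .mtch b, σ, h => by
      simp only [matchTerm] at h
      split_ifs at h
      cases h
      simp [Pat.binders]
  | .comp s t, .comp p q, σ, h => by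
      simp only [matchTerm, Option.bind_eq_bind, Option.bind_eq_some_iff, Option.pure_def,
        Option.some.injEq] at h
      obtain ⟨σ₁, h₁, σ₂, h₂, rfl⟩ := h
      have ih₁ := matchTerm_dom h₁
      have ih₂ := matchTerm_dom h₂
      refine ⟨by simp [Pat.binders, ih₁.1, ih₂.1], fun x hx b hb => ?_⟩
      rcases List.mem_append.1 hx with hx | hx
      · exact Finset.mem_union_left _ (ih₁.2 x hx b hb)
      · exact Finset.mem_union_right _ (ih₂.2 x hx b hb)
  | .name _, .comp _ _, _, h => by simp [matchTerm] at h
  | .comp _ _, .mtch _, _, h => by simp [matchTerm] at h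

theorem polyMatch_dom : ∀ {ts : List Term} {ps : List Pat} {σ : List (Name × Term)},
    polyMatch ts ps = some σ →
      σ.map Prod.fst = ps.flatMap Pat.binders ∧ ∀ x ∈ σ, ∀ b ∈ x.2.names, ∃ t ∈ ts, b ∈ t.names
  | [], [], σ, h => by cases h; simp
  | t :: ts, p :: ps, σ, h => by
      simp only [polyMatch, Option.bind_eq_bind, Option.bind_eq_some_iff, Option.pure_def,
        Option.some.injEq] at h
      obtain ⟨σ₁, h₁, σ₂, h₂, rfl⟩ := h
      have ih₁ := matchTerm_dom h₁
      have ih₂ := polyMatch_dom h₂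
      refine ⟨by simp [ih₁.1, ih₂.1], fun x hx b hb => ?_⟩
      rcases List.mem_append.1 hx with hx | hx
      · exact ⟨t, List.mem_cons_self, ih₁.2 x hx b hb⟩
      · obtain ⟨u, hu, h⟩ := ih₂.2 x hx b hb
        exact ⟨u, List.mem_cons_of_mem _ hu, h⟩
  | [], _ :: _, _, h => by simp [polyMatch] at h
  | _ :: _, [], _, h => by simp [polyMatch] at h

theorem joinMatch_dom : ∀ {ms : List Msg} {I : List InPart} {σ : List (Name × Term)},
    joinMatch ms I = some σ →
      σ.map Prod.fst = inBinders I ∧ ∀ x ∈ σ, ∀ b ∈ x.2.names, ∃ m ∈ ms, b ∈ m.names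
  | [], [], σ, h => by cases h; simp [inBinders]
  | m :: ms, i :: I, σ, h => by
      simp only [joinMatch] at h
      split_ifs at h
      simp only [Option.bind_eq_bind, Option.bind_eq_some_iff, Option.pure_def,
        Option.some.injEq] at h
      obtain ⟨σ₁, h₁, σ₂, h₂, rfl⟩ := h
      have ih₁ := polyMatch_dom h₁
      have ih₂ := joinMatch_dom h₂
      refine ⟨?_, fun x hx b hb => ?_⟩
      · rw [List.map_append, ih₁.1, ih₂.1]
        rfl
      rcases List.mem_append.1 hx with hx | hx
      · obtain ⟨u, hu, h⟩ := ih₁.2 x hx b hb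
        exact ⟨m, List.mem_cons_self, mem_names_msg.2 (Or.inr ⟨u, hu, h⟩)⟩
      · obtain ⟨u, hu, h⟩ := ih₂.2 x hx b hb
        exact ⟨u, List.mem_cons_of_mem _ hu, h⟩
  | [], _ :: _, _, h => by simp [joinMatch] at h
  | _ :: _, [], _, h => by simp [joinMatch] at h

theorem listSubst_of_not_mem {σ : List (Name × Term)} {a : Name} (h : a ∉ σ.map Prod.fst) :
    listSubst σ a = .name a := by
  have : σ.lookup a = none := by
    rw [List.lookup_eq_none_iff]
    intro p hp
    simpa using fun e => h (List.mem_map.2 ⟨p, hp, Eq.symm e⟩)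
  rw [listSubst, this]
  rfl

theorem listSubst_mem_or {σ : List (Name × Term)} (a : Name) :
    (a, listSubst σ a) ∈ σ ∨ (a ∉ σ.map Prod.fst) ∧ listSubst σ a = .name a := by
  by_cases h : a ∈ σ.map Prod.fst
  · refine Or.inl ?_
    induction σ with
    | nil => simp at h
    | cons p σ ih =>
        obtain ⟨b, t⟩ := p
        by_cases e : a = b
        · subst e
          simp [listSubst]
        · have hb : (a == b) = false := by simpa using e
          have h : a ∈ σ.map Prod.fst := by simpa [e] using h
          have := ih h
          simp only [listSubst, List.lookup_cons, hb] at this ⊢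
          exact List.mem_cons_of_mem _ this
  · exact Or.inr ⟨h, listSubst_of_not_mem h⟩

/-! ### Decoding reflects the operational semantics -/

namespace Raw

section foldr

variable {β : Type} {F : β → Raw} {bs : List β} {R : Raw}

theorem dec_foldr : (bs.foldr (fun b R => .par (F b) R) R).dec =
    bs.foldr (fun b R => .par (F b).dec R) R.dec := by
  induction bs with
  | nil => rfl
  | cons b bs ih => simp only [List.foldr_cons, dec, ih]

theorem trim_foldr : (bs.foldr (fun b R => .par (F b) R) R).trim =
    bs.foldr (fun b R => .par (F b).trim R) R.trim := by
  induction bs with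
  | nil => rfl
  | cons b bs ih => simp only [List.foldr_cons, trim, ih]

theorem tagged_foldr {W : Set Name} : (bs.foldr (fun b R => .par (F b) R) R).Tagged W ↔
    (∀ b ∈ bs, (F b).Tagged W) ∧ R.Tagged W := by
  induction bs with
  | nil => simp
  | cons b bs ih => simp only [List.foldr_cons, Tagged, ih, List.forall_mem_cons, and_assoc]

theorem mem_fn_foldr {a : Name} : a ∈ (bs.foldr (fun b R => .par (F b) R) R).fn ↔
    (∃ b ∈ bs, a ∈ (F b).fn) ∨ a ∈ R.fn := by
  induction bs with
  | nil => simp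
  | cons b bs ih => simp [List.foldr_cons, fn, ih, or_assoc]

end foldr

end Raw

section

variable {α : Synchronism} {γ : Medium} {ε : Coordination}

theorem wf_dec : ∀ {P : Raw} {W : Set Name}, Lang.Wf ⟨α, .monadic, γ, .intensional, ε⟩ P →
    P.Tagged W → Lang.Wf ⟨α, .polyadic, γ, .intensional, ε⟩ P.dec := by
  have hm : ∀ m : Msg, Lang.MsgOk ⟨α, .monadic, γ, .intensional, ε⟩ m →
      Lang.MsgOk ⟨α, .polyadic, γ, .intensional, ε⟩ m.dec := fun m h =>
    ⟨h.1, nofun, fun _ _ h => absurd rfl h⟩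
  intro P
  induction P with
  | nil => exact fun _ _ => trivial
  | ok => exact fun _ _ => trivial
  | outA m => exact fun h _ => ⟨h.1, hm m h.2⟩
  | outS m P ih => exact fun h h' => ⟨h.1, hm m h.2.1, ih h.2.2 h'.2⟩
  | inp I P ih =>
      intro W h h'
      refine ⟨⟨by simpa using h.1.1, by simpa using h.1.2.1, fun i hi => ?_, ?_⟩, ih h.2 h'.2⟩
      · obtain ⟨i, hi', rfl⟩ := List.mem_map.1 hi
        exact ⟨(h.1.2.2.1 i hi').1, nofun, fun _ _ => trivial⟩
      · rw [inBinders_dec h'.1]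
        exact h.1.2.2.2
  | res a P ih => exact fun h h' => ih h h'
  | par P Q ih ih' => exact fun h h' => ⟨ih h.1 h'.1, ih' h.2 h'.2⟩
  | cond s t P Q ih ih' => exact fun h h' => ⟨ih h.1 h'.1, ih' h.2 h'.2⟩
  | rep P ih => exact fun h h' => ih h h'

/-- Tagging is carried in both directions to make the symmetry rule provable. The free names of the
decodings are carried along to ensure that `0` never becomes free in a decoding. -/
theorem struct_dec {P Q : Raw} (h : Struct ⟨α, .monadic, γ, .intensional, ε⟩ P Q) :
    Lang.Wf ⟨α, .monadic, γ, .intensional, ε⟩ P → ∀ {W : Set Name},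
      (P.trim.Tagged W ↔ Q.trim.Tagged W) ∧
      (P.trim.Tagged W → Struct ⟨α, .polyadic, γ, .intensional, ε⟩ P.trim.dec Q.trim.dec ∧
        P.trim.dec.fn = Q.trim.dec.fn) := by
  induction h with
  | refl P => exact fun _ {W} => ⟨Iff.rfl, fun _ => ⟨.refl _, rfl⟩⟩
  | symm h ih =>
      intro hw W
      have ih := ih ((Lang.wf_of_struct h).2 hw) (W := W)
      exact ⟨ih.1.symm, fun h => ⟨(ih.2 (ih.1.2 h)).1.symm, (ih.2 (ih.1.2 h)).2.symm⟩⟩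
  | trans h _ ih ih' =>
      intro hw W
      have ih := ih hw (W := W)
      have ih' := ih' ((Lang.wf_of_struct h).1 hw) (W := W)
      exact ⟨ih.1.trans ih'.1, fun h => ⟨(ih.2 h).1.trans (ih'.2 (ih.1.1 h)).1,
        (ih.2 h).2.trans (ih'.2 (ih.1.1 h)).2⟩⟩
  | alpha h =>
      intro _ W
      have := Raw.tagged_iff_of_alpha (Raw.alpha_trim h) (W := W)
      exact ⟨this.1, fun h => ⟨.alpha (this.2 h), Raw.fn_eq_of_alpha (this.2 h)⟩⟩
  | par_nil P =>
      exact fun _ {W} => ⟨and_iff_left trivial, fun _ => ⟨.par_nil _, Finset.union_empty _⟩⟩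
  | par_comm P Q =>
      exact fun _ {W} => ⟨and_comm, fun _ => ⟨.par_comm _ _, Finset.union_comm _ _⟩⟩
  | par_assoc P Q R =>
      exact fun _ {W} => ⟨and_assoc.symm,
        fun _ => ⟨.par_assoc _ _ _, (Finset.union_assoc _ _ _).symm⟩⟩
  | cond_eq s t P Q h hQ =>
      intro _ W
      rw [Raw.trim, if_pos h]
      exact ⟨Iff.rfl, fun _ => ⟨.refl _, rfl⟩⟩
  | cond_ne s t P Q h hP =>
      intro _ W
      rw [Raw.trim, if_neg h]
      exact ⟨Iff.rfl, fun _ => ⟨.refl _, rfl⟩⟩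
  | res_nil a => exact fun _ {W} => ⟨Iff.rfl, fun _ => ⟨.res_nil _, Finset.empty_sdiff _⟩⟩
  | res_comm a b P =>
      intro _ W
      refine ⟨?_, fun _ => ⟨.res_comm _ _ _, sdiff_right_comm _ _ _⟩⟩
      change P.trim.Tagged ((W \ {a}) \ {b}) ↔ P.trim.Tagged ((W \ {b}) \ {a})
      rw [sdiff_right_comm]
  | extrude a P Q h =>
      intro _ W
      have ha : a ∉ P.trim.fn := fun h' => h (Raw.trim_fn_subset P h')
      refine ⟨and_congr_left fun _ => ⟨fun h => h.mono ?_, fun h => h.mono fun c hc _ => hc.1⟩,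
        fun ht => ?_⟩
      · rintro c hc hcP
        exact ⟨hc, fun e => ha (e ▸ hcP)⟩
      · have ha' : a ∉ P.trim.dec.fn := fun h' => ha (ht.1.mem_fn.1 h')
        refine ⟨.extrude _ _ _ ha', ?_⟩
        ext c
        simp only [Raw.trim, Raw.dec, Raw.fn, Finset.mem_union, Finset.mem_sdiff,
          Finset.mem_singleton]
        grind
  | rep_unfold P =>
      intro hw W
      refine ⟨⟨fun h => ⟨Raw.Tagged.trim (P := P) h, h⟩, fun h => h.2⟩, fun h => ⟨?_, ?_⟩⟩
      -- Trimming stops at a replication, so the unfolded copy of `P` is trimmed while the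
      -- replicated one is not. The conditional axioms of the polyadic language bridge the gap,
      -- which is why `P` must be well-formed.
      · refine .trans (.rep_unfold _) (.par ?_ (.refl _))
        rw [← Raw.trim_dec]
        exact Lang.struct_trim (wf_dec (P := P) hw h)
      · change P.dec.fn = P.trim.dec.fn ∪ P.dec.fn
        rw [← Raw.trim_dec]
        exact (Finset.union_eq_right.2 (Raw.trim_fn_subset _)).symm
  | par _ _ ih ih' =>
      intro hw W
      have ih := ih hw.1 (W := W)
      have ih' := ih' hw.2 (W := W)
      refine ⟨and_congr ih.1 ih'.1, fun h => ⟨.par (ih.2 h.1).1 (ih'.2 h.2).1, ?_⟩⟩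
      exact congrArg₂ (· ∪ ·) (ih.2 h.1).2 (ih'.2 h.2).2
  | res a _ ih =>
      intro hw W
      have ih := ih hw (W := W \ {a})
      exact ⟨ih.1, fun h => ⟨.res _ (ih.2 h).1, congrArg (· \ {a}) (ih.2 h).2⟩⟩

/-- The last conjunct bounds the free names of the decoded contractum by those of the decoded redex:
names enter it only through the data of decoded messages, which exclude the terminators. -/
theorem tagged_subst_listSubst {W : Set Name} {ms : List Msg} {I : List InPart} {Q : Raw}
    {σ : List (Name × Term)} (hm : ∀ m ∈ ms, m.Tagged W) (hQ : (Raw.inp I Q).Tagged W)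
    (h : joinMatch ms I = some σ) :
    (Q.subst (listSubst σ)).Tagged W ∧
      Alpha (Q.dec.subst (listSubst σ)) (Q.subst (listSubst σ)).dec ∧
      ∀ b ∈ (Q.subst (listSubst σ)).dec.fn,
        (∃ m ∈ ms, b ∈ m.dec.names) ∨ b ∈ (Raw.inp I Q).dec.fn := by
  have hd := joinMatch_dom h
  have ht := hQ.2.subst (σ := listSubst σ) fun w hw _ =>
    listSubst_of_not_mem fun hx => hw.2 (hd.1 ▸ hx)
  refine ⟨ht.1.mono fun w hw _ => hw.1, ht.2.symm, fun b hb => ?_⟩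
  rw [Raw.fn_eq_of_alpha ht.2] at hb
  obtain ⟨a, ha, hb⟩ := Raw.mem_fn_subst.1 hb
  rcases listSubst_mem_or (σ := σ) a with h' | ⟨h', e⟩
  · obtain ⟨_, hm₁, hb⟩ := (joinMatch_dom (joinMatch_dec hm hQ.1 h)).2 _ h' b hb
    obtain ⟨m, hm', rfl⟩ := List.mem_map.1 hm₁
    exact Or.inl ⟨m, hm', hb⟩
  · rw [e, Term.names, Finset.mem_singleton] at hb
    refine Or.inr (Finset.mem_union_right _ (Finset.mem_sdiff.2 ⟨hb ▸ ha, fun hx => h' ?_⟩))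
    rw [hd.1, ← inBinders_dec hQ.1, ← hb]
    exact List.mem_toFinset.1 hx

/-- The inclusion of free names guarantees that `0`, absent from the decoding of a translation,
remains absent after every reduction. -/
theorem red_dec {P Q : Raw} (h : Red ⟨α, .monadic, γ, .intensional, ε⟩ P Q) :
    Lang.Wf ⟨α, .monadic, γ, .intensional, ε⟩ P → ∀ {W : Set Name}, P.trim.Tagged W →
      Q.trim.Tagged W ∧ Red ⟨α, .polyadic, γ, .intensional, ε⟩ P.trim.dec Q.trim.dec ∧
        Q.trim.dec.fn ⊆ P.trim.dec.fn := by
  induction h with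
  | commA ms I Q σ h =>
      intro hw W ht
      have hw' := Lang.wf_of_red (.commA ms I Q σ h) hw
      have e : (ms.foldr (fun m R => Raw.par (.outA m) R) (.inp I Q)).trim =
        ms.foldr (fun m R => Raw.par (.outA m) R) (.inp I Q) := Raw.trim_foldr (F := Raw.outA)
      rw [e] at ht ⊢
      rw [← Raw.trim_dec]
      have ht' := Raw.tagged_foldr.1 ht
      obtain ⟨h₁, h₂, h₃⟩ := tagged_subst_listSubst ht'.1 ht'.2 h
      refine ⟨h₁.trim, ?_, ?_⟩
      · rw [Raw.dec_foldr]
        have := Red.commA (L := ⟨α, .polyadic, γ, .intensional, ε⟩) _ _ Q.dec _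
          (joinMatch_dec ht'.1 ht'.2.1 h)
        rw [List.foldr_map] at this
        exact .struct (.refl _) this ((Struct.alpha h₂).trans (Lang.struct_trim (wf_dec hw' h₁)))
      · refine (Raw.trim_fn_subset _).trans fun b hb => ?_
        rw [Raw.dec_foldr, Raw.mem_fn_foldr]
        exact h₃ b hb
  | commS ms I Q σ h =>
      intro hw W ht
      have hw' := Lang.wf_of_red (.commS ms I Q σ h) hw
      have e : (ms.foldr (fun m R => Raw.par (.outS m.1 m.2) R) (.inp I Q)).trim =
        ms.foldr (fun m R => Raw.par (.outS m.1 m.2) R) (.inp I Q) :=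
        Raw.trim_foldr (F := fun m : Msg × Raw => Raw.outS m.1 m.2)
      rw [e] at ht ⊢
      rw [← Raw.trim_dec]
      have ht' := Raw.tagged_foldr.1 ht
      have hm : ∀ m ∈ ms.map Prod.fst, m.Tagged W := by
        intro m hm
        obtain ⟨x, hx, rfl⟩ := List.mem_map.1 hm
        exact (ht'.1 x hx).1
      obtain ⟨h₁, h₂, h₃⟩ := tagged_subst_listSubst hm ht'.2 h
      have h₄ := (Raw.tagged_foldr (F := fun x : Msg × Raw => x.2) (bs := ms) (W := W)
        (R := Q.subst (listSubst σ))).2 ⟨fun x hx => (ht'.1 x hx).2, h₁⟩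
      refine ⟨h₄.trim, ?_, ?_⟩
      · rw [Raw.dec_foldr]
        have := Red.commS (L := ⟨α, .polyadic, γ, .intensional, ε⟩)
          (ms.map fun x => (x.1.dec, x.2.dec)) _ Q.dec _ (by
            have := joinMatch_dec hm ht'.2.1 h
            rw [List.map_map] at this ⊢
            exact this)
        rw [List.foldr_map, List.foldr_map] at this
        refine .struct (.refl _) this (.trans ?_ (Lang.struct_trim (wf_dec hw' h₄)))
        rw [Raw.dec_foldr]
        exact Struct.foldr ms (fun _ _ => .refl _) (.alpha h₂)
      · refine (Raw.trim_fn_subset _).trans fun b hb => ?_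
        rw [Raw.dec_foldr, Raw.mem_fn_foldr] at hb ⊢
        rcases hb with ⟨x, hx, hb⟩ | hb
        · exact Or.inl ⟨x, hx, Finset.mem_union_right _ hb⟩
        · refine (h₃ b hb).imp_left ?_
          rintro ⟨m, hm, hb⟩
          obtain ⟨x, hx, rfl⟩ := List.mem_map.1 hm
          exact ⟨x, hx, Finset.mem_union_left _ hb⟩
  | par Q _ ih =>
      intro hw W ht
      obtain ⟨h₁, h₂, h₃⟩ := ih hw.1 ht.1
      exact ⟨⟨h₁, ht.2⟩, .par _ h₂, Finset.union_subset_union h₃ subset_rfl⟩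
  | res a _ ih =>
      intro hw W ht
      obtain ⟨h₁, h₂, h₃⟩ := ih hw ht
      exact ⟨h₁, .res _ h₂, Finset.sdiff_subset_sdiff h₃ subset_rfl⟩
  | struct h hr h' ih =>
      intro hw W ht
      have hw₁ := (Lang.wf_of_struct h).1 hw
      have hs := struct_dec h hw (W := W)
      have hs' := struct_dec h' (Lang.wf_of_red hr hw₁) (W := W)
      obtain ⟨h₁, h₂, h₃⟩ := ih hw₁ (hs.1.1 ht)
      exact ⟨hs'.1.1 h₁, .struct (hs.2 ht).1 h₂ (hs'.2 h₁).1,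
        ((hs'.2 h₁).2.symm.subset.trans h₃).trans (hs.2 ht).2.symm.subset⟩

end
/-! ### The encoding of polyadic into monadic intensional communication is valid -/

/-- Away from `0` the predecessor is injective, so shifting back is a permutation on the names
concerned. Reduction and structural equivalence are equivariant and can be transported along it. -/
theorem Raw.exists_perm_pred {X : Finset Name} (h : 0 ∉ X) : ∃ π : Equiv.Perm Name,
    ∀ P : Raw, P.fn ⊆ X → Alpha (P.perm π) (P.subst fun a => .name (a - 1)) := by
  obtain ⟨π, hπ⟩ := exists_perm_eq_on X (fun a => a - 1) (by
    intro a ha b hb e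
    cases a with
    | zero => exact absurd ha h
    | succ a =>
      cases b with
      | zero => exact absurd hb h
      | succ b => exact congrArg Nat.succ e)
  refine ⟨π, fun P hP => (alpha_perm_subst P π).trans ?_⟩
  rw [subst_congr fun c hc => congrArg Term.name (hπ c (hP hc))]
  exact .refl _

section

variable {α : Synchronism} {γ : Medium} {ε : Coordination}

/-- `T` represents `S`: its decoding, with the names shifted back, is `S`. -/
def Represents (T : Lang.Proc ⟨α, .monadic, γ, .intensional, ε⟩)
    (S : Lang.Proc ⟨α, .polyadic, γ, .intensional, ε⟩) : Prop :=
  T.1.trim.Tagged {0} ∧ 0 ∉ T.1.trim.dec.fn ∧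
    Struct ⟨α, .polyadic, γ, .intensional, ε⟩ S.1 (T.1.trim.dec.subst fun a => .name (a - 1))

/-- Polyadic data are sent as one term. -/
def packEncoding : Encoding ⟨α, .polyadic, γ, .intensional, ε⟩
    ⟨α, .monadic, γ, .intensional, ε⟩ where
  enc P := ⟨P.1.enc, wf_enc P.2⟩
  alpha _ _ h := enc_alpha h
  k := 1
  k_pos := Nat.one_pos
  policy a _ := a + 1

theorem steps_enc {P Q : Lang.Proc ⟨α, .polyadic, γ, .intensional, ε⟩} (h : P.Steps Q) :
    (packEncoding.enc P).Steps (packEncoding.enc Q) :=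
  Relation.ReflTransGen.lift packEncoding.enc (fun _ _ h => red_enc h) _ _ h

theorem represents_enc (S : Lang.Proc ⟨α, .polyadic, γ, .intensional, ε⟩) :
    Represents (packEncoding.enc S) S := by
  have e : (packEncoding.enc S).1.trim = S.1.trim.enc := S.1.trim_enc
  refine ⟨e ▸ Raw.tagged_enc rfl, ?_, ?_⟩
  · rw [e, Raw.mem_fn_dec_enc]
    rintro ⟨a, -, h⟩
    exact Nat.succ_ne_zero a h.symm
  · rw [e, Raw.dec_enc_subst]
    exact (Lang.struct_trim S.2).trans (.alpha (Raw.alpha_subst_name _))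

/-- This makes soundness immediate: a process reached from a translation is itself structurally
equivalent to the translation of what it represents, with no further reduction needed. -/
theorem Represents.struct {T : Lang.Proc ⟨α, .monadic, γ, .intensional, ε⟩}
    {S : Lang.Proc ⟨α, .polyadic, γ, .intensional, ε⟩} (h : Represents T S) :
    Struct ⟨α, .monadic, γ, .intensional, ε⟩ T.1 (packEncoding.enc S).1 :=
  ((Lang.struct_trim T.2).trans (.alpha (h.1.alpha_enc_dec h.2.1).symm)).trans
    (struct_enc h.2.2).symm

/-- The process represented by `T`. -/
def shiftBack (T : Lang.Proc ⟨α, .monadic, γ, .intensional, ε⟩) (h : T.1.trim.Tagged {0}) :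
    Lang.Proc ⟨α, .polyadic, γ, .intensional, ε⟩ :=
  ⟨T.1.trim.dec.subst fun a => .name (a - 1),
    Lang.Wf.subst _ _ (fun _ _ => ⟨_, rfl⟩) (wf_dec (Lang.wf_trim T.2) h)⟩

/-- One target step answers to exactly one source step, so infinite reduction sequences are
reflected. -/
theorem Represents.step {T T' : Lang.Proc ⟨α, .monadic, γ, .intensional, ε⟩}
    {S : Lang.Proc ⟨α, .polyadic, γ, .intensional, ε⟩} (h : Represents T S) (hT : T.Step T') :
    ∃ S', S.Step S' ∧ Represents T' S' := by
  obtain ⟨h₁, h₂, h₃⟩ := red_dec hT T.2 h.1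
  obtain ⟨π, hπ⟩ := Raw.exists_perm_pred h.2.1
  refine ⟨shiftBack T' h₁, ?_, h₁, fun h' => h.2.1 (h₃ h'), .refl _⟩
  exact .struct (h.2.2.trans (.alpha (hπ _ subset_rfl).symm)) (h₂.perm π) (.alpha (hπ _ h₃))

theorem Represents.steps {T T' : Lang.Proc ⟨α, .monadic, γ, .intensional, ε⟩}
    {S : Lang.Proc ⟨α, .polyadic, γ, .intensional, ε⟩} (h : Represents T S) (hT : T.Steps T') :
    ∃ S', S.Steps S' ∧ Represents T' S' := by
  induction hT with
  | refl => exact ⟨S, .refl, h⟩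
  | tail _ h' ih =>
      obtain ⟨S₁, hS₁, h₁⟩ := ih
      obtain ⟨S', hS', h₂⟩ := h₁.step h'
      exact ⟨S', hS₁.tail hS', h₂⟩

theorem Represents.diverges {T : Lang.Proc ⟨α, .monadic, γ, .intensional, ε⟩}
    {S : Lang.Proc ⟨α, .polyadic, γ, .intensional, ε⟩} (h : Represents T S) (hT : T.Diverges) :
    S.Diverges := by
  obtain ⟨f, rfl, hf⟩ := hT
  have hstep : ∀ n (S : {S // Represents (f n) S}),
      ∃ S' : {S // Represents (f (n + 1)) S}, S.1.Step S'.1 := fun n S => by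
    obtain ⟨S', h₁, h₂⟩ := S.2.step (hf n)
    exact ⟨⟨S', h₂⟩, h₁⟩
  choose g hg using hstep
  let F : ∀ n, {S // Represents (f n) S} := fun n => Nat.rec ⟨S, h⟩ g n
  exact ⟨fun n => (F n).1, rfl, fun n => hg n (F n)⟩

theorem Represents.success {T T' : Lang.Proc ⟨α, .monadic, γ, .intensional, ε⟩}
    {S : Lang.Proc ⟨α, .polyadic, γ, .intensional, ε⟩} (h : Represents T S)
    (hT : Struct ⟨α, .monadic, γ, .intensional, ε⟩ T.1 (.par T'.1 .ok)) :
    ∃ S' : Lang.Proc ⟨α, .polyadic, γ, .intensional, ε⟩,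
      Struct ⟨α, .polyadic, γ, .intensional, ε⟩ S.1 (.par S'.1 .ok) := by
  obtain ⟨h₁, h₂⟩ := struct_dec hT T.2 (W := {0})
  obtain ⟨h₃, h₄⟩ := h₂ h.1
  obtain ⟨π, hπ⟩ := Raw.exists_perm_pred h.2.1
  exact ⟨shiftBack T' (h₁.1 h.1).1, (h.2.2.trans (.alpha (hπ _ subset_rfl).symm)).trans
    ((h₃.perm π).trans (.alpha (hπ _ h₄.symm.subset)))⟩

theorem packEncoding_compositional (op : Op) :
    ∃ C : Ctx op.arity, C.IsContext ⟨α, .monadic, γ, .intensional, ε⟩ ∧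
      ∀ S : Fin op.arity → Lang.Proc ⟨α, .polyadic, γ, .intensional, ε⟩,
        Lang.Wf ⟨α, .polyadic, γ, .intensional, ε⟩ (op.app fun i => (S i).1) →
          (op.app fun i => (S i).1).enc = C.fill fun i => (S i).1.enc := by
  have one : ∀ i : Fin 1, [(0 : Fin 1)].count i = 1 := by decide
  have two : ∀ i : Fin 2, ([(0 : Fin 2)] ++ [1]).count i = 1 := by decide
  cases op with
  | nil => exact ⟨.nil, ⟨fun i => i.elim0, fun _ => trivial⟩, fun _ _ => rfl⟩
  | ok => exact ⟨.ok, ⟨fun i => i.elim0, fun _ => trivial⟩, fun _ _ => rfl⟩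
  | outA m =>
      -- An operator whose message is not admissible has no well-formed instance, so any context of
      -- the right arity will do. The same device serves for the other outputs and for inputs.
      by_cases hm : Lang.Wf ⟨α, .polyadic, γ, .intensional, ε⟩ (.outA m)
      · exact ⟨.outA m.enc, ⟨fun i => i.elim0, fun _ => wf_enc hm⟩, fun _ _ => rfl⟩
      · exact ⟨.nil, ⟨fun i => i.elim0, fun _ => trivial⟩, fun _ h => absurd h hm⟩
  | outS m =>
      by_cases hm : α = .synch ∧ Lang.MsgOk ⟨α, .polyadic, γ, .intensional, ε⟩ m
      · exact ⟨.outS m.enc (.hole (0 : Fin 1)),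
          ⟨one, fun T => ⟨hm.1, msgOk_enc hm.2, (T (0 : Fin 1)).2⟩⟩, fun _ _ => rfl⟩
      · exact ⟨.hole (0 : Fin 1), ⟨one, fun T => (T (0 : Fin 1)).2⟩,
          fun _ h => absurd ⟨h.1, h.2.1⟩ hm⟩
  | inp I =>
      by_cases hI : Lang.InputOk ⟨α, .polyadic, γ, .intensional, ε⟩ I
      · exact ⟨.inp (I.map InPart.enc) (.hole (0 : Fin 1)),
          ⟨one, fun T => ⟨inputOk_enc hI, (T (0 : Fin 1)).2⟩⟩, fun _ _ => rfl⟩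
      · exact ⟨.hole (0 : Fin 1), ⟨one, fun T => (T (0 : Fin 1)).2⟩, fun _ h => absurd h.1 hI⟩
  | res a => exact ⟨.res (a + 1) (.hole (0 : Fin 1)), ⟨one, fun T => (T (0 : Fin 1)).2⟩,
      fun _ _ => rfl⟩
  | par => exact ⟨.par (.hole (0 : Fin 2)) (.hole (1 : Fin 2)),
      ⟨two, fun T => ⟨(T (0 : Fin 2)).2, (T (1 : Fin 2)).2⟩⟩, fun _ _ => rfl⟩
  | cond s t => exact ⟨.cond (s.rename Nat.succ) (t.rename Nat.succ) (.hole (0 : Fin 2))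
      (.hole (1 : Fin 2)), ⟨two, fun T => ⟨(T (0 : Fin 2)).2, (T (1 : Fin 2)).2⟩⟩, fun _ _ => rfl⟩
  | rep => exact ⟨.rep (.hole (0 : Fin 1)), ⟨one, fun T => (T (0 : Fin 1)).2⟩, fun _ _ => rfl⟩

theorem finite_domain_shiftSubst {σ : Name → Term} (h : {a | σ a ≠ .name a}.Finite) :
    {a | shiftSubst σ a ≠ .name a}.Finite := by
  refine (h.image Nat.succ).subset fun a ha => ?_
  cases a with
  | zero => exact absurd rfl ha
  | succ a => exact ⟨a, fun e : σ a = .name a => ha (congrArg (Term.rename Nat.succ) e), rfl⟩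

theorem packEncoding_isValid
    {beq : Lang.Proc ⟨α, .monadic, γ, .intensional, ε⟩ →
      Lang.Proc ⟨α, .monadic, γ, .intensional, ε⟩ → Prop}
    (hb : Lang.IsReferenceEquivalence ⟨α, .monadic, γ, .intensional, ε⟩ beq) :
    packEncoding.IsValid beq where
  compositionality op _ := by
    obtain ⟨C, hC, h⟩ := packEncoding_compositional (α := α) (γ := γ) (ε := ε) op
    exact ⟨C, hC, fun S hS _ => h S hS ▸ .refl _⟩
  name_invariance σ :=
    ⟨⟨shiftSubst σ.toFun, finite_domain_shiftSubst σ.finite_domain, fun _ h => absurd rfl h⟩,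
      fun _ _ => rfl, fun S => ⟨fun _ => S.1.alpha_enc_subst _,
        fun _ => hb.of_struct _ _ (.alpha (S.1.alpha_enc_subst _))⟩⟩
  completeness _ S' h :=
    ⟨packEncoding.enc S', steps_enc h, hb.equivalence.refl _⟩
  soundness S T h := by
    obtain ⟨S', hS', h'⟩ := (represents_enc S).steps h
    exact ⟨S', hS', T, .refl, hb.of_struct _ _ h'.struct⟩
  divergence_reflection S h := (represents_enc S).diverges h
  success_sensitiveness S := by
    constructor
    · rintro ⟨P, P', h, h'⟩
      exact ⟨packEncoding.enc P, packEncoding.enc P', steps_enc h,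
        struct_enc h'⟩
    · rintro ⟨T, T', h, h'⟩
      obtain ⟨S', hS', hr⟩ := (represents_enc S).steps h
      obtain ⟨S'', hS''⟩ := hr.success h'
      exact ⟨S', S'', hS', hS''⟩

theorem validlyEncodable_intensional
    {beq : Lang.Proc ⟨α, .monadic, γ, .intensional, ε⟩ →
      Lang.Proc ⟨α, .monadic, γ, .intensional, ε⟩ → Prop}
    (hb : Lang.IsReferenceEquivalence ⟨α, .monadic, γ, .intensional, ε⟩ beq) :
    ValidlyEncodable ⟨α, .polyadic, γ, .intensional, ε⟩ ⟨α, .monadic, γ, .intensional, ε⟩ beq :=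
  ⟨packEncoding, packEncoding_isValid hb⟩

end
end JoinCalc

/-! ### The corollary -/

theorem mainTheorem8
    (beq : ∀ L : JoinCalc.Lang, L.Proc → L.Proc → Prop)
    (hbeq : ∀ L : JoinCalc.Lang, L.IsReferenceEquivalence (beq L))
    (α : JoinCalc.Synchronism) (γ : JoinCalc.Medium) (δ : JoinCalc.Matching)
    (hbinary : ¬ JoinCalc.ValidlyEncodable
      ⟨α, .polyadic, γ, δ, .binary⟩ ⟨α, .monadic, γ, δ, .binary⟩
      (beq ⟨α, .monadic, γ, δ, .binary⟩))
    (ε : JoinCalc.Coordination) :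
    ¬ JoinCalc.ValidlyEncodable
      ⟨α, .polyadic, γ, δ, ε⟩ ⟨α, .monadic, γ, δ, .joining⟩
      (beq ⟨α, .monadic, γ, δ, .joining⟩) := by
  by_cases hI : δ = .intensional
  · subst hI
    exact absurd (JoinCalc.validlyEncodable_intensional (hbeq _)) hbinary
  · exact JoinCalc.not_validlyEncodable_of_ne_intensional hI (hbeq _)
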